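/- Work in the piecewise linear category. An $l$-component link is an embedding of $l$ ordered oriented circles in $\mathbf R^3$. An $l$-component string link is a proper embedding $\sigma$ of $l$ ordered copies of $I=[0,1]$ in $D^2\times I$ such that the $i$-th string runs from the $i$-th of $l$ standard points of $D^2$ at level $0$ to the same point at level $1$. Closing its strings by standard unlinked arcs outside $D^2\times I$ gives its closure, the link $\hat\sigma$. Links are considered up to ambient isotopy, string links up to ambient isotopy fixing the boundary of $D^2\times I$. For $n\ge 1$, two links (or two string links) are $C_n$-equivalent if they are related by a finite sequence of ambient isotopies and of surgeries (or inverses of surgeries) along tree claspers of degree at least $n$. Here the leaves of a tree clasper bound disks, each of which intersects the (string) link in a single point, and the degree is the number of nodes plus one; surgery means surgery along the associated framed link, which has a Hopf clasp on each edge and Borromean rings at each node. They are Self-$C_n$-equivalent if moreover, for each tree clasper that is used, all of its leaves intersect the same component of the (string) link. Proposition. Let $n\ge 1$ and $l\ge 1$, and let $E$ be $C_n$-equivalence or Self-$C_n$-equivalence. The relation $E$ on $l$-component links is generated by isotopy of links and the relation $E$ on $l$-component string links. That is, two $l$-component links $L$ and $L'$ are $E$-equivalent if and only if there are an $m\ge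 1$ and $l$-component string links $\sigma_1,\dots,\sigma_m$ such that $L$ is isotopic to $\hat\sigma_1$, $L'$ is isotopic to $\hat\sigma_m$, and for each $i$ with $1\le i<m$ either $\sigma_i$ and $\sigma_{i+1}$ are $E$-equivalent or $\hat\sigma_i$ and $\hat\sigma_{i+1}$ are isotopic. -/

import Mathlib

/-! Links, string links and tree claspers in the piecewise linear category. -/

noncomputable section

namespace Clasper

/-- Three-dimensional space. Only its topology and its affine structure are used. -/
abbrev Space : Type := Fin 3 → ℝ

/-- `f` is piecewise linear on `s` (with finitely many pieces): it is continuous on `s`, and at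
each point of `s` it agrees with one of finitely many affine maps. On a polyhedron `s` this is the
usual notion, the pieces being cut out by the equations `A x = B x`. -/
def IsPLOn {V W : Type*} [NormedAddCommGroup V] [NormedSpace ℝ V] [NormedAddCommGroup W]
    [NormedSpace ℝ W] (f : V → W) (s : Set V) : Prop :=
  ContinuousOn f s ∧ ∃ 𝒜 : Set (V →ᵃ[ℝ] W), 𝒜.Finite ∧ ∀ x ∈ s, ∃ A ∈ 𝒜, f x = A x

/-- An ambient isotopy of space through piecewise linear homeomorphisms, starting at the identity
and fixing every point outside `U`. -/
structure AmbientIsotopy (U : Set Space) where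
  homeo : unitInterval → Space ≃ₜ Space
  continuous_homeo : Continuous fun p : unitInterval × Space => homeo p.1 p.2
  continuous_symm : Continuous fun p : unitInterval × Space => (homeo p.1).symm p.2
  isPL : ∀ t, IsPLOn (homeo t) Set.univ
  isPL_symm : ∀ t, IsPLOn (homeo t).symm Set.univ
  homeo_zero : ∀ x, homeo 0 x = x
  fixed : ∀ t, ∀ x ∉ U, homeo t x = x

/-- Orientation preserving piecewise linear homeomorphisms of space: those that are isotopic to
the identity. -/
def OrientationPreserving (e : Space ≃ₜ Space) : Prop :=
  ∃ H : AmbientIsotopy Set.univ, H.homeo 1 = e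

/-! ### Links -/

/-- An ordered oriented `l`-component link: a piecewise linear embedding of `l` disjoint copies of
the circle `ℝ / ℤ` into space. -/
structure Link (l : ℕ) where
  toFun : Fin l → UnitAddCircle → Space
  injective : Function.Injective fun p : Fin l × UnitAddCircle => toFun p.1 p.2
  isPL : ∀ i, IsPLOn (fun t : ℝ => toFun i (t : UnitAddCircle)) (Set.Icc 0 1)

/-- Isotopy of ordered oriented links: an ambient isotopy carries each component to the component
with the same index, up to an orientation preserving reparametrization of the circle (the map
induced on `ℝ / ℤ` by `g`). -/
def Link.Isotopic {l : ℕ} (L L' : Link l) : Prop :=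
  ∃ H : AmbientIsotopy Set.univ, ∀ i, ∃ g : ℝ → ℝ,
    Continuous g ∧ StrictMono g ∧ (∀ t, g (t + 1) = g t + 1) ∧
    ∀ t : ℝ, H.homeo 1 (L.toFun i (t : UnitAddCircle)) = L'.toFun i (g t : UnitAddCircle)

/-! ### String links -/

/-- The interior of the cylinder `D² × I`, where `D² = [-1, 1]²` is the (piecewise linear)
standard disk and `I = [0, 1]`. -/
def openCylinder : Set Space :=
  {p | (-1 < p 0 ∧ p 0 < 1) ∧ (-1 < p 1 ∧ p 1 < 1) ∧ (0 < p 2 ∧ p 2 < 1)}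

/-- The `i`-th of the `l` standard points of `D²` is `(basePoint i, 0)`; these points lie in
increasing order on the first axis. -/
def basePoint {l : ℕ} (i : Fin l) : ℝ := -1 + 2 * ((i : ℝ) + 1) / ((l : ℝ) + 1)

/-- An `l`-component string link: a proper piecewise linear embedding of `l` disjoint copies of `I`
into `D² × I` whose `i`-th string runs from the `i`-th standard point at the bottom to the `i`-th
standard point at the top. -/
structure StringLink (l : ℕ) where
  toFun : Fin l → unitInterval → Space
  injective : Function.Injective fun p : Fin l × unitInterval => toFun p.1 p.2
  isPL : ∀ i, IsPLOn (Set.IccExtend zero_le_one (toFun i)) (Set.Icc 0 1)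
  map_zero : ∀ i, toFun i 0 = ![basePoint i, 0, 0]
  map_one : ∀ i, toFun i 1 = ![basePoint i, 0, 1]
  mem_openCylinder : ∀ i t, 0 < t → t < 1 → toFun i t ∈ openCylinder

/-- Isotopy of string links, fixing the boundary of the cylinder, up to orientation preserving
reparametrization of the strings. -/
def StringLink.Isotopic {l : ℕ} (σ σ' : StringLink l) : Prop :=
  ∃ H : AmbientIsotopy openCylinder, ∀ i, ∃ g : unitInterval ≃o unitInterval,
    ∀ t, H.homeo 1 (σ.toFun i t) = σ'.toFun i (g t)

/-! ### The closure of a string link -/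

/-- The standard arc that closes the string at position `x`. It lies in the plane where the second
coordinate is `0`, runs from `(x, 0, 1)` to `(x, 0, 0)` around the right-hand side of the cylinder,
with vertices `(4 - x, 0, 3 - x)` and `(4 - x, 0, x - 2)`. For different `x` in `(-1, 1)` these
arcs are nested. -/
def closingArc (x s : ℝ) : Space :=
  if s ≤ 1 / 3 then ![x + 3 * s * (4 - 2 * x), 0, 1 + 3 * s * (2 - x)]
  else if s ≤ 2 / 3 then ![4 - x, 0, 3 - x - (3 * s - 1) * (5 - 2 * x)]
  else ![x + 3 * (1 - s) * (4 - 2 * x), 0, -(3 * (1 - s) * (2 - x))]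

/-- The `i`-th component of the closure, as a path on `[0, 1]`: first the string, upwards, then the
closing arc. -/
def StringLink.closurePath {l : ℕ} (σ : StringLink l) (i : Fin l) (t : ℝ) : Space :=
  if t ≤ 1 / 2 then Set.IccExtend zero_le_one (σ.toFun i) (2 * t)
  else closingArc (basePoint i) (2 * t - 1)

theorem basePoint_mem {l : ℕ} (i : Fin l) : -1 < basePoint i ∧ basePoint i < 1 := by
  have h1 : (0 : ℝ) ≤ (i : ℝ) := by positivity
  have h2 : (i : ℝ) + 1 ≤ (l : ℝ) := by exact_mod_cast i.2
  have h3 : (0 : ℝ) < (l : ℝ) + 1 := by linarith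
  unfold basePoint
  constructor
  · have : 0 < 2 * ((i : ℝ) + 1) / ((l : ℝ) + 1) := by positivity
    linarith
  · have : 2 * ((i : ℝ) + 1) / ((l : ℝ) + 1) < 2 := by
      rw [div_lt_iff₀ h3]; linarith
    linarith

theorem basePoint_injective {l : ℕ} : Function.Injective (basePoint : Fin l → ℝ) := by
  intro i j h
  have h3 : (0 : ℝ) < (l : ℝ) + 1 := by positivity
  unfold basePoint at h
  have h4 : 2 * ((i : ℝ) + 1) / ((l : ℝ) + 1) = 2 * ((j : ℝ) + 1) / ((l : ℝ) + 1) := by linarith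
  rw [div_left_inj' h3.ne'] at h4
  have h5 : (i : ℝ) = (j : ℝ) := by linarith
  exact Fin.ext (by exact_mod_cast h5)

theorem closingArc_notMem {x s : ℝ} (hx : -1 < x ∧ x < 1) (hs : 0 < s ∧ s < 1) :
    ¬ (closingArc x s 0 ≤ 1 ∧ 0 ≤ closingArc x s 2 ∧ closingArc x s 2 ≤ 1) := by
  rintro ⟨h0, h1, h2⟩
  unfold closingArc at h0 h1 h2
  split_ifs at h0 h1 h2 with c1 c2
  · simp at h2
    nlinarith [mul_pos hs.1 (by linarith [hx.2] : 0 < 2 - x)]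
  · simp at h0
    linarith [hx.2]
  · simp at h1
    nlinarith [mul_pos (by linarith [hs.2] : 0 < 1 - s) (by linarith [hx.2] : 0 < 2 - x)]

theorem closingArc_injective {x y s r : ℝ} (hx : -1 < x ∧ x < 1) (hy : -1 < y ∧ y < 1)
    (hs : 0 < s ∧ s < 1) (hr : 0 < r ∧ r < 1) (h : closingArc x s = closingArc y r) :
    x = y ∧ s = r := by
  have px : 0 < 2 - x := by linarith [hx.2]
  have py : 0 < 2 - y := by linarith [hy.2]
  have h0 : closingArc x s 0 = closingArc y r 0 := by rw [h]
  have h2 : closingArc x s 2 = closingArc y r 2 := by rw [h]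
  clear h
  unfold closingArc at h0 h2
  split_ifs at h0 h2 with c1 c2 c3 c4 c5 c6 c7 c8 <;> simp at h0 h2
  · have hxy : x = y := by nlinarith
    subst hxy
    exact ⟨rfl, mul_right_cancel₀ px.ne' (by linarith)⟩
  · exfalso
    have e1 : 0 ≤ (1 - 3 * s) * (2 - x) := mul_nonneg (by linarith) px.le
    have e2 : 0 < (3 * r - 1) * (5 - 2 * y) := mul_pos (by linarith) (by linarith)
    nlinarith
  · exfalso
    have e1 : 0 < s * (2 - x) := mul_pos hs.1 px
    have e2 : 0 < (1 - r) * (2 - y) := mul_pos (by linarith) py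
    nlinarith
  · exfalso
    have e1 : 0 ≤ (1 - 3 * r) * (2 - y) := mul_nonneg (by linarith) py.le
    have e2 : 0 < (3 * s - 1) * (5 - 2 * x) := mul_pos (by linarith) (by linarith)
    nlinarith
  · have hxy : x = y := by linarith
    subst hxy
    refine ⟨rfl, ?_⟩
    have := mul_right_cancel₀ (by linarith : (5 - 2 * x) ≠ 0)
      (by linarith : (3 * s - 1) * (5 - 2 * x) = (3 * r - 1) * (5 - 2 * x))
    linarith
  · exfalso
    have e1 : 0 < (1 - 3 * (1 - r)) * (2 - y) := mul_pos (by linarith) py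
    have e2 : 0 ≤ (2 - 3 * s) * (5 - 2 * x) := mul_nonneg (by linarith) (by linarith)
    nlinarith
  · exfalso
    have e1 : 0 < r * (2 - y) := mul_pos hr.1 py
    have e2 : 0 < (1 - s) * (2 - x) := mul_pos (by linarith) px
    nlinarith
  · exfalso
    have e1 : 0 < (1 - 3 * (1 - s)) * (2 - x) := mul_pos (by linarith) px
    have e2 : 0 ≤ (2 - 3 * r) * (5 - 2 * y) := mul_nonneg (by linarith) (by linarith)
    nlinarith
  · have hxy : x = y := by nlinarith
    subst hxy
    refine ⟨rfl, ?_⟩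
    have := mul_right_cancel₀ px.ne' (by linarith : (1 - s) * (2 - x) = (1 - r) * (2 - x))
    linarith

theorem StringLink.bounds {l : ℕ} (σ : StringLink l) (i : Fin l) (t : unitInterval) :
    σ.toFun i t 0 ≤ 1 ∧ 0 ≤ σ.toFun i t 2 ∧ σ.toFun i t 2 ≤ 1 := by
  rcases eq_or_ne t 0 with rfl | h0
  · rw [σ.map_zero]
    simp [(basePoint_mem i).2.le]
  rcases eq_or_ne t 1 with rfl | h1
  · rw [σ.map_one]
    simp [(basePoint_mem i).2.le]
  have h := σ.mem_openCylinder i t (unitInterval.pos_iff_ne_zero.2 h0)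
    (unitInterval.lt_one_iff_ne_one.2 h1)
  exact ⟨h.1.2.le, h.2.2.1.le, h.2.2.2.le⟩

theorem StringLink.closurePath_injective {l : ℕ} (σ : StringLink l) {i j : Fin l} {t s : ℝ}
    (ht : t ∈ Set.Ico (0 : ℝ) 1) (hs : s ∈ Set.Ico (0 : ℝ) 1)
    (h : σ.closurePath i t = σ.closurePath j s) : i = j ∧ t = s := by
  unfold StringLink.closurePath at h
  split_ifs at h with c1 c2 c2
  · rw [Set.IccExtend_of_mem _ _ (⟨by linarith [ht.1], by linarith⟩ : 2 * t ∈ Set.Icc (0 : ℝ) 1),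
      Set.IccExtend_of_mem _ _ (⟨by linarith [hs.1], by linarith⟩ : 2 * s ∈ Set.Icc (0 : ℝ) 1)] at h
    have := σ.injective (a₁ := (i, _)) (a₂ := (j, _)) h
    have h1 : i = j := congrArg Prod.fst this
    have h2 : 2 * t = 2 * s := congrArg (fun p : Fin l × unitInterval => (p.2 : ℝ)) this
    exact ⟨h1, by linarith⟩
  · exfalso
    rw [Set.IccExtend_of_mem _ _ (⟨by linarith [ht.1], by linarith⟩ : 2 * t ∈ Set.Icc (0 : ℝ) 1)] at h
    refine closingArc_notMem (basePoint_mem j) (⟨?_, ?_⟩ : 0 < 2 * s - 1 ∧ 2 * s - 1 < 1) ?_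
    · linarith
    · linarith [hs.2]
    · rw [← h]; exact σ.bounds _ _
  · exfalso
    rw [Set.IccExtend_of_mem _ _ (⟨by linarith [hs.1], by linarith⟩ : 2 * s ∈ Set.Icc (0 : ℝ) 1)] at h
    refine closingArc_notMem (basePoint_mem i) (⟨?_, ?_⟩ : 0 < 2 * t - 1 ∧ 2 * t - 1 < 1) ?_
    · linarith
    · linarith [ht.2]
    · rw [h]; exact σ.bounds _ _
  · have := closingArc_injective (basePoint_mem i) (basePoint_mem j)
      ⟨by linarith, by linarith [ht.2]⟩ ⟨by linarith, by linarith [hs.2]⟩ h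
    exact ⟨basePoint_injective this.1, by linarith [this.2]⟩

theorem isPLOn_Icc_affine (a b : Space) (s : Set ℝ) : IsPLOn (fun t : ℝ => a + t • b) s :=
  ⟨by fun_prop, {AffineMap.const ℝ ℝ a + (LinearMap.toSpanSingleton ℝ Space b).toAffineMap},
    Set.finite_singleton _, fun x _ => ⟨_, rfl, by simp⟩⟩

/-- Two piecewise linear paths that fit together form a piecewise linear path. -/
theorem isPLOn_Icc_ite {f g : ℝ → Space} {a b c : ℝ} (hab : a ≤ b) (hbc : b ≤ c)
    (hf : IsPLOn f (Set.Icc a b)) (hg : IsPLOn g (Set.Icc b c)) (h : f b = g b) :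
    IsPLOn (fun t => if t ≤ b then f t else g t) (Set.Icc a c) := by
  obtain ⟨hfc, A, hA, hAf⟩ := hf
  obtain ⟨hgc, B, hB, hBg⟩ := hg
  refine ⟨?_, A ∪ B, hA.union hB, ?_⟩
  · rw [← Set.Icc_union_Icc_eq_Icc hab hbc]
    refine ContinuousOn.union_of_isClosed ?_ ?_ isClosed_Icc isClosed_Icc
    · exact hfc.congr fun t ht => by simp [ht.2]
    · refine hgc.congr fun t ht => ?_
      rcases ht.1.eq_or_lt with rfl | h'
      · simp [h]
      · simp [not_le.2 h']
  · intro t ht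
    by_cases h' : t ≤ b
    · obtain ⟨C, hC, e⟩ := hAf t ⟨ht.1, h'⟩
      exact ⟨C, Or.inl hC, by simp [h', e]⟩
    · obtain ⟨C, hC, e⟩ := hBg t ⟨(not_le.1 h').le, ht.2⟩
      exact ⟨C, Or.inr hC, by simp [h', e]⟩

theorem isPLOn_closingArc (x : ℝ) : IsPLOn (closingArc x) (Set.Icc 0 1) := by
  have e1 := isPLOn_Icc_affine ![x, 0, 1] ![3 * (4 - 2 * x), 0, 3 * (2 - x)] (Set.Icc 0 (1 / 3))
  have e2 := isPLOn_Icc_affine ![4 - x, 0, 3 - x + (5 - 2 * x)] ![0, 0, -(3 * (5 - 2 * x))]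
    (Set.Icc (1 / 3) (2 / 3))
  have e3 := isPLOn_Icc_affine ![x + 3 * (4 - 2 * x), 0, -(3 * (2 - x))]
    ![-(3 * (4 - 2 * x)), 0, 3 * (2 - x)] (Set.Icc (2 / 3) 1)
  have e23 := isPLOn_Icc_ite (by norm_num) (by norm_num) e2 e3
    (by ext k; fin_cases k <;> simp <;> ring)
  have e := isPLOn_Icc_ite (by norm_num) (by norm_num) e1 e23
    (by rw [if_pos (by norm_num)]; ext k; fin_cases k <;> simp <;> ring)
  convert e using 1
  funext s
  unfold closingArc
  split_ifs <;> ext k <;> fin_cases k <;> simp <;> ring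

/-- Reparametrizing a piecewise linear path affinely. -/
theorem IsPLOn.comp_affine {f : ℝ → Space} {s s' : Set ℝ} (hf : IsPLOn f s) (c d : ℝ)
    (h : ∀ t ∈ s', c * t + d ∈ s) : IsPLOn (fun t => f (c * t + d)) s' := by
  obtain ⟨hc, A, hA, hAf⟩ := hf
  refine ⟨hc.comp (by fun_prop) h,
    (fun B : ℝ →ᵃ[ℝ] Space => B.comp (AffineMap.lineMap d (c + d))) '' A, hA.image _, ?_⟩
  intro t ht
  obtain ⟨B, hB, e⟩ := hAf _ (h t ht)
  refine ⟨_, ⟨B, hB, rfl⟩, ?_⟩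
  refine e.trans ?_
  change B _ = B _
  congr 1
  simp [AffineMap.lineMap_apply]
  ring

theorem StringLink.closurePath_isPLOn {l : ℕ} (σ : StringLink l) (i : Fin l) :
    IsPLOn (σ.closurePath i) (Set.Icc 0 1) := by
  have e1 := (σ.isPL i).comp_affine (s' := Set.Icc 0 (1 / 2)) 2 0
    (fun t ht => ⟨by linarith [ht.1], by linarith [ht.2]⟩)
  have e2 := (isPLOn_closingArc (basePoint i)).comp_affine (s' := Set.Icc (1 / 2) 1) 2 (-1)
    (fun t ht => ⟨by linarith [ht.1], by linarith [ht.2]⟩)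
  have e := isPLOn_Icc_ite (by norm_num) (by norm_num) e1 e2 (by
    have h1 : (2 : ℝ) * (1 / 2) + 0 = 1 := by norm_num
    have h2 : (2 : ℝ) * (1 / 2) + -1 = 0 := by norm_num
    rw [h1, h2, Set.IccExtend_right]
    change σ.toFun i 1 = _
    rw [σ.map_one]
    simp [closingArc])
  convert e using 1
  funext t
  simp [StringLink.closurePath, sub_eq_add_neg]

theorem StringLink.closurePath_zero {l : ℕ} (σ : StringLink l) (i : Fin l) :
    σ.closurePath i 0 = σ.closurePath i 1 := by
  have h : ¬ ((1 : ℝ) ≤ 1 / 2) := by norm_num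
  have h' : ¬ ((2 : ℝ) * 1 - 1 ≤ 1 / 3) := by norm_num
  have h'' : ¬ ((2 : ℝ) * 1 - 1 ≤ 2 / 3) := by norm_num
  simp only [StringLink.closurePath, closingArc, h, h', h'', if_false]
  rw [if_pos (by norm_num), mul_zero, Set.IccExtend_left]
  change σ.toFun i 0 = _
  rw [σ.map_zero]
  ext k
  fin_cases k <;> norm_num

theorem StringLink.liftIco_closurePath {l : ℕ} (σ : StringLink l) (i : Fin l) {t : ℝ}
    (ht : t ∈ Set.Icc (0 : ℝ) 1) :
    AddCircle.liftIco (1 : ℝ) 0 (σ.closurePath i) (t : UnitAddCircle) = σ.closurePath i t := by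
  rcases ht.2.eq_or_lt with rfl | h
  · rw [← σ.closurePath_zero i, AddCircle.coe_period]
    exact AddCircle.liftIco_zero_coe_apply ⟨le_rfl, one_pos⟩
  · exact AddCircle.liftIco_zero_coe_apply ⟨ht.1, h⟩

/-- The closure of a string link. -/
def StringLink.closure {l : ℕ} (σ : StringLink l) : Link l where
  toFun i := AddCircle.liftIco (1 : ℝ) 0 (σ.closurePath i)
  injective := by
    rintro ⟨i, x⟩ ⟨j, y⟩ h
    obtain ⟨t, ht, rfl⟩ : ∃ t ∈ Set.Ico (0 : ℝ) (0 + 1), (t : UnitAddCircle) = x := by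
      have := (AddCircle.coe_image_Ico_eq (1 : ℝ) 0) ▸ Set.mem_univ x
      exact this
    obtain ⟨s, hs, rfl⟩ : ∃ t ∈ Set.Ico (0 : ℝ) (0 + 1), (t : UnitAddCircle) = y := by
      have := (AddCircle.coe_image_Ico_eq (1 : ℝ) 0) ▸ Set.mem_univ y
      exact this
    rw [zero_add] at ht hs
    dsimp only at h
    rw [σ.liftIco_closurePath i ⟨ht.1, ht.2.le⟩, σ.liftIco_closurePath j ⟨hs.1, hs.2.le⟩] at h
    obtain ⟨rfl, rfl⟩ := σ.closurePath_injective ht hs h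
    rfl
  isPL i := by
    obtain ⟨hc, A, hA, hAf⟩ := σ.closurePath_isPLOn i
    exact ⟨hc.congr fun t ht => σ.liftIco_closurePath i ht, A, hA, fun t ht => by
      obtain ⟨B, hB, e⟩ := hAf t ht
      exact ⟨B, hB, (σ.liftIco_closurePath i ht).trans e⟩⟩

/-! ### Tree claspers

A tree clasper is a tree shaped surface: bands (the edges) join disks (the nodes, each meeting
three edges) and annuli (the leaves, each meeting one edge). Surgery along it is, by definition,
surgery along the framed link obtained by putting a Hopf clasp on every edge and Borromean rings at
every node; all components of this link are unknots with framing zero. The leaves are simple: each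
one bounds a disk, and the tangle crosses each of these disks exactly once (and is otherwise
disjoint from the clasper and the disks).

In a regular neighbourhood of the tree and of the disks of the leaves, which is a ball, all this
has a standard form, which is described next: a ball made of cubes glued in the pattern of the
tree, the framed link inside it, and the pieces of the tangle that cross the disks. Half twists of
the bands can be pushed towards the leaves and removed there. -/

/-- Planar rooted binary trees. Adding a leaf at the root, such a tree `t` describes a planar tree
all of whose vertices have valence `1` (the leaves) or `3` (the nodes). -/
inductive Tree : Type
  | leaf : Tree
  | node : Tree → Tree → Tree

/-- The number of nodes. -/
def Tree.numNodes : Tree → ℕ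
  | .leaf => 0
  | .node a b => a.numNodes + b.numNodes + 1

/-- The degree of a tree clasper: the number of nodes plus one. -/
def Tree.degree (t : Tree) : ℕ := t.numNodes + 1

/-- A component of a framed link: a closed tubular neighbourhood of the component and the
longitude, on the boundary of this solid torus, that represents the framing. The longitude is
parametrized by the boundary of the square `[-1, 1]²`. -/
structure FramedKnot where
  solid : Set Space
  longitude : ℝ × ℝ → Space

/-- The image of a framed knot under an embedding. -/
def FramedKnot.map (f : Space → Space) (K : FramedKnot) : FramedKnot :=
  ⟨f '' K.solid, f ∘ K.longitude⟩

/-- Half of the thickness of the tubular neighbourhoods. -/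
def thickness : ℝ := 1 / 64

/-- A flat rectangular unknot with framing zero. The core is the boundary of the rectangle with
opposite corners `lo` and `hi`, which lies in a plane parallel to the `i`-th and the `j`-th axis (so
`lo` and `hi` agree in the third coordinate). The longitude is the inner boundary of the flat
rectangular annulus around the core. -/
def rectangle (i j : Fin 3) (lo hi : Space) : FramedKnot where
  solid := {p | ∀ k, lo k - thickness ≤ p k ∧ p k ≤ hi k + thickness} \
    {p | (lo i + thickness < p i ∧ p i < hi i - thickness) ∧
      (lo j + thickness < p j ∧ p j < hi j - thickness)}
  longitude u k :=
    (lo k + hi k) / 2 +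
      (if k = i then u.1 * ((hi i - lo i) / 2 - thickness)
       else if k = j then u.2 * ((hi j - lo j) / 2 - thickness) else 0)

/-- The orientation preserving similarity that puts the standard form of a subtree on the face
`x = 1` of the cube of its parent. -/
def firstChild (p : Space) : Space := ![1 + p 2 / 4, -p 1 / 4, 1 + p 0 / 4]

/-- The orientation preserving similarity that puts the standard form of a subtree on the face
`y = 1` of the cube of its parent. -/
def secondChild (p : Space) : Space := ![p 0 / 4, 1 + p 2 / 4, 1 - p 1 / 4]

/-- The cubes of the vertices of a tree other than the leaf at the root. The root vertex of the
tree occupies `[-1, 1]² × [0, 2]`, its subtrees are scaled by `1 / 4` and put on two faces. -/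
def Tree.upperBall : Tree → Set Space
  | .leaf => Set.Icc ![-1, -1, 0] ![1, 1, 2]
  | .node a b => Set.Icc ![-1, -1, 0] ![1, 1, 2] ∪
      (firstChild '' a.upperBall ∪ secondChild '' b.upperBall)

/-- The components of the framed link that belong to the vertices of a tree other than the leaf at
the root. There is one component for each vertex and each edge at that vertex. The component of an
edge going down reaches down to the height `1 / 4`; it is clasped with the component that comes up
from the parent, which reaches up to the height `1 / 2` and lies in the perpendicular plane. At a
node, the three components are Borromean rings: three rectangles with common center `(0, 0, 1)`, in
perpendicular planes, one elongated towards the parent, the others towards the two children. -/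
def Tree.upperLink : Tree → List FramedKnot
  | .leaf => [rectangle 0 2 ![-1 / 8, 0, 1 / 4] ![1 / 8, 0, 3 / 2]]
  | .node a b =>
      rectangle 0 2 ![-1 / 8, 0, 1 / 4] ![1 / 8, 0, 3 / 2] ::
      rectangle 0 1 ![-1 / 2, -1 / 8, 1] ![9 / 8, 1 / 8, 1] ::
      rectangle 1 2 ![0, -1 / 2, 7 / 8] ![0, 9 / 8, 9 / 8] ::
      (a.upperLink.map (FramedKnot.map firstChild) ++ b.upperLink.map (FramedKnot.map secondChild))

/-- The pieces of tangle that cross the disks of the leaves other than the one at the root: in the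
cube of each leaf, a straight segment perpendicular to the rectangle. -/
def Tree.upperStrands : Tree → Set Space
  | .leaf => segment ℝ ![0, -1, 1] ![0, 1, 1]
  | .node a b => firstChild '' a.upperStrands ∪ secondChild '' b.upperStrands

/-- The ball: the cube `[-1, 1]² × [-2, 0]` of the leaf at the root and the other cubes. -/
def Tree.ball (t : Tree) : Set Space := Set.Icc ![-1, -1, -2] ![1, 1, 0] ∪ t.upperBall

/-- The framed link of the tree clasper in standard form. -/
def Tree.framedLink (t : Tree) : List FramedKnot :=
  rectangle 1 2 ![0, -1 / 2, -3 / 2] ![0, 1 / 2, 1 / 2] :: t.upperLink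

/-- The pieces of tangle that cross the disks of the leaves, one for each leaf. -/
def Tree.strands (t : Tree) : Set Space := segment ℝ ![-1, 0, -1] ![1, 0, -1] ∪ t.upperStrands

/-- The exterior of a framed link. -/
def exterior (𝓛 : List FramedKnot) : Set Space := {p | ∀ K ∈ 𝓛, p ∉ interior K.solid}

/-- `h` identifies the result of surgery along the framed link `𝓛` in `B` with space again, by the
identity outside `B`. Surgery removes the interiors of the solid tori of `𝓛` and glues in solid
tori `D² × S¹` (here `Metric.closedBall 0 1 ×ˢ Metric.sphere 0 1`, since for the maximum norm the
unit ball of `ℝ × ℝ` is the square `[-1, 1]²`) whose meridians `∂D² × {pt}` are attached along the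
longitudes. Thus `h` embeds the exterior of `𝓛`, and there are embeddings `ψ j` of solid tori that
fill the complement of its image in the prescribed way. -/
def IsSurgeryMap (𝓛 : List FramedKnot) (B : Set Space) (h : Space → Space) : Prop :=
  IsPLOn h (exterior 𝓛) ∧ Set.InjOn h (exterior 𝓛) ∧ (∀ x ∉ B, h x = x) ∧
  ∃ ψ : Fin 𝓛.length → (ℝ × ℝ) × (ℝ × ℝ) → Space,
    (∀ j, IsPLOn (ψ j) (Metric.closedBall 0 1 ×ˢ Metric.sphere 0 1)) ∧
    (∀ j, Set.InjOn (ψ j) (Metric.closedBall 0 1 ×ˢ Metric.sphere 0 1)) ∧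
    (Pairwise fun j k => Disjoint (ψ j '' (Metric.closedBall 0 1 ×ˢ Metric.sphere 0 1))
      (ψ k '' (Metric.closedBall 0 1 ×ˢ Metric.sphere 0 1))) ∧
    h '' exterior 𝓛 = (⋃ j, ψ j '' (Metric.ball 0 1 ×ˢ Metric.sphere 0 1))ᶜ ∧
    ∀ j, ∀ u ∈ Metric.sphere (0 : ℝ × ℝ) 1, h ((𝓛.get j).longitude u) = ψ j (u, (1, 0))

/-- A tree clasper with simple leaves in the region `U`, for the tangle in `U` with components
`T i : X → Space`. It is the image of the standard form of a tree under an orientation preserving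
homeomorphism of space (a piecewise linear embedding of a ball in space extends to space). -/
structure TreeClasper (U : Set Space) {ι X : Type} (T : ι → X → Space) where
  tree : Tree
  place : Space ≃ₜ Space
  orientationPreserving : OrientationPreserving place
  ball_subset : place '' tree.ball ⊆ U
  inter_ball : (⋃ i, Set.range (T i)) ∩ place '' tree.ball = place '' tree.strands

/-- The degree of a tree clasper. -/
def TreeClasper.degree {U : Set Space} {ι X : Type} {T : ι → X → Space} (C : TreeClasper U T) : ℕ :=
  C.tree.degree

/-- All leaves of the tree clasper intersect the same component of the tangle. -/
def TreeClasper.IsSelf {U : Set Space} {ι X : Type} {T : ι → X → Space} (C : TreeClasper U T) :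
    Prop :=
  ∃ i, ∀ j, j ≠ i → Disjoint (Set.range (T j)) (C.place '' C.tree.ball)

/-- `T'` is a result of surgery on the tangle `T` along the tree clasper `C`. -/
def TreeClasper.IsResult {U : Set Space} {ι X : Type} {T : ι → X → Space} (C : TreeClasper U T)
    (T' : ι → X → Space) : Prop :=
  ∃ h, IsSurgeryMap C.tree.framedLink C.tree.ball h ∧
    ∀ i x, T' i x = C.place (h (C.place.symm (T i x)))

/-! ### The equivalence relations -/

/-- `C_n`-equivalence of links: generated by isotopy and surgery along tree claspers of degree at
least `n`. -/
def Link.CEquiv (n : ℕ) {l : ℕ} : Link l → Link l → Prop :=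
  Relation.EqvGen fun L L' => L.Isotopic L' ∨
    ∃ C : TreeClasper Set.univ L.toFun, n ≤ C.degree ∧ C.IsResult L'.toFun

/-- Self-`C_n`-equivalence of links: as `C_n`-equivalence, but all leaves of each tree clasper have
to intersect the same component. -/
def Link.SelfCEquiv (n : ℕ) {l : ℕ} : Link l → Link l → Prop :=
  Relation.EqvGen fun L L' => L.Isotopic L' ∨
    ∃ C : TreeClasper Set.univ L.toFun, n ≤ C.degree ∧ C.IsSelf ∧ C.IsResult L'.toFun

/-- `C_n`-equivalence of string links. -/
def StringLink.CEquiv (n : ℕ) {l : ℕ} : StringLink l → StringLink l → Prop :=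
  Relation.EqvGen fun σ σ' => σ.Isotopic σ' ∨
    ∃ C : TreeClasper openCylinder σ.toFun, n ≤ C.degree ∧ C.IsResult σ'.toFun

/-- Self-`C_n`-equivalence of string links. -/
def StringLink.SelfCEquiv (n : ℕ) {l : ℕ} : StringLink l → StringLink l → Prop :=
  Relation.EqvGen fun σ σ' => σ.Isotopic σ' ∨
    ∃ C : TreeClasper openCylinder σ.toFun, n ≤ C.degree ∧ C.IsSelf ∧ C.IsResult σ'.toFun

/-- There is a finite sequence of string links, the first of which closes to `L` and the last of
which closes to `L'` up to isotopy, such that any two consecutive ones are `E`-equivalent or have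
isotopic closures. -/
def JoinedByStringLinks {l : ℕ} (E : StringLink l → StringLink l → Prop) (L L' : Link l) : Prop :=
  ∃ (m : ℕ) (σ : Fin (m + 1) → StringLink l),
    L.Isotopic (σ 0).closure ∧ L'.Isotopic (σ (Fin.last m)).closure ∧
    ∀ i : Fin m, E (σ i.castSucc) (σ i.succ) ∨
      (σ i.castSucc).closure.Isotopic (σ i.succ).closure

end Clasper

end

open Topology Filter

namespace Clasper

/-! ### Piecewise linear maps and ambient isotopies -/

section PL

variable {V W X : Type*} [NormedAddCommGroup V] [NormedSpace ℝ V] [NormedAddCommGroup W]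
  [NormedSpace ℝ W] [NormedAddCommGroup X] [NormedSpace ℝ X]

/-! From string links to links there is little to do: isotopies and claspers of string links live in
the open cylinder and the closing arcs lie outside it, so the same isotopies and claspers serve for
the closures (`StringLink.SurgeryEquiv.closure`).

Conversely, the main case is a single surgery on `L` along a clasper with result `L'`. The standard
ball `B` of the clasper is compact and has connected complement (`isPreconnected_compl_ball`). It
meets `L` only in disjoint arcs, so no component lies in `B` (`not_range_subset_strands`). Hence
each component has a straight piece outside `B`, and these pieces can be moved, without touching
`B`, to prescribed points on one side of `B` (`Link.exists_move_germs`). In a generic direction the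
rays from these points miss the rest of the link (`Link.exists_generic_direction`). Fingers of the
link are pulled out along the rays, opened, and put into one plane, where they become the standard
closing arcs; everything else, including `B`, ends up in the cylinder (`Link.exists_pull_out`,
`Link.exists_isStandardForm`).

Off `B` the links `L` and `L'` coincide, and surgery keeps the strands inside `B`, so the same
homeomorphism also brings `L'` to standard form. Cutting off the closing arcs leaves two string
links related by surgery along the image of the clasper, with the same tree and with leaves on the
same components (`TreeClasper.exists_stringLink`). An isotopy of links needs only one string link
whose closure is isotopic to both ends, which is the case of empty `B`.

All ambient isotopies are composed of pushes `x ↦ x + f x • w` with `f` piecewise linear of slope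
greater than `-1` along `w` (`SlopeGE.isotopy`): such a push is increasing on every line in the
direction `w`. -/

theorem IsPLOn.comp {f : V → W} {g : W → X} {s : Set V} {t : Set W} (hg : IsPLOn g t)
    (hf : IsPLOn f s) (h : Set.MapsTo f s t) : IsPLOn (g ∘ f) s := by
  obtain ⟨hfc, A, hA, hAf⟩ := hf
  obtain ⟨hgc, B, hB, hBg⟩ := hg
  refine ⟨hgc.comp hfc h, Set.image2 (fun b a => b.comp a) B A, hB.image2 _ hA, fun x hx => ?_⟩
  obtain ⟨a, ha, e⟩ := hAf x hx
  obtain ⟨b, hb, e'⟩ := hBg (f x) (h hx)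
  exact ⟨_, ⟨b, hb, a, ha, rfl⟩, by simp [e', ← e]⟩

theorem IsPLOn.congr {f g : V → W} {s : Set V} (hf : IsPLOn f s) (h : ∀ x ∈ s, g x = f x) :
    IsPLOn g s := by
  obtain ⟨hfc, A, hA, hAf⟩ := hf
  refine ⟨hfc.congr h, A, hA, fun x hx => ?_⟩
  obtain ⟨a, ha, e⟩ := hAf x hx
  exact ⟨a, ha, (h x hx).trans e⟩

theorem isPLOn_id (s : Set V) : IsPLOn (id : V → V) s :=
  ⟨continuousOn_id, {AffineMap.id ℝ V}, Set.finite_singleton _, fun _ _ => ⟨_, rfl, rfl⟩⟩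

end PL

/-- The identity isotopy. -/
def AmbientIsotopy.refl (U : Set Space) : AmbientIsotopy U where
  homeo _ := Homeomorph.refl _
  continuous_homeo := continuous_snd
  continuous_symm := continuous_snd
  isPL _ := isPLOn_id _
  isPL_symm _ := isPLOn_id _
  homeo_zero _ := rfl
  fixed _ _ _ := rfl

/-- First `H`, then `K`, at each time. -/
def AmbientIsotopy.trans {U : Set Space} (H K : AmbientIsotopy U) : AmbientIsotopy U where
  homeo t := (H.homeo t).trans (K.homeo t)
  continuous_homeo := K.continuous_homeo.comp (continuous_fst.prodMk H.continuous_homeo)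
  continuous_symm := H.continuous_symm.comp (continuous_fst.prodMk K.continuous_symm)
  isPL t := (K.isPL t).comp (H.isPL t) (Set.mapsTo_univ _ _)
  isPL_symm t := (H.isPL_symm t).comp (K.isPL_symm t) (Set.mapsTo_univ _ _)
  homeo_zero x := by simp [H.homeo_zero, K.homeo_zero]
  fixed t x hx := by simp [H.fixed t x hx, K.fixed t x hx]

/-- The inverse isotopy. -/
def AmbientIsotopy.symm {U : Set Space} (H : AmbientIsotopy U) : AmbientIsotopy U where
  homeo t := (H.homeo t).symm
  continuous_homeo := H.continuous_symm
  continuous_symm := H.continuous_homeo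
  isPL := H.isPL_symm
  isPL_symm := H.isPL
  homeo_zero x := by rw [Homeomorph.symm_apply_eq, H.homeo_zero]
  fixed t x hx := by rw [Homeomorph.symm_apply_eq, H.fixed t x hx]

/-- Enlarging the region of an isotopy. -/
def AmbientIsotopy.mono {U U' : Set Space} (h : U ⊆ U') (H : AmbientIsotopy U) :
    AmbientIsotopy U' where
  __ := H
  fixed t x hx := H.fixed t x fun h' => hx (h h')

/-- Homeomorphisms that are ambient isotopic to the identity in the region `U`. -/
def IsotopicToId (U : Set Space) (e : Space ≃ₜ Space) : Prop :=
  ∃ H : AmbientIsotopy U, H.homeo 1 = e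

theorem IsotopicToId.refl (U : Set Space) : IsotopicToId U (Homeomorph.refl _) :=
  ⟨AmbientIsotopy.refl U, rfl⟩

theorem IsotopicToId.trans {U : Set Space} {e f : Space ≃ₜ Space} (he : IsotopicToId U e)
    (hf : IsotopicToId U f) : IsotopicToId U (e.trans f) := by
  obtain ⟨H, rfl⟩ := he
  obtain ⟨K, rfl⟩ := hf
  exact ⟨H.trans K, rfl⟩

theorem IsotopicToId.symm {U : Set Space} {e : Space ≃ₜ Space} (he : IsotopicToId U e) :
    IsotopicToId U e.symm := by
  obtain ⟨H, rfl⟩ := he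
  exact ⟨H.symm, rfl⟩

theorem IsotopicToId.mono {U U' : Set Space} (h : U ⊆ U') {e : Space ≃ₜ Space}
    (he : IsotopicToId U e) : IsotopicToId U' e := by
  obtain ⟨H, rfl⟩ := he
  exact ⟨H.mono h, rfl⟩

theorem IsotopicToId.fixed {U : Set Space} {e : Space ≃ₜ Space} (he : IsotopicToId U e)
    {x : Space} (hx : x ∉ U) : e x = x := by
  obtain ⟨H, rfl⟩ := he
  exact H.fixed 1 x hx

theorem IsotopicToId.isPLOn {U : Set Space} {e : Space ≃ₜ Space} (he : IsotopicToId U e) :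
    IsPLOn e Set.univ := by
  obtain ⟨H, rfl⟩ := he
  exact H.isPL 1

/-! ### Pushing space in a direction -/

/-- `f` is a continuous function with finitely many affine pieces, whose slope in the direction
`w` is at least `c`. -/
structure SlopeGE (w : Space) (c : ℝ) (f : Space → ℝ) : Prop where
  continuous : Continuous f
  slope : ∀ x s, 0 ≤ s → f x + c * s ≤ f (x + s • w)
  -- The slope bound is required of every affine piece as well, because the pieces of the inverse of
  -- a push are found by dividing by one plus a multiple of this slope.
  pieces : ∃ 𝒜 : Set (Space →ᵃ[ℝ] ℝ), 𝒜.Finite ∧ (∀ A ∈ 𝒜, c ≤ A.linear w) ∧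
    ∀ x, ∃ A ∈ 𝒜, f x = A x

namespace SlopeGE

variable {w : Space} {c c' : ℝ} {f g : Space → ℝ}

theorem affine (A : Space →ᵃ[ℝ] ℝ) (h : c ≤ A.linear w) : SlopeGE w c A := by
  refine ⟨A.continuous_of_finiteDimensional, fun x s hs => ?_, {A}, Set.finite_singleton _, ?_, ?_⟩
  · have : A (x + s • w) = A x + s * A.linear w := by
      rw [add_comm, ← vadd_eq_add, A.map_vadd]; simp [add_comm]
    rw [this]; nlinarith
  · simpa using h
  · simp

theorem linear_add_const (φ : Space →ₗ[ℝ] ℝ) (b : ℝ) (h : c ≤ φ w) :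
    SlopeGE w c fun x => φ x + b := by
  have := SlopeGE.affine (w := w) (c := c) (φ.toAffineMap + AffineMap.const ℝ Space b) (by simpa)
  exact this

theorem coord (k : Fin 3) (a b : ℝ) (h : c ≤ a * w k) : SlopeGE w c fun x => a * x k + b :=
  linear_add_const (a • LinearMap.proj k) b h

theorem const (b : ℝ) (h : c ≤ 0) : SlopeGE w c fun _ => b := by
  simpa using linear_add_const (w := w) (c := c) 0 b (by simpa)

theorem sup (hf : SlopeGE w c f) (hg : SlopeGE w c g) : SlopeGE w c fun x => max (f x) (g x) := by
  obtain ⟨h1, h2, A, hA, hc, hA'⟩ := hf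
  obtain ⟨k1, k2, B, hB, kc, hB'⟩ := hg
  refine ⟨h1.max k1, fun x s hs => ?_, A ∪ B, hA.union hB, ?_, fun x => ?_⟩
  · rw [max_add]
    exact max_le_max (h2 x s hs) (k2 x s hs)
  · rintro a (ha | ha)
    exacts [hc a ha, kc a ha]
  · rcases max_choice (f x) (g x) with h | h
    · obtain ⟨a, ha, e⟩ := hA' x
      exact ⟨a, Or.inl ha, h.trans e⟩
    · obtain ⟨a, ha, e⟩ := hB' x
      exact ⟨a, Or.inr ha, h.trans e⟩

theorem inf (hf : SlopeGE w c f) (hg : SlopeGE w c g) : SlopeGE w c fun x => min (f x) (g x) := by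
  obtain ⟨h1, h2, A, hA, hc, hA'⟩ := hf
  obtain ⟨k1, k2, B, hB, kc, hB'⟩ := hg
  refine ⟨h1.min k1, fun x s hs => ?_, A ∪ B, hA.union hB, ?_, fun x => ?_⟩
  · rw [min_add]
    exact min_le_min (h2 x s hs) (k2 x s hs)
  · rintro a (ha | ha)
    exacts [hc a ha, kc a ha]
  · rcases min_choice (f x) (g x) with h | h
    · obtain ⟨a, ha, e⟩ := hA' x
      exact ⟨a, Or.inl ha, h.trans e⟩
    · obtain ⟨a, ha, e⟩ := hB' x
      exact ⟨a, Or.inr ha, h.trans e⟩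

theorem add (hf : SlopeGE w c f) (hg : SlopeGE w c' g) :
    SlopeGE w (c + c') fun x => f x + g x := by
  obtain ⟨h1, h2, A, hA, hc, hA'⟩ := hf
  obtain ⟨k1, k2, B, hB, kc, hB'⟩ := hg
  refine ⟨h1.add k1, fun x s hs => ?_, Set.image2 (fun a b => a + b) A B, hA.image2 _ hB, ?_,
    fun x => ?_⟩
  · linarith [h2 x s hs, k2 x s hs]
  · rintro _ ⟨a, ha, b, hb, rfl⟩
    simpa using add_le_add (hc a ha) (kc b hb)
  · obtain ⟨a, ha, e⟩ := hA' x
    obtain ⟨b, hb, e'⟩ := hB' x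
    exact ⟨_, ⟨a, ha, b, hb, rfl⟩, by simp [e, e']⟩

theorem smul (hf : SlopeGE w c f) {a : ℝ} (ha : 0 ≤ a) : SlopeGE w (a * c) fun x => a * f x := by
  obtain ⟨h1, h2, A, hA, hc, hA'⟩ := hf
  refine ⟨by fun_prop, fun x s hs => ?_, (fun b => a • b) '' A, hA.image _, ?_, fun x => ?_⟩
  · nlinarith [h2 x s hs]
  · rintro _ ⟨b, hb, rfl⟩
    simpa using mul_le_mul_of_nonneg_left (hc b hb) ha
  · obtain ⟨b, hb, e⟩ := hA' x
    exact ⟨_, ⟨b, hb, rfl⟩, by simp [e]⟩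

theorem sum {ι : Type*} (s : Finset ι) {f : ι → Space → ℝ} (h : ∀ i ∈ s, SlopeGE w 0 (f i)) :
    SlopeGE w 0 fun x => ∑ i ∈ s, f i x := by
  classical
  induction s using Finset.induction_on with
  | empty => simpa using const (w := w) 0 le_rfl
  | insert a s ha ih =>
    simp only [Finset.sum_insert ha]
    simpa using (h a (Finset.mem_insert_self _ _)).add
      (ih fun i hi => h i (Finset.mem_insert_of_mem hi))

/-! ### Inverting a push -/

variable {κ : ℝ}

/-- The function `s - t * f (y - s • w)` of `s` increases at least at the rate `1 - max κ 0 > 0`, so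
it changes sign on a large interval. The maximum with `0` covers all times `t` in `[0, 1]` and both
signs of `κ`. Only existence is proved here; uniqueness follows from `root_dist`. -/
theorem exists_unique_root (hf : SlopeGE w (-κ) f) (hκ : κ < 1) (t : unitInterval) (y : Space) :
    ∃ s : ℝ, s = t * f (y - s • w) := by
  have hb : ∀ s, 0 ≤ s → (t : ℝ) * f (y - s • w) ≤ t * f y + max κ 0 * s := fun s hs => by
    have h1 := hf.slope (y - s • w) s hs
    rw [sub_add_cancel] at h1
    have h2 : (t : ℝ) * (κ * s) ≤ max κ 0 * s := by
      rw [← mul_assoc]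
      refine mul_le_mul_of_nonneg_right ?_ hs
      rcases le_total κ 0 with h | h
      · exact (mul_nonpos_of_nonneg_of_nonpos t.2.1 h).trans (le_max_right _ _)
      · exact (mul_le_of_le_one_left h t.2.2).trans (le_max_left _ _)
    nlinarith [t.2.1]
  have hb' : ∀ s, 0 ≤ s → (t : ℝ) * f y - max κ 0 * s ≤ t * f (y + s • w) := fun s hs => by
    have h1 := hf.slope y s hs
    have h2 : (t : ℝ) * (κ * s) ≤ max κ 0 * s := by
      rw [← mul_assoc]
      refine mul_le_mul_of_nonneg_right ?_ hs
      rcases le_total κ 0 with h | h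
      · exact (mul_nonpos_of_nonneg_of_nonpos t.2.1 h).trans (le_max_right _ _)
      · exact (mul_le_of_le_one_left h t.2.2).trans (le_max_left _ _)
    nlinarith [t.2.1]
  have hm : 0 < 1 - max κ 0 := by
    have : max κ 0 < 1 := max_lt hκ one_pos
    linarith
  set M : ℝ := |t * f y| / (1 - max κ 0) with hM
  have hM0 : 0 ≤ M := by positivity
  have hM1 : (1 - max κ 0) * M = |t * f y| := by rw [hM]; field_simp
  have hc : Continuous fun s : ℝ => s - t * f (y - s • w) := by
    have := hf.continuous
    fun_prop
  have h0 : (0 : ℝ) ∈ Set.Icc ((-M) - t * f (y - (-M) • w)) (M - t * f (y - M • w)) := by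
    constructor
    · have := hb' M hM0
      have e : y - (-M) • w = y + M • w := by module
      rw [e]
      linarith [neg_abs_le ((t : ℝ) * f y)]
    · have := hb M hM0
      linarith [le_abs_self ((t : ℝ) * f y)]
  obtain ⟨s, -, hs⟩ := intermediate_value_Icc (by linarith) hc.continuousOn h0
  exact ⟨s, by dsimp only at hs; linarith⟩

/-- Quantitative uniqueness of the root. -/
theorem root_dist (hf : SlopeGE w (-κ) f) (t : unitInterval) (y : Space) {s s' : ℝ}
    (hs : s = t * f (y - s • w)) :
    (1 - max κ 0) * |s' - s| ≤ |s' - t * f (y - s' • w)| := by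
  have key : ∀ a b : ℝ, a ≤ b → (1 - max κ 0) * (b - a) ≤
      (b - t * f (y - b • w)) - (a - t * f (y - a • w)) := fun a b hab => by
    have h1 := hf.slope (y - b • w) (b - a) (by linarith)
    have e : y - b • w + (b - a) • w = y - a • w := by module
    rw [e] at h1
    have h2 : (t : ℝ) * (κ * (b - a)) ≤ max κ 0 * (b - a) := by
      rw [← mul_assoc]
      refine mul_le_mul_of_nonneg_right ?_ (by linarith)
      rcases le_total κ 0 with h | h
      · exact (mul_nonpos_of_nonneg_of_nonpos t.2.1 h).trans (le_max_right _ _)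
      · exact (mul_le_of_le_one_left h t.2.2).trans (le_max_left _ _)
    nlinarith [t.2.1]
  rcases le_total s s' with h | h
  · rw [abs_of_nonneg (by linarith)]
    have := key s s' h
    exact (by linarith : _ ≤ s' - t * f (y - s' • w)).trans (le_abs_self _)
  · rw [abs_of_nonpos (by linarith)]
    have := key s' s h
    exact (by linarith : _ ≤ -(s' - t * f (y - s' • w))).trans (neg_le_abs _)

/-- The distance by which a point has been pushed at time `t`, in terms of its position then. -/
noncomputable def root (hf : SlopeGE w (-κ) f) (hκ : κ < 1) (t : unitInterval) (y : Space) : ℝ :=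
  (hf.exists_unique_root hκ t y).choose

theorem root_spec (hf : SlopeGE w (-κ) f) (hκ : κ < 1) (t : unitInterval) (y : Space) :
    hf.root hκ t y = t * f (y - hf.root hκ t y • w) :=
  (hf.exists_unique_root hκ t y).choose_spec

theorem eq_root (hf : SlopeGE w (-κ) f) (hκ : κ < 1) {t : unitInterval} {y : Space} {s : ℝ}
    (hs : s = t * f (y - s • w)) : s = hf.root hκ t y := by
  have h := hf.root_dist t y (s' := s) (hf.root_spec hκ t y)
  rw [sub_eq_zero.2 hs, abs_zero] at h
  have hm : 0 < 1 - max κ 0 := by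
    have : max κ 0 < 1 := max_lt hκ one_pos
    linarith
  have h' : |s - hf.root hκ t y| ≤ 0 := by
    by_contra! h''
    nlinarith
  exact sub_eq_zero.1 (abs_eq_zero.1 (le_antisymm h' (abs_nonneg _)))

/-- By `root_dist`, the root at a nearby parameter differs from the fixed number `s₀` by at most a
constant times the defect of `s₀` in the equation there, which is continuous and vanishes at `p₀`.
-/
theorem continuous_root (hf : SlopeGE w (-κ) f) (hκ : κ < 1) :
    Continuous fun p : unitInterval × Space => hf.root hκ p.1 p.2 := by
  have hm : 0 < 1 - max κ 0 := by
    have : max κ 0 < 1 := max_lt hκ one_pos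
    linarith
  rw [continuous_iff_continuousAt]
  rintro p₀
  set s₀ := hf.root hκ p₀.1 p₀.2 with hs₀
  have hc : Continuous fun p : unitInterval × Space => |s₀ - p.1 * f (p.2 - s₀ • w)| / (1 - max κ 0) := by
    have := hf.continuous
    fun_prop
  have h0 : Filter.Tendsto (fun p : unitInterval × Space =>
      |s₀ - p.1 * f (p.2 - s₀ • w)| / (1 - max κ 0)) (nhds p₀) (nhds 0) := by
    have := hc.tendsto p₀
    have e : s₀ - p₀.1 * f (p₀.2 - s₀ • w) = 0 := sub_eq_zero.2 (hf.root_spec hκ _ _)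
    rwa [e, abs_zero, zero_div] at this
  rw [ContinuousAt, tendsto_iff_dist_tendsto_zero]
  refine squeeze_zero (fun _ => dist_nonneg) (fun p => ?_) h0
  rw [le_div_iff₀ hm, Real.dist_eq, abs_sub_comm, mul_comm]
  exact hf.root_dist p.1 p.2 (hf.root_spec hκ _ _)

/-- Pushing space in the direction `w`, by the distance `f`. -/
noncomputable def isotopy (hf : SlopeGE w (-κ) f) (hκ : κ < 1) {U : Set Space}
    (hU : ∀ x ∉ U, f x = 0) : AmbientIsotopy U where
  homeo t :=
    { toFun := fun x => x + (t * f x : ℝ) • w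
      invFun := fun y => y - hf.root hκ t y • w
      left_inv := fun x => by
        have : (t * f x : ℝ) = hf.root hκ t (x + (t * f x : ℝ) • w) := by
          apply hf.eq_root hκ
          rw [add_sub_cancel_right]
        dsimp only
        rw [← this, add_sub_cancel_right]
      right_inv := fun y => by
        dsimp only
        rw [← hf.root_spec hκ t y, sub_add_cancel]
      continuous_toFun := by
        have := hf.continuous
        fun_prop
      continuous_invFun := by
        have := hf.continuous_root hκ
        fun_prop }
  continuous_homeo := by
    have := hf.continuous
    change Continuous fun p : unitInterval × Space => p.2 + (p.1 * f p.2 : ℝ) • w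
    fun_prop
  continuous_symm := by
    have := hf.continuous_root hκ
    change Continuous fun p : unitInterval × Space => p.2 - hf.root hκ p.1 p.2 • w
    fun_prop
  isPL t := by
    have := hf.continuous
    obtain ⟨A, hA, -, hA'⟩ := hf.pieces
    refine ⟨?_, (fun a : Space →ᵃ[ℝ] ℝ => AffineMap.id ℝ Space +
      (LinearMap.toSpanSingleton ℝ Space ((t : ℝ) • w)).toAffineMap.comp a) '' A, hA.image _, ?_⟩
    · change ContinuousOn (fun x : Space => x + (t * f x : ℝ) • w) _
      fun_prop
    · intro x _
      obtain ⟨a, ha, e⟩ := hA' x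
      refine ⟨_, ⟨a, ha, rfl⟩, ?_⟩
      change x + (t * f x : ℝ) • w = x + (a x) • (t : ℝ) • w
      rw [e, smul_smul, mul_comm]
  isPL_symm t := by
    obtain ⟨A, hA, hc, hA'⟩ := hf.pieces
    -- If `a` is the affine piece of `f` at the preimage `x`, then `a y = (1 + t * a.linear w) * a
    -- x`, so the root `t * a x` is an affine function of `y`.
    refine ⟨?_, (fun a : Space →ᵃ[ℝ] ℝ => AffineMap.id ℝ Space -
      (LinearMap.toSpanSingleton ℝ Space (((t : ℝ) / (1 + t * a.linear w)) • w)).toAffineMap.comp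
        a) '' A, hA.image _, ?_⟩
    · have := hf.continuous_root hκ
      change ContinuousOn (fun y : Space => y - hf.root hκ t y • w) _
      fun_prop
    · intro y _
      set x := y - hf.root hκ t y • w with hx
      obtain ⟨a, ha, e⟩ := hA' x
      refine ⟨_, ⟨a, ha, rfl⟩, ?_⟩
      change y - hf.root hκ t y • w = y - (a y) • ((t : ℝ) / (1 + t * a.linear w)) • w
      have hr : hf.root hκ t y = t * a x := (hf.root_spec hκ t y).trans (by rw [← hx, e])
      have hy : a y = a x + hf.root hκ t y * a.linear w := by
        have : y = (hf.root hκ t y • w) +ᵥ x := by rw [hx, vadd_eq_add]; module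
        conv_lhs => rw [this]
        rw [a.map_vadd]
        simp [add_comm]
      have hpos : 0 < 1 + t * a.linear w := by
        have h1 := hc a ha
        have h2 := t.2.1
        have h3 := t.2.2
        rcases le_total 0 (a.linear w) with h | h
        · positivity
        · nlinarith
      rw [smul_smul]
      congr 2
      rw [hy, hr]
      field_simp
  homeo_zero x := by simp
  fixed t x hx := by simp [hU x hx]

/-- The homeomorphism that pushes space in the direction `w`, by the distance `f`. -/
theorem exists_isotopicToId (hf : SlopeGE w (-κ) f) (hκ : κ < 1) {U : Set Space}
    (hU : ∀ x ∉ U, f x = 0) : ∃ e, IsotopicToId U e ∧ ∀ x, e x = x + f x • w := by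
  refine ⟨_, ⟨hf.isotopy hκ hU, rfl⟩, fun x => ?_⟩
  change x + ((1 : unitInterval) * f x : ℝ) • w = _
  simp

end SlopeGE

/-! ### Removing finitely many points from a connected open set -/

/-- The radial map `x ↦ a + (r / (1 + ‖x‖)) • x` carries the complement of the origin onto the
punctured ball. -/
theorem isPreconnected_ball_diff_center {E : Type*} [NormedAddCommGroup E] [NormedSpace ℝ E]
    (h : 1 < Module.rank ℝ E) (a : E) {r : ℝ} (hr : 0 < r) :
    IsPreconnected (Metric.ball a r \ {a}) := by
  have h1 := (isConnected_compl_singleton_of_one_lt_rank h (0 : E)).isPreconnected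
  have hpos : ∀ x : E, 0 < 1 + ‖x‖ := fun x => by positivity
  have hc : Continuous fun x : E => a + (r / (1 + ‖x‖)) • x :=
    continuous_const.add
      ((continuous_const.div (by fun_prop) fun x => (hpos x).ne').smul continuous_id)
  have h2 := h1.image _ hc.continuousOn
  convert h2 using 1
  ext y
  constructor
  · rintro ⟨hy, hya⟩
    rw [mem_ball_iff_norm] at hy
    have hp : 0 < r - ‖y - a‖ := by linarith
    refine ⟨(r - ‖y - a‖)⁻¹ • (y - a), ?_, ?_⟩
    · simpa [sub_eq_zero, hp.ne'] using hya
    · dsimp only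
      rw [norm_smul, Real.norm_of_nonneg (inv_nonneg.2 hp.le), smul_smul]
      have : r / (1 + (r - ‖y - a‖)⁻¹ * ‖y - a‖) * (r - ‖y - a‖)⁻¹ = 1 := by
        have h3 : 1 + (r - ‖y - a‖)⁻¹ * ‖y - a‖ = r * (r - ‖y - a‖)⁻¹ := by field_simp; ring
        rw [h3]
        field_simp
      rw [this, one_smul, add_sub_cancel]
  · rintro ⟨x, hx, rfl⟩
    have hx' : x ≠ 0 := hx
    have hp := hpos x
    refine ⟨?_, ?_⟩
    · rw [mem_ball_iff_norm, add_sub_cancel_left, norm_smul, Real.norm_of_nonneg (by positivity),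
        div_mul_eq_mul_div, div_lt_iff₀ hp]
      nlinarith
    · simp [hx', hr.ne', hp.ne']

/-- A point of `U` in the closure of a component `T` of `U \ {a}` has a ball around it that is
contained in `T` up to the point `a`, because a punctured ball is still connected. So `T` is dense
near all of `U`, and no point other than `a` can be missing from it. -/
theorem isPreconnected_diff_singleton {E : Type*} [NormedAddCommGroup E] [NormedSpace ℝ E]
    (h : 1 < Module.rank ℝ E) {U : Set E} (hU : IsOpen U) (hc : IsPreconnected U) (a : E) :
    IsPreconnected (U \ {a}) := by
  have : Nontrivial E := (rank_pos_iff_nontrivial (R := ℝ)).1 (zero_lt_one.trans h)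
  have : (𝓝[≠] a).NeBot := Module.punctured_nhds_neBot ℝ E a
  refine isPreconnected_of_forall_pair fun x hx y hy => ?_
  set T := connectedComponentIn (U \ {a}) x with hT
  have hTsub : T ⊆ U \ {a} := connectedComponentIn_subset _ _
  have hxT : x ∈ T := mem_connectedComponentIn hx
  have key : ∀ z ∈ closure T ∩ U, ∃ r > 0, Metric.ball z r \ {a} ⊆ T := by
    rintro z ⟨hz, hzU⟩
    obtain ⟨r, hr, hrU⟩ := Metric.isOpen_iff.1 hU z hzU
    rcases eq_or_ne z a with rfl | hza
    · refine ⟨r, hr, ?_⟩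
      obtain ⟨w, hwb, hwT⟩ := mem_closure_iff.1 hz _ Metric.isOpen_ball (Metric.mem_ball_self hr)
      have hc' := isPreconnected_ball_diff_center h z hr
      have e : connectedComponentIn (U \ {z}) w = T := (connectedComponentIn_eq hwT).symm
      rw [← e]
      exact hc'.subset_connectedComponentIn ⟨hwb, (hTsub hwT).2⟩ (Set.sdiff_subset_sdiff_left hrU)
    · have hd : 0 < dist z a := dist_pos.2 hza
      refine ⟨min r (dist z a), lt_min hr hd, ?_⟩
      obtain ⟨w, hwb, hwT⟩ := mem_closure_iff.1 hz _ Metric.isOpen_ball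
        (Metric.mem_ball_self (lt_min hr hd))
      have e : connectedComponentIn (U \ {a}) w = T := (connectedComponentIn_eq hwT).symm
      rw [← e]
      have hb : Metric.ball z (min r (dist z a)) ⊆ U \ {a} := fun u hu => by
        refine ⟨hrU (Metric.ball_subset_ball (min_le_left _ _) hu), ?_⟩
        rintro rfl
        rw [Metric.mem_ball, dist_comm] at hu
        exact (lt_irrefl _ (hu.trans_le (min_le_right _ _)))
      exact Set.sdiff_subset.trans
        ((convex_ball _ _).isPreconnected.subset_connectedComponentIn hwb hb)
  -- Connectedness of `U` itself is used here: the interior of `closure T` is open, meets `U`, and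
  -- is relatively closed in it by `key`.
  have hsub : U ⊆ interior (closure T) := by
    refine hc.subset_of_closure_inter_subset isOpen_interior ?_ ?_
    · refine ⟨x, hx.1, ?_⟩
      obtain ⟨r, hr, hrT⟩ := key x ⟨subset_closure hxT, hx.1⟩
      refine interior_mono subset_closure (mem_interior_iff_mem_nhds.2 ?_)
      have : Metric.ball x r \ {a} ∈ 𝓝 x :=
        (Metric.isOpen_ball.sdiff isClosed_singleton).mem_nhds ⟨Metric.mem_ball_self hr, hx.2⟩
      exact mem_of_superset this hrT
    · rintro z ⟨hz, hzU⟩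
      have hz' : z ∈ closure T := by
        have := closure_mono (interior_subset (s := closure T)) hz
        rwa [closure_closure] at this
      obtain ⟨r, hr, hrT⟩ := key z ⟨hz', hzU⟩
      refine mem_interior.2 ⟨Metric.ball z r, ?_, Metric.isOpen_ball, Metric.mem_ball_self hr⟩
      refine Set.Subset.trans ?_ (closure_mono hrT)
      have hd : Dense ({a}ᶜ : Set E) := dense_compl_singleton a
      exact hd.open_subset_closure_inter Metric.isOpen_ball
  have hyT : y ∈ T := by
    obtain ⟨r, hr, hrT⟩ := key y ⟨interior_subset (hsub hy.1), hy.1⟩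
    exact hrT ⟨Metric.mem_ball_self hr, hy.2⟩
  exact ⟨T, hTsub, hxT, hyT, isPreconnected_connectedComponentIn⟩

theorem isPreconnected_diff_finite {E : Type*} [NormedAddCommGroup E] [NormedSpace ℝ E]
    (h : 1 < Module.rank ℝ E) {U : Set E} (hU : IsOpen U) (hc : IsPreconnected U) {F : Set E}
    (hF : F.Finite) : IsPreconnected (U \ F) := by
  induction F, hF using Set.Finite.induction_on with
  | empty => simpa
  | @insert a F _ hF ih =>
    rw [show U \ insert a F = (U \ F) \ {a} by ext; simp; tauto]
    exact isPreconnected_diff_singleton h (hU.sdiff hF.isClosed) ih a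

/-! ### Moving a point together with a direction -/

theorem exists_norm_eq_abs (x : Space) : ∃ k, ‖x‖ = |x k| := by
  obtain ⟨k, -, h⟩ := Finset.exists_mem_eq_sup' Finset.univ_nonempty fun k => ‖x k‖
  refine ⟨k, le_antisymm ?_ (norm_le_pi_norm x k)⟩
  rw [pi_norm_le_iff_of_nonneg (abs_nonneg _)]
  intro j
  have := Finset.le_sup' (fun k => ‖x k‖) (Finset.mem_univ j)
  rw [h] at this
  exact this

/-- The norm of `Space` is the maximum norm, so it is piecewise linear with the six pieces `± x k`,
and it is 1-Lipschitz. -/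
theorem SlopeGE.const_add_mul_norm {w : Space} {c : ℝ} (a b : ℝ) (p : Space)
    (h : c ≤ -(|b| * ‖w‖)) : SlopeGE w c fun x => a + b * ‖x - p‖ := by
  refine ⟨by fun_prop, fun x s hs => ?_, Set.range fun u : Fin 3 × ({1, -1} : Finset ℝ) =>
    ((b * u.2) • LinearMap.proj (R := ℝ) (φ := fun _ : Fin 3 => ℝ) u.1).toAffineMap +
      AffineMap.const ℝ Space (a - b * u.2 * p u.1), Set.finite_range _, ?_, fun x => ?_⟩
  · have h1 : |‖x + s • w - p‖ - ‖x - p‖| ≤ s * ‖w‖ := by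
      refine (abs_norm_sub_norm_le _ _).trans ?_
      rw [show x + s • w - p - (x - p) = s • w by abel, norm_smul, Real.norm_of_nonneg hs]
    have h2 : |b * (‖x + s • w - p‖ - ‖x - p‖)| ≤ |b| * (s * ‖w‖) := by
      rw [abs_mul]; gcongr
    have h3 := neg_abs_le (b * (‖x + s • w - p‖ - ‖x - p‖))
    nlinarith
  · rintro _ ⟨⟨k, ⟨σ, hσ⟩⟩, rfl⟩
    have hw : |w k| ≤ ‖w‖ := norm_le_pi_norm w k
    have h1 : |b * σ * w k| ≤ |b| * ‖w‖ := by
      rw [abs_mul, abs_mul]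
      have : |σ| = 1 := by
        simp at hσ
        rcases hσ with rfl | rfl <;> simp
      rw [this, mul_one]
      gcongr
    have h2 := neg_abs_le (b * σ * w k)
    simp
    linarith
  · obtain ⟨k, hk⟩ := exists_norm_eq_abs (x - p)
    rcases abs_choice ((x - p) k) with h' | h'
    · exact ⟨_, ⟨(k, ⟨1, by simp⟩), rfl⟩, by
        simp only [hk, h']
        simp
        ring⟩
    · exact ⟨_, ⟨(k, ⟨-1, by simp⟩), rfl⟩, by
        simp only [hk, h']
        simp
        ring⟩

/-- A translation near a point, extended to an isotopy supported in a ball. -/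
theorem exists_local_translation (p w : Space) {r : ℝ} (hr : 0 < r) (hw : ‖w‖ ≤ r / 4) :
    ∃ e, IsotopicToId (Metric.closedBall p r) e ∧ ∀ x, ‖x - p‖ ≤ r / 2 → e x = x + w := by
  -- This cutoff is `1` on the ball of radius `r / 2` and `0` outside the ball of radius `r`. Its
  -- slope along `w` is at least `-(2 / r) * ‖w‖ ≥ -1 / 2`.
  have hs : SlopeGE w (-(1 / 2)) fun x => max 0 (min 1 (2 + (-(2 / r)) * ‖x - p‖)) := by
    refine SlopeGE.sup (.const 0 (by norm_num)) (.inf (.const 1 (by norm_num))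
      (.const_add_mul_norm _ _ _ ?_))
    rw [abs_neg, abs_of_pos (by positivity)]
    have : 2 / r * ‖w‖ ≤ 2 / r * (r / 4) := by gcongr
    have e : 2 / r * (r / 4) = 1 / 2 := by field_simp; norm_num
    linarith
  obtain ⟨e, he, he'⟩ := hs.exists_isotopicToId (by norm_num) (U := Metric.closedBall p r) (by
    intro x hx
    rw [mem_closedBall_iff_norm, not_le] at hx
    refine max_eq_left ((min_le_right _ _).trans ?_)
    have : 2 / r * r ≤ 2 / r * ‖x - p‖ := by gcongr
    have e : 2 / r * r = 2 := by field_simp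
    linarith)
  refine ⟨e, he, fun x hx => ?_⟩
  have h1 : 2 / r * ‖x - p‖ ≤ 2 / r * (r / 2) := by gcongr
  have h2 : 2 / r * (r / 2) = 1 := by field_simp
  rw [he', min_eq_left (by linarith), max_eq_right zero_le_one, one_smul]

/-- A transvection near a point, extended to an isotopy supported in a ball. -/
theorem exists_local_transvection (p d w : Space) {r : ℝ} (hr : 0 < r) {k : Fin 3} (hk : d k ≠ 0)
    (hw : ‖w‖ ≤ 1 / 2) (hw' : ‖w‖ ≤ |d k| / 2) :
    ∃ e, IsotopicToId (Metric.closedBall p r) e ∧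
      ∀ᶠ s in 𝓝 (0 : ℝ), e (p + s • d) = p + s • (d + w) := by
  -- The functional `(x k - p k) / d k` has the value `s` at `p + s • d`. It is truncated to lie
  -- between plus and minus the positive part of `r - ‖x - p‖`, which changes nothing near `p` on
  -- this line.
  have hs : SlopeGE w (-(1 / 2)) fun x => max (min 0 (-r + 1 * ‖x - p‖))
      (min (max 0 (r + (-1) * ‖x - p‖)) ((d k)⁻¹ * x k + -((d k)⁻¹ * p k))) := by
    refine .sup (.inf (.const 0 (by norm_num)) (.const_add_mul_norm _ _ _ (by simp; linarith)))
      (.inf (.sup (.const 0 (by norm_num)) (.const_add_mul_norm _ _ _ (by simp; linarith)))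
        (.coord _ _ _ ?_))
    have h1 : |(d k)⁻¹ * w k| ≤ 1 / 2 := by
      rw [abs_mul, abs_inv, inv_mul_le_iff₀ (abs_pos.2 hk)]
      have : |w k| ≤ ‖w‖ := norm_le_pi_norm w k
      linarith
    linarith [neg_abs_le ((d k)⁻¹ * w k)]
  obtain ⟨e, he, he'⟩ := hs.exists_isotopicToId (by norm_num) (U := Metric.closedBall p r) (by
    intro x hx
    rw [mem_closedBall_iff_norm, not_le] at hx
    rw [max_eq_left (by linarith : r + -1 * ‖x - p‖ ≤ 0),
      min_eq_left (by linarith : 0 ≤ -r + 1 * ‖x - p‖)]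
    exact max_eq_left (min_le_left _ _))
  refine ⟨e, he, ?_⟩
  have hd : 0 < 1 + ‖d‖ := by positivity
  have : Metric.ball (0 : ℝ) (r / (1 + ‖d‖)) ∈ 𝓝 (0 : ℝ) := Metric.ball_mem_nhds _ (by positivity)
  filter_upwards [this] with s hs
  rw [mem_ball_zero_iff, Real.norm_eq_abs, lt_div_iff₀ hd] at hs
  rw [he', add_sub_cancel_left, norm_smul, Real.norm_eq_abs]
  have e1 : (d k)⁻¹ * (p + s • d) k + -((d k)⁻¹ * p k) = s := by
    simp
    field_simp
    ring
  have h1 := le_abs_self s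
  have h2 := neg_abs_le s
  have h3 : 0 ≤ |s| * ‖d‖ := by positivity
  rw [e1, max_eq_right (by linarith [abs_nonneg s] : (0 : ℝ) ≤ r + -1 * (|s| * ‖d‖)),
    min_eq_right (by linarith [abs_nonneg s] : -r + 1 * (|s| * ‖d‖) ≤ 0),
    min_eq_right (by linarith), max_eq_right (by linarith)]
  module

/-- There is an isotopy with compact support in `U` that carries a short segment at `a.1` in the
direction `a.2` to one at `b.1` in the direction `b.2`. -/
def GermMovable (U : Set Space) (a b : Space × Space) : Prop :=
  ∃ Q ⊆ U, IsCompact Q ∧ ∃ e, IsotopicToId Q e ∧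
    ∀ᶠ s in 𝓝 (0 : ℝ), e (a.1 + s • a.2) = b.1 + s • b.2

theorem GermMovable.symm {U : Set Space} {a b : Space × Space} (h : GermMovable U a b) :
    GermMovable U b a := by
  obtain ⟨Q, hQ, hc, e, he, he'⟩ := h
  refine ⟨Q, hQ, hc, e.symm, he.symm, ?_⟩
  filter_upwards [he'] with s hs
  rw [Homeomorph.symm_apply_eq, hs]

theorem GermMovable.trans {U : Set Space} {a b c : Space × Space} (h : GermMovable U a b)
    (h' : GermMovable U b c) : GermMovable U a c := by
  obtain ⟨Q, hQ, hc, e, he, he'⟩ := h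
  obtain ⟨Q', hQ', hc', f, hf, hf'⟩ := h'
  refine ⟨Q ∪ Q', Set.union_subset hQ hQ', hc.union hc', e.trans f,
    (he.mono Set.subset_union_left).trans (hf.mono Set.subset_union_right), ?_⟩
  filter_upwards [he', hf'] with s hs hs'
  rw [Homeomorph.trans_apply, hs, hs']

/-- A nearby germ is reached by a translation of the base point and then a transvection of the
direction. The radius is halved so that the ball around the new base point is still contained in
`U`. -/
theorem eventually_germMovable {U : Set Space} (hU : IsOpen U) {a : Space × Space} (ha : a.1 ∈ U)
    (ha' : a.2 ≠ 0) : ∀ᶠ b in 𝓝 a, GermMovable U a b := by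
  obtain ⟨p, d⟩ := a
  obtain ⟨k, hk⟩ : ∃ k, d k ≠ 0 := by
    by_contra! h
    exact ha' (funext h)
  obtain ⟨r', hr', hrU⟩ := Metric.nhds_basis_closedBall.mem_iff.1 (hU.mem_nhds ha)
  set r := r' / 2 with hr
  have hr0 : 0 < r := by positivity
  have h1 : Metric.closedBall p (r / 4) ∈ 𝓝 p := Metric.closedBall_mem_nhds _ (by positivity)
  have h2 : Metric.closedBall d (min (1 / 2) (|d k| / 2)) ∈ 𝓝 d :=
    Metric.closedBall_mem_nhds _ (lt_min (by norm_num) (by positivity))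
  filter_upwards [prod_mem_nhds h1 h2]
  rintro ⟨q, d'⟩ ⟨hq, hd'⟩
  simp only [mem_closedBall_iff_norm, le_min_iff] at hq hd'
  obtain ⟨e, he, he'⟩ := exists_local_translation p (q - p) hr0 hq
  obtain ⟨f, hf, hf'⟩ := exists_local_transvection q d (d' - d) hr0 hk hd'.1 hd'.2
  have s1 : Metric.closedBall p r ⊆ Metric.closedBall p r' :=
    Metric.closedBall_subset_closedBall (by linarith)
  have s2 : Metric.closedBall q r ⊆ Metric.closedBall p r' :=
    Metric.closedBall_subset_closedBall' (by rw [dist_eq_norm]; linarith)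
  refine ⟨_, hrU, isCompact_closedBall p r', e.trans f, (he.mono s1).trans (hf.mono s2), ?_⟩
  have hd : 0 < 1 + ‖d‖ := by positivity
  have : Metric.ball (0 : ℝ) (r / 2 / (1 + ‖d‖)) ∈ 𝓝 (0 : ℝ) :=
    Metric.ball_mem_nhds _ (by positivity)
  filter_upwards [this, hf'] with s hs hs'
  rw [mem_ball_zero_iff, lt_div_iff₀ hd] at hs
  rw [Homeomorph.trans_apply, he', show p + s • d + (q - p) = q + s • d by abel, hs',
    add_sub_cancel]
  rw [add_sub_cancel_left, norm_smul]
  nlinarith [norm_nonneg s]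

theorem one_lt_rank_space : 1 < Module.rank ℝ Space := by
  simp

/-- Being movable is an equivalence relation with open classes on the connected space of pairs of a
point of `U` and a nonzero vector. -/
theorem germMovable {U : Set Space} (hU : IsOpen U) (hc : IsPreconnected U) {p q d d' : Space}
    (hp : p ∈ U) (hq : q ∈ U) (hd : d ≠ 0) (hd' : d' ≠ 0) : GermMovable U (p, d) (q, d') := by
  have h := hc.prod (isConnected_compl_singleton_of_one_lt_rank one_lt_rank_space
    (0 : Space)).isPreconnected
  refine h.induction₂ (GermMovable U) ?_ ?_ ?_ ⟨hp, hd⟩ ⟨hq, hd'⟩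
  · rintro a ⟨ha, ha'⟩
    exact nhdsWithin_le_nhds (eventually_germMovable hU ha ha')
  · intro a b c _ _ _
    exact GermMovable.trans
  · intro a b _ _
    exact GermMovable.symm

/-! ### The standard ball of a tree clasper -/

@[simp]
theorem vec_two (a b c : ℝ) : (![a, b, c] : Space) 2 = c := rfl

theorem continuous_firstChild : Continuous firstChild := by
  unfold firstChild
  fun_prop

theorem continuous_secondChild : Continuous secondChild := by
  unfold secondChild
  fun_prop

theorem mem_Icc_vec {p : Space} {a b c a' b' c' : ℝ} :
    p ∈ Set.Icc ![a, b, c] ![a', b', c'] ↔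
      (a ≤ p 0 ∧ p 0 ≤ a') ∧ (b ≤ p 1 ∧ p 1 ≤ b') ∧ (c ≤ p 2 ∧ p 2 ≤ c') := by
  simp [Set.mem_Icc, Pi.le_def, Fin.forall_fin_succ]
  tauto

theorem isCompact_upperBall : ∀ t : Tree, IsCompact t.upperBall
  | .leaf => isCompact_Icc
  | .node a b => isCompact_Icc.union (((isCompact_upperBall a).image continuous_firstChild).union
      ((isCompact_upperBall b).image continuous_secondChild))

theorem isCompact_ball (t : Tree) : IsCompact t.ball :=
  isCompact_Icc.union (isCompact_upperBall t)

/-- The bounds reproduce themselves: a subtree of height at most `2`, scaled by `1 / 4`, protrudes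
by at most `1 / 2` from its face, and its width shrinks from `3 / 2` to `3 / 8` on each side. -/
theorem upperBall_bounds : ∀ (t : Tree) {p : Space}, p ∈ t.upperBall →
    (-(3 / 2) ≤ p 0 ∧ p 0 ≤ 3 / 2) ∧ (-(3 / 2) ≤ p 1 ∧ p 1 ≤ 3 / 2) ∧ (0 ≤ p 2 ∧ p 2 ≤ 2)
  | .leaf, p, hp => by
    rw [Tree.upperBall, mem_Icc_vec] at hp
    obtain ⟨h1, h2, h3⟩ := hp
    refine ⟨⟨?_, ?_⟩, ⟨?_, ?_⟩, ⟨?_, ?_⟩⟩ <;> linarith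
  | .node a b, p, hp => by
    rw [Tree.upperBall] at hp
    rcases hp with hp | ⟨q, hq, rfl⟩ | ⟨q, hq, rfl⟩
    · rw [mem_Icc_vec] at hp
      obtain ⟨h1, h2, h3⟩ := hp
      refine ⟨⟨?_, ?_⟩, ⟨?_, ?_⟩, ⟨?_, ?_⟩⟩ <;> linarith
    · obtain ⟨h1, h2, h3⟩ := upperBall_bounds a hq
      simp only [firstChild, Matrix.cons_val]
      refine ⟨⟨?_, ?_⟩, ⟨?_, ?_⟩, ⟨?_, ?_⟩⟩ <;> linarith
    · obtain ⟨h1, h2, h3⟩ := upperBall_bounds b hq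
      simp only [secondChild, Matrix.cons_val]
      refine ⟨⟨?_, ?_⟩, ⟨?_, ?_⟩, ⟨?_, ?_⟩⟩ <;> linarith

theorem firstChild_upperBall_bounds (t : Tree) {p : Space} (hp : p ∈ firstChild '' t.upperBall) :
    (1 ≤ p 0 ∧ p 0 ≤ 3 / 2) ∧ (-(3 / 8) ≤ p 1 ∧ p 1 ≤ 3 / 8) ∧ (5 / 8 ≤ p 2 ∧ p 2 ≤ 11 / 8) := by
  obtain ⟨q, hq, rfl⟩ := hp
  obtain ⟨h1, h2, h3⟩ := upperBall_bounds t hq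
  simp only [firstChild, Matrix.cons_val]
  refine ⟨⟨?_, ?_⟩, ⟨?_, ?_⟩, ⟨?_, ?_⟩⟩ <;> linarith

theorem secondChild_upperBall_bounds (t : Tree) {p : Space} (hp : p ∈ secondChild '' t.upperBall) :
    (-(3 / 8) ≤ p 0 ∧ p 0 ≤ 3 / 8) ∧ (1 ≤ p 1 ∧ p 1 ≤ 3 / 2) ∧ (5 / 8 ≤ p 2 ∧ p 2 ≤ 11 / 8) := by
  obtain ⟨q, hq, rfl⟩ := hp
  obtain ⟨h1, h2, h3⟩ := upperBall_bounds t hq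
  simp only [secondChild, Matrix.cons_val]
  refine ⟨⟨?_, ?_⟩, ⟨?_, ?_⟩, ⟨?_, ?_⟩⟩ <;> linarith

/-- The subtrees are centered at height `1` and extend by at most `3 / 8` downwards, so only the
root cube is left below `5 / 8`. -/
theorem upperBall_base_bounds (t : Tree) {p : Space} (hp : p ∈ t.upperBall) (h : p 2 < 5 / 8) :
    (-1 ≤ p 0 ∧ p 0 ≤ 1) ∧ (-1 ≤ p 1 ∧ p 1 ≤ 1) := by
  rcases t with _ | ⟨a, b⟩
  · rw [Tree.upperBall, mem_Icc_vec] at hp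
    exact ⟨hp.1, hp.2.1⟩
  · rw [Tree.upperBall] at hp
    rcases hp with hp | hp | hp
    · rw [mem_Icc_vec] at hp
      exact ⟨hp.1, hp.2.1⟩
    · linarith [(firstChild_upperBall_bounds a hp).2.2.1]
    · linarith [(secondChild_upperBall_bounds b hp).2.2.1]

theorem cube_subset_upperBall (t : Tree) : Set.Icc ![-1, -1, 0] ![1, 1, 2] ⊆ t.upperBall := by
  rcases t with _ | ⟨a, b⟩
  · exact subset_rfl
  · exact Set.subset_union_left

/-- An open box, given by its extents in the three coordinates. -/
def openBox (a b c a' b' c' : ℝ) : Set Space :=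
  {p | (a < p 0 ∧ p 0 < a') ∧ (b < p 1 ∧ p 1 < b') ∧ (c < p 2 ∧ p 2 < c')}

theorem isPreconnected_openBox (a b c a' b' c' : ℝ) : IsPreconnected (openBox a b c a' b' c') := by
  have : openBox a b c a' b' c' = Set.pi Set.univ
      ![Set.Ioo a a', Set.Ioo b b', Set.Ioo c c'] := by
    ext p
    simp [openBox, Set.mem_pi, Fin.forall_fin_succ]
  rw [this]
  refine isPreconnected_univ_pi fun k => ?_
  fin_cases k <;> exact isPreconnected_Ioo

theorem isPreconnected.subset_component {α : Type*} [TopologicalSpace α] {W Q : Set α} {o x : α}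
    (hQ : IsPreconnected Q) (h : Q ⊆ W) (hx : x ∈ Q) (hx' : x ∈ connectedComponentIn W o) :
    Q ⊆ connectedComponentIn W o := by
  rw [connectedComponentIn_eq hx']
  exact hQ.subset_connectedComponentIn hx h

theorem mem_openBox {a b c a' b' c' x y z : ℝ} : ![x, y, z] ∈ openBox a b c a' b' c' ↔
    (a < x ∧ x < a') ∧ (b < y ∧ y < b') ∧ (c < z ∧ z < c') := by
  simp [openBox]

/-- The box is chosen for the induction: its images under the two similarities are boxes inside it,
attached to the faces `x = 1` and `y = 1` of the root cube. The complement of the tree is covered by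
convex boxes that miss everything and by the images of the complements of the subtrees, and each of
these sets is linked to the point `(0, 0, 3)` above the tree. -/
theorem isPreconnected_openBox_diff_upperBall :
    ∀ t : Tree, IsPreconnected (openBox (-2) (-2) 0 2 2 4 \ t.upperBall) := by
  intro t
  induction t with
  | leaf =>
    set W := openBox (-2) (-2) 0 2 2 4 \ Tree.leaf.upperBall with hW
    have box : ∀ {a b c a' b' c' x y z : ℝ}, openBox a b c a' b' c' ⊆ W →
        ![x, y, z] ∈ openBox a b c a' b' c' → ![x, y, z] ∈ connectedComponentIn W ![0, 0, 3] →
        openBox a b c a' b' c' ⊆ connectedComponentIn W ![0, 0, 3] := fun h1 h2 h3 =>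
      isPreconnected.subset_component (isPreconnected_openBox _ _ _ _ _ _) h1 h2 h3
    have sub : ∀ {a b c a' b' c' : ℝ}, -2 ≤ a → a' ≤ 2 → -2 ≤ b → b' ≤ 2 → 0 ≤ c → c' ≤ 4 →
        (2 ≤ c ∨ 1 ≤ a ∨ a' ≤ -1 ∨ 1 ≤ b ∨ b' ≤ -1) → openBox a b c a' b' c' ⊆ W := by
      rintro a b c a' b' c' h1 h2 h3 h4 h5 h6 h7 p ⟨k1, k2, k3⟩
      refine ⟨⟨⟨by linarith, by linarith⟩, ⟨by linarith, by linarith⟩, by linarith, by linarith⟩, ?_⟩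
      intro hp
      rw [Tree.upperBall, mem_Icc_vec] at hp
      rcases h7 with h7 | h7 | h7 | h7 | h7 <;> linarith
    have o : (![0, 0, 3] : Space) ∈ connectedComponentIn W ![0, 0, 3] := by
      refine mem_connectedComponentIn (sub (a := -2) (b := -2) (c := 2) (a' := 2) (b' := 2)
        (c' := 4) ?_ ?_ ?_ ?_ ?_ ?_ ?_ ?_) <;> norm_num [mem_openBox]
    have top : openBox (-2) (-2) 2 2 2 4 ⊆ connectedComponentIn W ![0, 0, 3] := by
      refine box (sub ?_ ?_ ?_ ?_ ?_ ?_ ?_) ?_ o <;> norm_num [mem_openBox]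
    have xp : openBox 1 (-2) 0 2 2 4 ⊆ connectedComponentIn W ![0, 0, 3] := by
      refine box (x := 3 / 2) (y := 0) (z := 3) (sub ?_ ?_ ?_ ?_ ?_ ?_ ?_) ?_ (top ?_) <;>
        norm_num [mem_openBox]
    have xn : openBox (-2) (-2) 0 (-1) 2 4 ⊆ connectedComponentIn W ![0, 0, 3] := by
      refine box (x := -3 / 2) (y := 0) (z := 3) (sub ?_ ?_ ?_ ?_ ?_ ?_ ?_) ?_ (top ?_) <;>
        norm_num [mem_openBox]
    have yp : openBox (-2) 1 0 2 2 4 ⊆ connectedComponentIn W ![0, 0, 3] := by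
      refine box (x := 0) (y := 3 / 2) (z := 3) (sub ?_ ?_ ?_ ?_ ?_ ?_ ?_) ?_ (top ?_) <;>
        norm_num [mem_openBox]
    have yn : openBox (-2) (-2) 0 2 (-1) 4 ⊆ connectedComponentIn W ![0, 0, 3] := by
      refine box (x := 0) (y := -3 / 2) (z := 3) (sub ?_ ?_ ?_ ?_ ?_ ?_ ?_) ?_ (top ?_) <;>
        norm_num [mem_openBox]
    suffices h : W ⊆ connectedComponentIn W ![0, 0, 3] by
      rw [(connectedComponentIn_subset _ _).antisymm h |>.symm]
      exact isPreconnected_connectedComponentIn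
    rintro p ⟨⟨h1, h2, h3⟩, hp⟩
    rw [Tree.upperBall, mem_Icc_vec] at hp
    by_cases c1 : 2 < p 2
    · exact top ⟨h1, h2, c1, h3.2⟩
    by_cases c2 : 1 < p 0
    · exact xp ⟨⟨c2, h1.2⟩, h2, h3⟩
    by_cases c3 : p 0 < -1
    · exact xn ⟨⟨h1.1, c3⟩, h2, h3⟩
    by_cases c4 : 1 < p 1
    · exact yp ⟨h1, ⟨c4, h2.2⟩, h3⟩
    by_cases c5 : p 1 < -1
    · exact yn ⟨h1, ⟨h2.1, c5⟩, h3⟩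
    push Not at c1 c2 c3 c4 c5
    exact absurd ⟨⟨c3, c2⟩, ⟨c5, c4⟩, h3.1.le, c1⟩ hp
  | node s t ihs iht =>
    set W := openBox (-2) (-2) 0 2 2 4 \ (Tree.node s t).upperBall with hW
    have box : ∀ {a b c a' b' c' x y z : ℝ}, openBox a b c a' b' c' ⊆ W →
        ![x, y, z] ∈ openBox a b c a' b' c' → ![x, y, z] ∈ connectedComponentIn W ![0, 0, 3] →
        openBox a b c a' b' c' ⊆ connectedComponentIn W ![0, 0, 3] := fun h1 h2 h3 =>
      isPreconnected.subset_component (isPreconnected_openBox _ _ _ _ _ _) h1 h2 h3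
    -- The three disjunctions express that the box misses the root cube, the first subtree and the
    -- second subtree.
    have sub : ∀ {a b c a' b' c' : ℝ}, -2 ≤ a → a' ≤ 2 → -2 ≤ b → b' ≤ 2 → 0 ≤ c → c' ≤ 4 →
        (2 ≤ c ∨ 1 ≤ a ∨ a' ≤ -1 ∨ 1 ≤ b ∨ b' ≤ -1) →
        (3 / 2 ≤ a ∨ a' ≤ 1 ∨ 3 / 8 ≤ b ∨ b' ≤ -(3 / 8) ∨ 11 / 8 ≤ c ∨ c' ≤ 5 / 8) →
        (3 / 2 ≤ b ∨ b' ≤ 1 ∨ 3 / 8 ≤ a ∨ a' ≤ -(3 / 8) ∨ 11 / 8 ≤ c ∨ c' ≤ 5 / 8) →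
        openBox a b c a' b' c' ⊆ W := by
      rintro a b c a' b' c' h1 h2 h3 h4 h5 h6 h7 h8 h9 p ⟨k1, k2, k3⟩
      refine ⟨⟨⟨by linarith, by linarith⟩, ⟨by linarith, by linarith⟩, by linarith, by linarith⟩, ?_⟩
      rw [Tree.upperBall]
      rintro (hp | hp | hp)
      · rw [mem_Icc_vec] at hp
        rcases h7 with h7 | h7 | h7 | h7 | h7 <;> linarith
      · have := firstChild_upperBall_bounds s hp
        rcases h8 with h7 | h7 | h7 | h7 | h7 | h7 <;> linarith
      · have := secondChild_upperBall_bounds t hp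
        rcases h9 with h7 | h7 | h7 | h7 | h7 | h7 <;> linarith
    have o : (![0, 0, 3] : Space) ∈ connectedComponentIn W ![0, 0, 3] := by
      refine mem_connectedComponentIn (sub (a := -2) (b := -2) (c := 2) (a' := 2) (b' := 2)
        (c' := 4) ?_ ?_ ?_ ?_ ?_ ?_ ?_ ?_ ?_ ?_) <;> norm_num [mem_openBox]
    have top : openBox (-2) (-2) 2 2 2 4 ⊆ connectedComponentIn W ![0, 0, 3] := by
      refine box (sub ?_ ?_ ?_ ?_ ?_ ?_ ?_ ?_ ?_) ?_ o <;> norm_num [mem_openBox]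
    have Q1 : openBox (-2) (-2) 0 (-1) 2 4 ⊆ connectedComponentIn W ![0, 0, 3] := by
      refine box (x := -3 / 2) (y := 0) (z := 3) (sub ?_ ?_ ?_ ?_ ?_ ?_ ?_ ?_ ?_) ?_ (top ?_) <;>
        norm_num [mem_openBox]
    have Q2 : openBox (-2) (-2) 0 2 (-1) 4 ⊆ connectedComponentIn W ![0, 0, 3] := by
      refine box (x := 0) (y := -3 / 2) (z := 3) (sub ?_ ?_ ?_ ?_ ?_ ?_ ?_ ?_ ?_) ?_ (top ?_) <;>
        norm_num [mem_openBox]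
    have Q4 : openBox 1 (3 / 8) 0 2 2 4 ⊆ connectedComponentIn W ![0, 0, 3] := by
      refine box (x := 3 / 2) (y := 1) (z := 3) (sub ?_ ?_ ?_ ?_ ?_ ?_ ?_ ?_ ?_) ?_ (top ?_) <;>
        norm_num [mem_openBox]
    have Q5 : openBox 1 (-2) 0 2 (-(3 / 8)) 4 ⊆ connectedComponentIn W ![0, 0, 3] := by
      refine box (x := 3 / 2) (y := -1) (z := 3) (sub ?_ ?_ ?_ ?_ ?_ ?_ ?_ ?_ ?_) ?_ (top ?_) <;>
        norm_num [mem_openBox]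
    have Q6 : openBox 1 (-2) (11 / 8) 2 2 4 ⊆ connectedComponentIn W ![0, 0, 3] := by
      refine box (x := 3 / 2) (y := 0) (z := 3) (sub ?_ ?_ ?_ ?_ ?_ ?_ ?_ ?_ ?_) ?_ (top ?_) <;>
        norm_num [mem_openBox]
    have Q8 : openBox (3 / 2) (-2) 0 2 2 4 ⊆ connectedComponentIn W ![0, 0, 3] := by
      refine box (x := 7 / 4) (y := 0) (z := 3) (sub ?_ ?_ ?_ ?_ ?_ ?_ ?_ ?_ ?_) ?_ (top ?_) <;>
        norm_num [mem_openBox]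
    have Q7 : openBox 1 (-2) 0 2 2 (5 / 8) ⊆ connectedComponentIn W ![0, 0, 3] := by
      refine box (x := 7 / 4) (y := 0) (z := 1 / 2) (sub ?_ ?_ ?_ ?_ ?_ ?_ ?_ ?_ ?_) ?_ (Q8 ?_) <;>
        norm_num [mem_openBox]
    have Q9 : openBox (3 / 8) 1 0 2 2 4 ⊆ connectedComponentIn W ![0, 0, 3] := by
      refine box (x := 1) (y := 3 / 2) (z := 3) (sub ?_ ?_ ?_ ?_ ?_ ?_ ?_ ?_ ?_) ?_ (top ?_) <;>
        norm_num [mem_openBox]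
    have Q10 : openBox (-2) 1 0 (-(3 / 8)) 2 4 ⊆ connectedComponentIn W ![0, 0, 3] := by
      refine box (x := -1) (y := 3 / 2) (z := 3) (sub ?_ ?_ ?_ ?_ ?_ ?_ ?_ ?_ ?_) ?_ (top ?_) <;>
        norm_num [mem_openBox]
    have Q11 : openBox (-2) 1 (11 / 8) 2 2 4 ⊆ connectedComponentIn W ![0, 0, 3] := by
      refine box (x := 0) (y := 3 / 2) (z := 3) (sub ?_ ?_ ?_ ?_ ?_ ?_ ?_ ?_ ?_) ?_ (top ?_) <;>
        norm_num [mem_openBox]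
    have Q13 : openBox (-2) (3 / 2) 0 2 2 4 ⊆ connectedComponentIn W ![0, 0, 3] := by
      refine box (x := 0) (y := 7 / 4) (z := 3) (sub ?_ ?_ ?_ ?_ ?_ ?_ ?_ ?_ ?_) ?_ (top ?_) <;>
        norm_num [mem_openBox]
    have Q12 : openBox (-2) 1 0 2 2 (5 / 8) ⊆ connectedComponentIn W ![0, 0, 3] := by
      refine box (x := 0) (y := 7 / 4) (z := 1 / 2) (sub ?_ ?_ ?_ ?_ ?_ ?_ ?_ ?_ ?_) ?_ (Q13 ?_) <;>
        norm_num [mem_openBox]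
    have mem3 : ∀ r : Tree, (![0, 0, 3] : Space) ∈ openBox (-2) (-2) 0 2 2 4 \ r.upperBall := by
      intro r
      refine ⟨by norm_num [mem_openBox], fun h => ?_⟩
      have := (upperBall_bounds r h).2.2.2
      norm_num at this
    -- The base point `(0, 0, 3)` of the subtree goes to `(7 / 4, 0, 1)`, which lies in the region
    -- `Q8` beyond the subtree.
    have R1 : firstChild '' (openBox (-2) (-2) 0 2 2 4 \ s.upperBall) ⊆
        connectedComponentIn W ![0, 0, 3] := by
      refine isPreconnected.subset_component (ihs.image _ continuous_firstChild.continuousOn) ?_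
        ⟨_, mem3 s, rfl⟩ (Q8 (by norm_num [firstChild, mem_openBox]))
      rintro _ ⟨q, ⟨⟨h1, h2, h3⟩, hq⟩, rfl⟩
      refine ⟨?_, ?_⟩
      · simp only [firstChild, mem_openBox]
        refine ⟨⟨?_, ?_⟩, ⟨?_, ?_⟩, ⟨?_, ?_⟩⟩ <;> linarith
      · rw [Tree.upperBall]
        rintro (hp | ⟨q', hq', e⟩ | hp)
        · rw [mem_Icc_vec] at hp
          simp only [firstChild, Matrix.cons_val] at hp
          linarith
        · have : q' = q := by
            have e0 := congrFun e 0
            have e1 := congrFun e 1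
            have e2 := congrFun e 2
            simp only [firstChild, Matrix.cons_val] at e0 e1 e2
            ext k
            fin_cases k
            · change q' 0 = q 0
              linarith
            · change q' 1 = q 1
              linarith
            · change q' 2 = q 2
              linarith
          exact hq (this ▸ hq')
        · have := (secondChild_upperBall_bounds t hp).1.2
          simp only [firstChild, Matrix.cons_val] at this
          linarith
    have R2 : secondChild '' (openBox (-2) (-2) 0 2 2 4 \ t.upperBall) ⊆
        connectedComponentIn W ![0, 0, 3] := by
      refine isPreconnected.subset_component (iht.image _ continuous_secondChild.continuousOn) ?_
        ⟨_, mem3 t, rfl⟩ (Q13 (by norm_num [secondChild, mem_openBox]))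
      rintro _ ⟨q, ⟨⟨h1, h2, h3⟩, hq⟩, rfl⟩
      refine ⟨?_, ?_⟩
      · simp only [secondChild, mem_openBox]
        refine ⟨⟨?_, ?_⟩, ⟨?_, ?_⟩, ⟨?_, ?_⟩⟩ <;> linarith
      · rw [Tree.upperBall]
        rintro (hp | hp | ⟨q', hq', e⟩)
        · rw [mem_Icc_vec] at hp
          simp only [secondChild, Matrix.cons_val] at hp
          linarith
        · have := (firstChild_upperBall_bounds s hp).1.1
          simp only [secondChild, Matrix.cons_val] at this
          linarith
        · have : q' = q := by
            have e0 := congrFun e 0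
            have e1 := congrFun e 1
            have e2 := congrFun e 2
            simp only [secondChild, Matrix.cons_val] at e0 e1 e2
            ext k
            fin_cases k
            · change q' 0 = q 0
              linarith
            · change q' 1 = q 1
              linarith
            · change q' 2 = q 2
              linarith
          exact hq (this ▸ hq')
    suffices h : W ⊆ connectedComponentIn W ![0, 0, 3] by
      rw [(connectedComponentIn_subset _ _).antisymm h |>.symm]
      exact isPreconnected_connectedComponentIn
    rintro p ⟨⟨h1, h2, h3⟩, hp⟩
    rw [Tree.upperBall] at hp
    simp only [Set.mem_union, not_or] at hp
    obtain ⟨hp1, hp2, hp3⟩ := hp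
    rw [mem_Icc_vec] at hp1
    by_cases c1 : 2 < p 2
    · exact top ⟨h1, h2, c1, h3.2⟩
    by_cases c3 : p 0 < -1
    · exact Q1 ⟨⟨h1.1, c3⟩, h2, h3⟩
    by_cases c5 : p 1 < -1
    · exact Q2 ⟨h1, ⟨h2.1, c5⟩, h3⟩
    by_cases c2 : 1 < p 0
    · by_cases d1 : 3 / 8 < p 1
      · exact Q4 ⟨⟨c2, h1.2⟩, ⟨d1, h2.2⟩, h3⟩
      by_cases d2 : p 1 < -(3 / 8)
      · exact Q5 ⟨⟨c2, h1.2⟩, ⟨h2.1, d2⟩, h3⟩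
      by_cases d3 : 11 / 8 < p 2
      · exact Q6 ⟨⟨c2, h1.2⟩, h2, d3, h3.2⟩
      by_cases d4 : p 2 < 5 / 8
      · exact Q7 ⟨⟨c2, h1.2⟩, h2, h3.1, d4⟩
      push Not at d1 d2 d3 d4
      have e : p = firstChild ![4 * (p 2 - 1), -4 * p 1, 4 * (p 0 - 1)] := by
        ext k
        fin_cases k <;> simp [firstChild]
      refine R1 ⟨_, ⟨?_, fun h => hp2 ⟨_, h, e.symm⟩⟩, e.symm⟩
      rw [mem_openBox]
      refine ⟨⟨?_, ?_⟩, ⟨?_, ?_⟩, ⟨?_, ?_⟩⟩ <;> linarith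
    by_cases c4 : 1 < p 1
    · by_cases d1 : 3 / 8 < p 0
      · exact Q9 ⟨⟨d1, h1.2⟩, ⟨c4, h2.2⟩, h3⟩
      by_cases d2 : p 0 < -(3 / 8)
      · exact Q10 ⟨⟨h1.1, d2⟩, ⟨c4, h2.2⟩, h3⟩
      by_cases d3 : 11 / 8 < p 2
      · exact Q11 ⟨h1, ⟨c4, h2.2⟩, d3, h3.2⟩
      by_cases d4 : p 2 < 5 / 8
      · exact Q12 ⟨h1, ⟨c4, h2.2⟩, h3.1, d4⟩
      push Not at d1 d2 d3 d4
      have e : p = secondChild ![4 * p 0, -4 * (p 2 - 1), 4 * (p 1 - 1)] := by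
        ext k
        fin_cases k <;> simp [secondChild]
        ring
      refine R2 ⟨_, ⟨?_, fun h => hp3 ⟨_, h, e.symm⟩⟩, e.symm⟩
      rw [mem_openBox]
      refine ⟨⟨?_, ?_⟩, ⟨?_, ?_⟩, ⟨?_, ?_⟩⟩ <;> linarith
    push Not at c1 c2 c3 c4 c5
    exact absurd ⟨⟨c3, c2⟩, ⟨c5, c4⟩, h3.1.le, c1⟩ hp1

/-- Apart from a box around the subtrees, the complement is a union of half-spaces and of their
intersections with `p 2 < 5 / 8`, where the ball is no wider than a cube. All these convex sets are
linked to a point above the ball. -/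
theorem isPreconnected_compl_ball (t : Tree) : IsPreconnected t.ballᶜ := by
  set o : Space := ![0, 0, 3] with ho
  have absorb : ∀ {Q : Set Space} (x : Space), IsPreconnected Q → Q ⊆ t.ballᶜ → x ∈ Q →
      x ∈ connectedComponentIn t.ballᶜ o → Q ⊆ connectedComponentIn t.ballᶜ o :=
    fun x h1 h2 h3 h4 => isPreconnected.subset_component h1 h2 h3 h4
  have half : ∀ (φ : Space →ₗ[ℝ] ℝ) (c : ℝ), IsPreconnected {p : Space | c < φ p} := fun φ c =>
    (convex_halfSpace_gt φ.isLinear c).isPreconnected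
  have half' : ∀ (φ : Space →ₗ[ℝ] ℝ) (c : ℝ),
      IsPreconnected {p : Space | p 2 < 5 / 8 ∧ c < φ p} := fun φ c =>
    ((convex_halfSpace_lt (LinearMap.proj (R := ℝ) (φ := fun _ : Fin 3 => ℝ) 2).isLinear
      (5 / 8)).inter (convex_halfSpace_gt φ.isLinear c)).isPreconnected
  let π : Fin 3 → Space →ₗ[ℝ] ℝ := fun k => LinearMap.proj (R := ℝ) (φ := fun _ : Fin 3 => ℝ) k
  have far : ∀ p : Space, (2 < p 2 ∨ p 2 < -2 ∨ 3 / 2 < p 0 ∨ p 0 < -(3 / 2) ∨ 3 / 2 < p 1 ∨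
      p 1 < -(3 / 2) ∨ (p 2 < 5 / 8 ∧ (1 < p 0 ∨ p 0 < -1 ∨ 1 < p 1 ∨ p 1 < -1))) →
      p ∈ t.ballᶜ := by
    intro p hp h
    rw [Tree.ball] at h
    rcases h with h | h
    · rw [mem_Icc_vec] at h
      rcases hp with hp | hp | hp | hp | hp | hp | ⟨-, hp | hp | hp | hp⟩ <;> linarith
    · have h1 := upperBall_bounds t h
      rcases hp with hp | hp | hp | hp | hp | hp | ⟨hp', hp⟩
      · linarith
      · linarith
      · linarith
      · linarith
      · linarith
      · linarith
      · have h2 := upperBall_base_bounds t h hp'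
        rcases hp with hp | hp | hp | hp <;> linarith
  have o' : o ∈ connectedComponentIn t.ballᶜ o :=
    mem_connectedComponentIn (far o (Or.inl (by norm_num [ho])))
  have top : {p : Space | 2 < p 2} ⊆ connectedComponentIn t.ballᶜ o :=
    absorb o (half (π 2) 2) (fun p hp => far p (Or.inl hp)) (by norm_num [ho]) o'
  have xp : {p : Space | 3 / 2 < p 0} ⊆ connectedComponentIn t.ballᶜ o := by
    refine absorb ![2, 0, 3] (half (π 0) (3 / 2)) (fun p hp => far p ?_) (by norm_num)
      (top (by norm_num))
    have : 3 / 2 < p 0 := hp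
    tauto
  have xn : {p : Space | 3 / 2 < (-π 0) p} ⊆ connectedComponentIn t.ballᶜ o := by
    refine absorb ![-2, 0, 3] (half (-π 0) (3 / 2)) (fun p hp => far p ?_) (by norm_num [π])
      (top (by norm_num))
    have : 3 / 2 < - p 0 := hp
    have : p 0 < -(3 / 2) := by linarith
    tauto
  have yp : {p : Space | 3 / 2 < p 1} ⊆ connectedComponentIn t.ballᶜ o := by
    refine absorb ![0, 2, 3] (half (π 1) (3 / 2)) (fun p hp => far p ?_) (by norm_num)
      (top (by norm_num))
    have : 3 / 2 < p 1 := hp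
    tauto
  have yn : {p : Space | 3 / 2 < (-π 1) p} ⊆ connectedComponentIn t.ballᶜ o := by
    refine absorb ![0, -2, 3] (half (-π 1) (3 / 2)) (fun p hp => far p ?_) (by norm_num [π])
      (top (by norm_num))
    have : 3 / 2 < - p 1 := hp
    have : p 1 < -(3 / 2) := by linarith
    tauto
  have bot : {p : Space | 2 < (-π 2) p} ⊆ connectedComponentIn t.ballᶜ o := by
    refine absorb ![2, 0, -3] (half (-π 2) 2) (fun p hp => far p ?_) (by norm_num [π])
      (xp (by norm_num))
    have : 2 < - p 2 := hp
    have : p 2 < -2 := by linarith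
    tauto
  have xp' : {p : Space | p 2 < 5 / 8 ∧ 1 < (π 0) p} ⊆ connectedComponentIn t.ballᶜ o := by
    refine absorb ![2, 0, 0] (half' (π 0) 1) (fun p hp => far p ?_) (by norm_num [π])
      (xp (by norm_num))
    have : p 2 < 5 / 8 ∧ 1 < p 0 := hp
    tauto
  have xn' : {p : Space | p 2 < 5 / 8 ∧ 1 < (-π 0) p} ⊆ connectedComponentIn t.ballᶜ o := by
    refine absorb ![-2, 0, 0] (half' (-π 0) 1) (fun p hp => far p ?_) (by norm_num [π])
      (xn (by norm_num [π]))
    have h : p 2 < 5 / 8 ∧ 1 < -p 0 := hp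
    have : p 0 < -1 := by linarith
    tauto
  have yp' : {p : Space | p 2 < 5 / 8 ∧ 1 < (π 1) p} ⊆ connectedComponentIn t.ballᶜ o := by
    refine absorb ![0, 2, 0] (half' (π 1) 1) (fun p hp => far p ?_) (by norm_num [π])
      (yp (by norm_num))
    have : p 2 < 5 / 8 ∧ 1 < p 1 := hp
    tauto
  have yn' : {p : Space | p 2 < 5 / 8 ∧ 1 < (-π 1) p} ⊆ connectedComponentIn t.ballᶜ o := by
    refine absorb ![0, -2, 0] (half' (-π 1) 1) (fun p hp => far p ?_) (by norm_num [π])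
      (yn (by norm_num [π]))
    have h : p 2 < 5 / 8 ∧ 1 < -p 1 := hp
    have : p 1 < -1 := by linarith
    tauto
  have inner : openBox (-2) (-2) 0 2 2 4 \ t.upperBall ⊆ connectedComponentIn t.ballᶜ o := by
    refine absorb o (isPreconnected_openBox_diff_upperBall t) ?_ ⟨?_, fun h => ?_⟩ o'
    · rintro p ⟨hp, hp'⟩ h
      rw [Tree.ball] at h
      rcases h with h | h
      · rw [mem_Icc_vec] at h
        linarith [hp.2.2.1]
      · exact hp' h
    · rw [ho, mem_openBox]
      norm_num
    · have := (upperBall_bounds t h).2.2.2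
      norm_num [ho] at this
  suffices h : t.ballᶜ ⊆ connectedComponentIn t.ballᶜ o by
    rw [(connectedComponentIn_subset _ _).antisymm h |>.symm]
    exact isPreconnected_connectedComponentIn
  intro p hp
  rw [Tree.ball, Set.mem_compl_iff, Set.mem_union, not_or, mem_Icc_vec] at hp
  obtain ⟨hp1, hp2⟩ := hp
  by_cases c1 : 2 < p 2
  · exact top c1
  by_cases c2 : 2 < -p 2
  · exact bot c2
  by_cases c3 : 3 / 2 < p 0
  · exact xp c3
  by_cases c4 : 3 / 2 < -p 0
  · exact xn c4
  by_cases c5 : 3 / 2 < p 1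
  · exact yp c5
  by_cases c6 : 3 / 2 < -p 1
  · exact yn c6
  push Not at c1 c2 c3 c4 c5 c6
  by_cases c0 : 0 < p 2
  · refine inner ⟨⟨⟨?_, ?_⟩, ⟨?_, ?_⟩, ⟨?_, ?_⟩⟩, hp2⟩ <;> linarith
  push Not at c0
  have c0' : p 2 < 5 / 8 := by linarith
  by_cases d1 : 1 < p 0
  · exact xp' ⟨c0', d1⟩
  by_cases d2 : 1 < -p 0
  · exact xn' ⟨c0', d2⟩
  by_cases d3 : 1 < p 1
  · exact yp' ⟨c0', d3⟩
  by_cases d4 : 1 < -p 1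
  · exact yn' ⟨c0', d4⟩
  push Not at d1 d2 d3 d4
  exact absurd ⟨⟨by linarith, d1⟩, ⟨by linarith, d3⟩, by linarith, c0⟩ hp1

/-! ### A circle is not contained in the strands -/

/-- A value halfway between those at `0` and at `1 / 2` is taken on each of the two half circles. -/
theorem not_injective_of_continuous_circle {c : UnitAddCircle → ℝ} (hc : Continuous c) :
    ¬ Function.Injective c := by
  intro hi
  set g : ℝ → ℝ := fun t => c (t : UnitAddCircle) with hg
  have hgc : Continuous g := hc.comp continuous_quotient_mk'
  have h1 : g 1 = g 0 := by
    simp only [hg]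
    rw [AddCircle.coe_period]
    simp
  have inj : ∀ s ∈ Set.Ico (0 : ℝ) 1, ∀ t ∈ Set.Ico (0 : ℝ) 1, g s = g t → s = t := by
    intro s hs t ht h
    have := hi h
    rwa [AddCircle.coe_eq_coe_iff_of_mem_Ico (a := 0) (by simpa using hs) (by simpa using ht)]
      at this
  have hne : g 0 ≠ g (1 / 2) := fun h => by
    have := inj 0 (by norm_num) (1 / 2) (by norm_num) h
    norm_num at this
  set v := (g 0 + g (1 / 2)) / 2 with hv
  have e1 : v ∈ Set.uIcc (g 0) (g (1 / 2)) := by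
    rw [Set.mem_uIcc]
    rcases le_total (g 0) (g (1 / 2)) with h | h
    · left; constructor <;> linarith
    · right; constructor <;> linarith
  have e2 : v ∈ Set.uIcc (g (1 / 2)) (g 1) := by
    rw [h1, Set.uIcc_comm]; exact e1
  obtain ⟨s, hs, hs'⟩ := intermediate_value_uIcc hgc.continuousOn e1
  obtain ⟨t, ht, ht'⟩ := intermediate_value_uIcc hgc.continuousOn e2
  rw [Set.uIcc_of_le (by norm_num)] at hs ht
  have ht1 : t ≠ 1 := by
    rintro rfl
    rw [h1] at ht'
    exact hne (by linarith)
  have := inj s ⟨hs.1, by linarith [hs.2]⟩ t ⟨by linarith [ht.1], lt_of_le_of_ne ht.2 ht1⟩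
    (hs'.trans ht'.symm)
  have h2 : s = 1 / 2 := by linarith [hs.2, ht.1]
  rw [h2] at hs'
  exact hne (by linarith)

theorem isCompact_segment (a b : Space) : IsCompact (segment ℝ a b) := by
  rw [segment_eq_image_lineMap]
  exact isCompact_Icc.image AffineMap.lineMap_continuous

theorem isCompact_upperStrands : ∀ t : Tree, IsCompact t.upperStrands
  | .leaf => isCompact_segment _ _
  | .node a b => ((isCompact_upperStrands a).image continuous_firstChild).union
      ((isCompact_upperStrands b).image continuous_secondChild)

theorem segment_leaf {p : Space} (hp : p ∈ segment ℝ ![0, -1, 1] ![0, 1, 1]) :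
    p 0 = 0 ∧ p 2 = 1 ∧ -1 ≤ p 1 ∧ p 1 ≤ 1 := by
  obtain ⟨a, b, ha, hb, hab, rfl⟩ := hp
  simp
  refine ⟨hab, ?_, ?_⟩ <;> linarith

theorem upperStrands_bounds : ∀ (t : Tree) {p : Space}, p ∈ t.upperStrands →
    (-(3 / 2) ≤ p 0 ∧ p 0 ≤ 3 / 2) ∧ (-(3 / 2) ≤ p 1 ∧ p 1 ≤ 3 / 2) ∧ (0 ≤ p 2 ∧ p 2 ≤ 2)
  | .leaf, p, hp => by
    obtain ⟨h1, h2, h3, h4⟩ := segment_leaf hp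
    refine ⟨⟨?_, ?_⟩, ⟨?_, ?_⟩, ⟨?_, ?_⟩⟩ <;> linarith
  | .node a b, p, hp => by
    rw [Tree.upperStrands] at hp
    rcases hp with ⟨q, hq, rfl⟩ | ⟨q, hq, rfl⟩
    · obtain ⟨h1, h2, h3⟩ := upperStrands_bounds a hq
      simp only [firstChild, Matrix.cons_val]
      refine ⟨⟨?_, ?_⟩, ⟨?_, ?_⟩, ⟨?_, ?_⟩⟩ <;> linarith
    · obtain ⟨h1, h2, h3⟩ := upperStrands_bounds b hq
      simp only [secondChild, Matrix.cons_val]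
      refine ⟨⟨?_, ?_⟩, ⟨?_, ?_⟩, ⟨?_, ?_⟩⟩ <;> linarith

theorem range_subset_or_subset {f : UnitAddCircle → Space} (hf : Continuous f) {A B : Set Space}
    (hA : IsCompact A) (hB : IsCompact B) (h : Disjoint A B) (hAB : Set.range f ⊆ A ∪ B) :
    Set.range f ⊆ A ∨ Set.range f ⊆ B :=
  isPreconnected_iff_subset_of_disjoint_closed.1 (isPreconnected_range hf) A B hA.isClosed
    hB.isClosed hAB (by rw [h.inter_eq, Set.inter_empty])

/-- The strands of the two subtrees are disjoint compact sets, so a connected curve lies in one of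
them. Undoing the similarity leads by induction to a single segment, on which one coordinate is
injective. -/
theorem not_range_subset_upperStrands (t : Tree) : ∀ {f : UnitAddCircle → Space}, Continuous f →
    Function.Injective f → ¬ Set.range f ⊆ t.upperStrands := by
  induction t with
  | leaf =>
    intro f hf hi h
    refine not_injective_of_continuous_circle ((continuous_apply 1).comp hf) fun x y hxy => hi ?_
    obtain ⟨h1, h2, -⟩ := segment_leaf (h ⟨x, rfl⟩)
    obtain ⟨k1, k2, -⟩ := segment_leaf (h ⟨y, rfl⟩)
    ext k
    fin_cases k
    exacts [h1.trans k1.symm, hxy, h2.trans k2.symm]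
  | node a b iha ihb =>
    intro f hf hi h
    have hd : Disjoint (firstChild '' a.upperStrands) (secondChild '' b.upperStrands) := by
      rw [Set.disjoint_left]
      rintro _ ⟨q, hq, rfl⟩ ⟨q', hq', e⟩
      have e0 := congrFun e 0
      have h1 := upperStrands_bounds a hq
      have h2 := upperStrands_bounds b hq'
      simp only [firstChild, secondChild, Matrix.cons_val] at e0
      linarith
    rcases range_subset_or_subset hf ((isCompact_upperStrands a).image continuous_firstChild)
      ((isCompact_upperStrands b).image continuous_secondChild) hd h with h' | h'
    · choose g hg hg' using fun x => h' ⟨x, rfl⟩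
      have e : g = fun x => ![4 * (f x 2 - 1), -4 * f x 1, 4 * (f x 0 - 1)] := by
        funext x
        rw [← hg']
        ext k
        fin_cases k <;> simp [firstChild] <;> ring
      refine iha (f := g) (by rw [e]; fun_prop) (fun x y hxy => hi ?_) ?_
      · rw [← hg', ← hg', hxy]
      · rintro _ ⟨x, rfl⟩
        exact hg x
    · choose g hg hg' using fun x => h' ⟨x, rfl⟩
      have e : g = fun x => ![4 * f x 0, -4 * (f x 2 - 1), 4 * (f x 1 - 1)] := by
        funext x
        rw [← hg']
        ext k
        fin_cases k <;> simp [secondChild] <;> ring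
      refine ihb (f := g) (by rw [e]; fun_prop) (fun x y hxy => hi ?_) ?_
      · rw [← hg', ← hg', hxy]
      · rintro _ ⟨x, rfl⟩
        exact hg x

theorem not_range_subset_strands (t : Tree) {f : UnitAddCircle → Space} (hf : Continuous f)
    (hi : Function.Injective f) : ¬ Set.range f ⊆ t.strands := by
  intro h
  have root : ∀ p ∈ segment ℝ (![-1, 0, -1] : Space) ![1, 0, -1], p 1 = 0 ∧ p 2 = -1 := by
    rintro _ ⟨a, b, -, -, hab, rfl⟩
    simp
    linarith
  rcases range_subset_or_subset hf (isCompact_segment _ _) (isCompact_upperStrands t)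
    (Set.disjoint_left.2 fun p hp hp' => by
      linarith [(root p hp).2, (upperStrands_bounds t hp').2.2.1]) h with h' | h'
  · refine not_injective_of_continuous_circle ((continuous_apply 0).comp hf) fun x y hxy => hi ?_
    obtain ⟨h1, h2⟩ := root _ (h' ⟨x, rfl⟩)
    obtain ⟨k1, k2⟩ := root _ (h' ⟨y, rfl⟩)
    ext k
    fin_cases k
    exacts [hxy, h1.trans k1.symm, h2.trans k2.symm]
  · exact not_range_subset_upperStrands t hf hi h'

/-! ### Straight pieces of a link -/

theorem coe_fract_circle (t : ℝ) : ((Int.fract t : ℝ) : UnitAddCircle) = t := by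
  have h : ((⌊t⌋ : ℝ) : UnitAddCircle) = 0 := by
    have := AddCircle.coe_period (1 : ℝ)
    have h2 : (⌊t⌋ : ℝ) = ⌊t⌋ • (1 : ℝ) := by simp
    rw [h2, AddCircle.coe_zsmul, this, smul_zero]
  rw [Int.fract, AddCircle.coe_sub, h, sub_zero]

variable {l : ℕ}

/-- Continuity is given on one period only; it extends because the values at `0` and `1` agree. -/
theorem Link.continuous_path (L : Link l) (i : Fin l) :
    Continuous fun t : ℝ => L.toFun i (t : UnitAddCircle) := by
  have h := ContinuousOn.comp_fract'' (L.isPL i).1 (by simp [AddCircle.coe_period])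
  exact h.congr fun t => by simp

theorem Link.continuous (L : Link l) (i : Fin l) : Continuous (L.toFun i) :=
  (QuotientAddGroup.isQuotientMap_mk (N := AddSubgroup.zmultiples (1 : ℝ))).continuous_iff.2
    (L.continuous_path i)

theorem Link.injective_component (L : Link l) (i : Fin l) : Function.Injective (L.toFun i) :=
  fun x y h => congrArg Prod.snd (L.injective (a₁ := (i, x)) (a₂ := (i, y)) h)

/-- The image of a link under a piecewise linear homeomorphism. -/
def Link.map (L : Link l) (e : Space ≃ₜ Space) (he : IsPLOn e Set.univ) : Link l where
  toFun i x := e (L.toFun i x)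
  injective := e.injective.comp L.injective
  isPL i := he.comp (L.isPL i) (Set.mapsTo_univ _ _)

theorem coe_injOn_Ioo {s t : ℝ} (hs : s ∈ Set.Ioo (0 : ℝ) 1) (ht : t ∈ Set.Ioo (0 : ℝ) 1)
    (h : (s : UnitAddCircle) = t) : s = t := by
  rwa [AddCircle.coe_eq_coe_iff_of_mem_Ico (a := 0) (by simpa using ⟨hs.1.le, hs.2⟩)
    (by simpa using ⟨ht.1.le, ht.2⟩)] at h

/-- A component of a link that is not contained in a closed set has a straight piece outside. -/
theorem Link.exists_germ (L : Link l) (i : Fin l) {B : Set Space} (hB : IsClosed B)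
    (h : ¬ Set.range (L.toFun i) ⊆ B) : ∃ (t : ℝ) (d : Space), d ≠ 0 ∧
      L.toFun i (t : UnitAddCircle) ∉ B ∧ ∀ᶠ s in 𝓝 (0 : ℝ),
        L.toFun i ((t + s : ℝ) : UnitAddCircle) = L.toFun i (t : UnitAddCircle) + s • d := by
  have hc := L.continuous_path i
  set f : ℝ → Space := fun t => L.toFun i (t : UnitAddCircle) with hf
  have hW : IsOpen (f ⁻¹' Bᶜ) := hB.isOpen_compl.preimage hc
  obtain ⟨a, b, hab, hab', hsub⟩ : ∃ a b : ℝ, a < b ∧ Set.Icc a b ⊆ Set.Ioo 0 1 ∧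
      Set.Icc a b ⊆ f ⁻¹' Bᶜ := by
    rw [Set.not_subset] at h
    obtain ⟨_, ⟨x, rfl⟩, hx⟩ := h
    obtain ⟨t, rfl⟩ := QuotientAddGroup.mk_surjective x
    have ht : Int.fract t ∈ f ⁻¹' Bᶜ := by
      change L.toFun i _ ∉ B
      rw [coe_fract_circle]
      exact hx
    have h1 : Int.fract t ∈ closure (Set.Ioo (0 : ℝ) 1) := by
      rw [closure_Ioo (by norm_num)]
      exact ⟨Int.fract_nonneg t, (Int.fract_lt_one t).le⟩
    obtain ⟨u, hu⟩ := mem_closure_iff.1 h1 _ hW ht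
    obtain ⟨r, hr, hru⟩ := Metric.nhds_basis_closedBall.mem_iff.1 ((hW.inter isOpen_Ioo).mem_nhds hu)
    rw [Real.closedBall_eq_Icc] at hru
    exact ⟨u - r, u + r, by linarith, hru.trans Set.inter_subset_right,
      hru.trans Set.inter_subset_left⟩
  obtain ⟨-, 𝒜, hA, hA'⟩ := L.isPL i
  have hcl : ∀ A : ℝ →ᵃ[ℝ] Space, IsClosed ({t | f t = A t} ∩ Set.Icc a b) := fun A =>
    (isClosed_eq hc A.continuous_of_finiteDimensional).inter isClosed_Icc
  -- The interval is covered by finitely many closed sets on which the path agrees with an affine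
  -- map, so by Baire one of them has interior points.
  obtain ⟨A, t, ht⟩ : ∃ A : ℝ →ᵃ[ℝ] Space, (interior ({t | f t = A t} ∩ Set.Icc a b)).Nonempty := by
    by_contra! hn
    have hd : Dense (⋂ A ∈ 𝒜, ({t | f t = A t} ∩ Set.Icc a b)ᶜ) :=
      dense_biInter_of_isOpen (fun A _ => (hcl A).isOpen_compl) hA.countable
        fun A _ => interior_eq_empty_iff_dense_compl.1 (hn A)
    obtain ⟨t, ht, ht'⟩ := hd.inter_open_nonempty _ isOpen_Ioo (Set.nonempty_Ioo.2 hab)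
    obtain ⟨A, hAA, e⟩ := hA' t (Set.Ioo_subset_Icc_self (hab' (Set.Ioo_subset_Icc_self ht)))
    rw [Set.mem_iInter₂] at ht'
    exact ht' A hAA ⟨e, Set.Ioo_subset_Icc_self ht⟩
  have hev : ∀ᶠ s in 𝓝 (0 : ℝ), t + s ∈ interior ({t | f t = A t} ∩ Set.Icc a b) := by
    have : Tendsto (fun s : ℝ => t + s) (𝓝 0) (𝓝 t) := by
      have : Continuous fun s : ℝ => t + s := by fun_prop
      simpa using this.tendsto 0
    exact this.eventually (isOpen_interior.mem_nhds ht)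
  have hlin : ∀ s, A (t + s) = A t + s • A.linear 1 := fun s => by
    have : t + s = s +ᵥ t := by rw [vadd_eq_add, add_comm]
    rw [this, A.map_vadd, vadd_eq_add, add_comm, ← map_smul, smul_eq_mul, mul_one]
  have hgerm : ∀ᶠ s in 𝓝 (0 : ℝ), f (t + s) = f t + s • A.linear 1 := by
    filter_upwards [hev] with s hs
    rw [(interior_subset hs).1, (interior_subset ht).1, hlin]
  -- If the direction were zero, the path would be constant near `t`, against injectivity.
  refine ⟨t, A.linear 1, fun h0 => ?_, hsub (interior_subset ht).2, hgerm⟩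
  obtain ⟨s, hs, hs'⟩ := ((hev.and hgerm).filter_mono nhdsWithin_le_nhds |>.and
    (self_mem_nhdsWithin : {x : ℝ | x ≠ 0} ∈ 𝓝[≠] 0)).exists
  rw [h0, smul_zero, add_zero] at hs
  have := coe_injOn_Ioo (hab' (interior_subset hs.1).2) (hab' (interior_subset ht).2)
    (L.injective_component i hs.2)
  exact hs' (show s = 0 by linarith)

/-- Straight pieces of the components of a link can be moved to prescribed points and to a
prescribed direction in the complement of a compact set, if this is connected. -/
theorem Link.exists_move_germs (L : Link l) {B : Set Space} (hB : IsClosed B)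
    (hc : IsPreconnected Bᶜ) (hL : ∀ i, ¬ Set.range (L.toFun i) ⊆ B) {P : Fin l → Space}
    (hP : Function.Injective P) (hPB : ∀ i, P i ∉ B) {w : Space} (hw : w ≠ 0) :
    ∃ e, IsotopicToId Bᶜ e ∧ ∀ i, ∃ t : ℝ, ∀ᶠ s in 𝓝 (0 : ℝ),
      e (L.toFun i ((t + s : ℝ) : UnitAddCircle)) = P i + s • w := by
  suffices h : ∀ S : Finset (Fin l), ∃ e, IsotopicToId Bᶜ e ∧ ∀ i ∈ S, ∃ t : ℝ, ∀ᶠ s in 𝓝 (0 : ℝ),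
      e (L.toFun i ((t + s : ℝ) : UnitAddCircle)) = P i + s • w by
    obtain ⟨e, he, h⟩ := h Finset.univ
    exact ⟨e, he, fun i => h i (Finset.mem_univ i)⟩
  intro S
  induction S using Finset.induction_on with
  | empty => exact ⟨_, .refl _, by simp⟩
  | insert j S hj ih =>
    obtain ⟨e, he, h⟩ := ih
    -- The moved component is still not contained in `B`, since `e` fixes `B` pointwise.
    obtain ⟨t, d, hd, htB, hg⟩ := (L.map e he.isPLOn).exists_germ j hB (by
      intro hsub
      refine hL j ?_
      rintro _ ⟨x, rfl⟩
      by_contra hx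
      have h1 : e (L.toFun j x) ∈ B := hsub ⟨x, rfl⟩
      have h2 := he.symm.fixed (x := e (L.toFun j x)) (by simpa using h1)
      rw [Homeomorph.symm_apply_apply] at h2
      rw [h2] at hx
      exact hx h1)
    -- The next move avoids the points that have already been reached. Its support is compact, so it
    -- also leaves a neighbourhood of each of them fixed, and with it the germ there.
    have hU : IsOpen (Bᶜ \ P '' S) := hB.isOpen_compl.sdiff (S.finite_toSet.image P).isClosed
    have hUc : IsPreconnected (Bᶜ \ P '' S) := isPreconnected_diff_finite one_lt_rank_space
      hB.isOpen_compl hc (S.finite_toSet.image P)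
    obtain ⟨Q, hQU, hQ, f, hf, hf'⟩ := germMovable hU hUc (p := e (L.toFun j (t : UnitAddCircle)))
      (q := P j) ⟨htB, by
        rintro ⟨i, hi, e'⟩
        obtain ⟨t', ht'⟩ := h i hi
        have h1 := ht'.self_of_nhds
        rw [zero_smul, add_zero, add_zero, e'] at h1
        have h2 : i = j := congrArg Prod.fst (L.injective (a₁ := (i, _)) (a₂ := (j, _)) (e.injective h1))
        exact hj (h2 ▸ hi)⟩ ⟨hPB j, by
        rintro ⟨i, hi, e'⟩
        exact hj (hP e' ▸ hi)⟩ hd hw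
    refine ⟨e.trans f, he.trans (hf.mono (hQU.trans Set.sdiff_subset)), fun i hi => ?_⟩
    rcases Finset.mem_insert.1 hi with rfl | hi
    · refine ⟨t, ?_⟩
      filter_upwards [hg, hf'] with s hs hs'
      change e _ = e _ + _ at hs
      rw [Homeomorph.trans_apply, hs, hs']
    · obtain ⟨t', ht'⟩ := h i hi
      refine ⟨t', ?_⟩
      have h1 : Qᶜ ∈ 𝓝 (P i) := hQ.isClosed.isOpen_compl.mem_nhds fun h' =>
        (hQU h').2 ⟨i, hi, rfl⟩
      have h2 : Tendsto (fun s : ℝ => P i + s • w) (𝓝 0) (𝓝 (P i)) := by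
        have : Continuous fun s : ℝ => P i + s • w := by fun_prop
        simpa using this.tendsto 0
      filter_upwards [ht', h2.eventually h1] with s hs hs'
      rw [Homeomorph.trans_apply, hs, hf.fixed hs']

/-! ### Rays in general position -/

/-- Pushing space in a coordinate direction. -/
theorem SlopeGE.exists_push {k : Fin 3} {c : ℝ} {f : Space → ℝ}
    (hf : SlopeGE (Pi.single k 1) c f) (hc : -1 < c) :
    ∃ e, IsotopicToId Set.univ e ∧ ∀ x, e x = x + f x • Pi.single k (1 : ℝ) :=
  SlopeGE.exists_isotopicToId (κ := -c) (by rwa [neg_neg]) (by linarith)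
    (fun x hx => absurd (Set.mem_univ x) hx)

theorem exists_ne_zero_orthogonal (a b : Space) :
    ∃ n : Space, n ≠ 0 ∧ ∑ k, n k * a k = 0 ∧ ∑ k, n k * b k = 0 := by
  let f : Space →ₗ[ℝ] (Fin 2 → ℝ) :=
    LinearMap.pi ![∑ k, a k • LinearMap.proj (R := ℝ) (φ := fun _ : Fin 3 => ℝ) k,
      ∑ k, b k • LinearMap.proj (R := ℝ) (φ := fun _ : Fin 3 => ℝ) k]
  have h : LinearMap.ker f ≠ ⊥ := LinearMap.ker_ne_bot_of_finrank_lt (by simp)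
  obtain ⟨n, hn, hn0⟩ := (Submodule.ne_bot_iff _).1 h
  have h0 := congrFun (LinearMap.mem_ker.1 hn) 0
  have h1 := congrFun (LinearMap.mem_ker.1 hn) 1
  refine ⟨n, hn0, ?_, ?_⟩
  · simpa [f, mul_comm] using h0
  · simpa [f, mul_comm] using h1

theorem finite_moment_roots {n : Space} (hn : n ≠ 0) :
    {τ : ℝ | n 0 + n 1 * τ + n 2 * τ ^ 2 = 0}.Finite := by
  open Polynomial in
  set p : ℝ[X] := C (n 0) + C (n 1) * X + C (n 2) * X ^ 2 with hp
  have hp0 : p ≠ 0 := by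
    intro h
    refine hn ?_
    have h0 := congrArg (fun q : Polynomial ℝ => q.coeff 0) h
    have h1 := congrArg (fun q : Polynomial ℝ => q.coeff 1) h
    have h2 := congrArg (fun q : Polynomial ℝ => q.coeff 2) h
    simp [hp, Polynomial.coeff_X, Polynomial.coeff_C] at h0 h1 h2
    ext k
    fin_cases k <;> assumption
  refine (Polynomial.finite_setOfPred_isRoot hp0).subset fun τ hτ => ?_
  have hτ' : n 0 + n 1 * τ + n 2 * τ ^ 2 = 0 := hτ
  simp [hp, Polynomial.IsRoot, hτ']

/-- From finitely many points, there is a common direction, close to the first axis, in which no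
other point of a link is seen. -/
theorem Link.exists_generic_direction (L : Link l) (P : Fin l → Space) :
    ∃ τ : ℝ, ∀ i j θ (r : ℝ), L.toFun j θ = P i + r • ![1, τ, τ ^ 2] → r = 0 := by
  choose 𝒜 hA hA' using fun j => (L.isPL j).2
  -- The point `P i` and an affine piece of the link lie in a plane through `P i` with normal `n i
  -- A`. A ray in a direction not parallel to this plane leaves it at once. The curve `(1, τ, τ ^
  -- 2)` is parallel to each such plane for finitely many `τ` only.
  choose n hn hn1 hn2 using fun (i : Fin l) (A : ℝ →ᵃ[ℝ] Space) =>
    exists_ne_zero_orthogonal (A 0 - P i) (A.linear 1)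
  have hfin : (⋃ i : Fin l, ⋃ j : Fin l, ⋃ A ∈ 𝒜 j,
      {τ : ℝ | n i A 0 + n i A 1 * τ + n i A 2 * τ ^ 2 = 0}).Finite :=
    Set.finite_iUnion fun i => Set.finite_iUnion fun j =>
      (hA j).biUnion fun A _ => finite_moment_roots (hn i A)
  obtain ⟨τ, hτ⟩ := hfin.infinite_compl.nonempty
  refine ⟨τ, fun i j θ r h => ?_⟩
  obtain ⟨t, rfl⟩ := QuotientAddGroup.mk_surjective θ
  obtain ⟨A, hAj, e⟩ := hA' j (Int.fract t) ⟨Int.fract_nonneg t, (Int.fract_lt_one t).le⟩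
  have e' : A (Int.fract t) = P i + r • ![1, τ, τ ^ 2] := by
    rw [← h, ← e]
    dsimp only
    rw [coe_fract_circle]
  have hlin : A (Int.fract t) = A 0 + Int.fract t • A.linear 1 := by
    have : Int.fract t = Int.fract t +ᵥ (0 : ℝ) := by simp
    conv_lhs => rw [this]
    rw [A.map_vadd, vadd_eq_add, add_comm, ← map_smul, smul_eq_mul, mul_one]
  simp only [Set.mem_compl_iff, Set.mem_iUnion, not_exists] at hτ
  have hne : n i A 0 + n i A 1 * τ + n i A 2 * τ ^ 2 ≠ 0 := hτ i j A hAj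
  have h1 := hn1 i A
  have h2 := hn2 i A
  have k0 := congrFun (hlin.symm.trans e') 0
  have k1 := congrFun (hlin.symm.trans e') 1
  have k2 := congrFun (hlin.symm.trans e') 2
  simp [Fin.sum_univ_three] at h1 h2 k0 k1 k2
  have : r * (n i A 0 + n i A 1 * τ + n i A 2 * τ ^ 2) = 0 := by
    linear_combination h1 + Int.fract t * h2 - n i A 0 * k0 - n i A 1 * k1 - n i A 2 * k2
  exact (mul_eq_zero.1 this).resolve_right hne

/-- The shear that fixes the plane `x = X` and makes the direction `(1, τ, τ²)` horizontal. -/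
theorem exists_shear (X τ : ℝ) : ∃ e, IsotopicToId Set.univ e ∧
    ∀ p : Space, e p = ![p 0, p 1 - τ * (p 0 - X), p 2 - τ ^ 2 * (p 0 - X)] := by
  obtain ⟨e, he, he'⟩ := SlopeGE.exists_push (k := 1)
    (SlopeGE.coord (c := 0) 0 (-τ) (τ * X) (by simp)) (by norm_num)
  obtain ⟨f, hf, hf'⟩ := SlopeGE.exists_push (k := 2)
    (SlopeGE.coord (c := 0) 0 (-τ ^ 2) (τ ^ 2 * X) (by simp)) (by norm_num)
  refine ⟨e.trans f, he.trans hf, fun p => ?_⟩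
  rw [Homeomorph.trans_apply, hf', he']
  ext k
  fin_cases k <;> simp <;> ring

/-- Around rays in the direction of the first axis that meet a link only in one point each, there
are tubes that meet the link only in short straight pieces. -/
theorem Link.exists_tubes (L : Link l) {B : Set Space} (hB : IsCompact B) {X : ℝ} {x : Fin l → ℝ}
    (hBX : ∀ p ∈ B, p 0 < X) (t : Fin l → ℝ)
    (hg : ∀ i, ∀ᶠ s in 𝓝 (0 : ℝ), L.toFun i ((t i + s : ℝ) : UnitAddCircle) = ![X, x i, -s])
    (hray : ∀ i j θ r, L.toFun j θ = ![X + r, x i, 0] → r = 0) :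
    ∃ ρ : ℝ, 0 < ρ ∧ ρ < 1 / 2 ∧
      (∀ i s, |s| ≤ ρ → L.toFun i ((t i + s : ℝ) : UnitAddCircle) = ![X, x i, -s]) ∧
      ∀ i, ∀ p ∈ (⋃ j, Set.range (L.toFun j)) ∪ B, X - ρ ≤ p 0 → |p 1 - x i| ≤ ρ → |p 2| ≤ ρ →
        ∃ s, |s| ≤ ρ ∧ p = L.toFun i ((t i + s : ℝ) : UnitAddCircle) := by
  suffices h : ∀ i, ∀ᶠ ρ in 𝓝[>] (0 : ℝ),
      (∀ s, |s| ≤ ρ → L.toFun i ((t i + s : ℝ) : UnitAddCircle) = ![X, x i, -s]) ∧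
      ∀ p ∈ (⋃ j, Set.range (L.toFun j)) ∪ B, X - ρ ≤ p 0 → |p 1 - x i| ≤ ρ → |p 2| ≤ ρ →
        ∃ s, |s| ≤ ρ ∧ p = L.toFun i ((t i + s : ℝ) : UnitAddCircle) by
    have h1 : ∀ᶠ ρ in 𝓝[>] (0 : ℝ), 0 < ρ := self_mem_nhdsWithin
    have h2 : ∀ᶠ ρ in 𝓝[>] (0 : ℝ), ρ < 1 / 2 :=
      nhdsWithin_le_nhds (Iio_mem_nhds (by norm_num))
    obtain ⟨ρ, ⟨h, h1⟩, h2⟩ := ((eventually_all.2 h).and h1 |>.and h2).exists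
    exact ⟨ρ, h1, h2, fun i => (h i).1, fun i => (h i).2⟩
  intro i
  obtain ⟨ρ₁, hρ₁, h₁⟩ := Metric.eventually_nhds_iff.1 (hg i)
  have hgi : ∀ s, |s| < ρ₁ → L.toFun i ((t i + s : ℝ) : UnitAddCircle) = ![X, x i, -s] :=
    fun s hs => h₁ (by simpa using hs)
  have hpt : L.toFun i (t i : UnitAddCircle) = ![X, x i, 0] := by
    have := hgi 0 (by simpa)
    simpa using this
  set ρ₂ := min ρ₁ (1 / 2) with hρ₂
  have hρ₂0 : 0 < ρ₂ := lt_min hρ₁ (by norm_num)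
  -- This compact set contains all that has to stay away from the tube: the other components, the
  -- own component away from the piece at `t i`, and `B`. The bound `ρ₂ ≤ 1 / 2` makes the excluded
  -- piece and this interval together one full period.
  set K : Set Space := ((⋃ j ∈ {j | j ≠ i}, Set.range (L.toFun j)) ∪
    (fun s : ℝ => L.toFun i (s : UnitAddCircle)) '' Set.Icc (t i + ρ₂) (t i + 1 - ρ₂)) ∪ B with hK
  have hKc : IsCompact K := by
    refine IsCompact.union (IsCompact.union ?_ ?_) hB
    · exact (Set.toFinite _).isCompact_biUnion fun j _ => isCompact_range (L.continuous j)
    · exact isCompact_Icc.image (L.continuous_path i)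
  -- Nonpositive exactly on the ray, and at most `ρ` exactly on the tube of radius `ρ`. By
  -- compactness it has a positive lower bound on `K`.
  let φ : Space → ℝ := fun p => max (max (X - p 0) |p 1 - x i|) |p 2|
  have hφ : Continuous φ := by fun_prop
  have hpos : ∀ p ∈ K, 0 < φ p := by
    intro p hp
    by_contra! hle
    have e1 : p 1 = x i := by
      have : |p 1 - x i| ≤ 0 := ((le_max_right _ _).trans (le_max_left _ _)).trans hle
      linarith [abs_eq_zero.1 (le_antisymm this (abs_nonneg _))]
    have e2 : p 2 = 0 := abs_eq_zero.1 (le_antisymm ((le_max_right _ _).trans hle) (abs_nonneg _))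
    have e0 : X - p 0 ≤ 0 := ((le_max_left _ _).trans (le_max_left _ _)).trans hle
    have e : p = ![X + (p 0 - X), x i, 0] := by
      ext k
      fin_cases k <;> simp [e1, e2]
    have huse : ∀ j θ, L.toFun j θ = p → j = i ∧ θ = (t i : UnitAddCircle) := fun j θ hθ => by
      have hr := hray i j θ (p 0 - X) (hθ.trans e)
      have : L.toFun j θ = L.toFun i (t i : UnitAddCircle) := by
        rw [hpt, hθ, e, hr, add_zero]
      have := L.injective (a₁ := (j, θ)) (a₂ := (i, _)) this
      exact ⟨congrArg Prod.fst this, congrArg Prod.snd this⟩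
    rcases hp with (hp | ⟨s, hs, hsp⟩) | hp
    · simp only [Set.mem_iUnion] at hp
      obtain ⟨j, hj, θ, hθ⟩ := hp
      exact hj (huse j θ hθ).1
    · have h3 := (huse i s hsp).2
      rw [AddCircle.coe_eq_coe_iff_of_mem_Ico (a := t i) ⟨by linarith [hs.1], by linarith [hs.2]⟩
        ⟨le_rfl, by linarith⟩] at h3
      linarith [hs.1]
    · linarith [hBX p hp]
  obtain ⟨ρ₃, hρ₃, h₃⟩ : ∃ ρ₃ > 0, ∀ p ∈ K, ρ₃ ≤ φ p := by
    rcases K.eq_empty_or_nonempty with hE | hne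
    · exact ⟨1, one_pos, by simp [hE]⟩
    · obtain ⟨p, hp, hmin⟩ := hKc.exists_isMinOn hne hφ.continuousOn
      exact ⟨φ p, hpos p hp, fun q hq => hmin hq⟩
  have hlt : ∀ᶠ ρ in 𝓝[>] (0 : ℝ), ρ < min ρ₂ ρ₃ :=
    nhdsWithin_le_nhds (Iio_mem_nhds (lt_min hρ₂0 hρ₃))
  filter_upwards [hlt] with ρ hρ
  have hρ2 := hρ.trans_le (min_le_left _ _)
  have hρ3 := hρ.trans_le (min_le_right _ _)
  have hρ1 := hρ2.trans_le (min_le_left _ _)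
  refine ⟨fun s hs => hgi s (hs.trans_lt hρ1), fun p hp h0 h1 h2 => ?_⟩
  have hpK : p ∉ K := fun h => by
    have : φ p ≤ ρ := max_le (max_le (by linarith) h1) h2
    linarith [h₃ p h]
  have key : ∃ s, |s| < ρ₁ ∧ p = L.toFun i ((t i + s : ℝ) : UnitAddCircle) := by
    rcases hp with hp | hp
    · simp only [Set.mem_iUnion] at hp
      obtain ⟨j, θ, rfl⟩ := hp
      rcases eq_or_ne j i with rfl | hj
      · obtain ⟨s, hs, rfl⟩ : ∃ s ∈ Set.Ico (t j - 1 / 2) (t j - 1 / 2 + 1),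
            (s : UnitAddCircle) = θ := by
          have := (AddCircle.coe_image_Ico_eq (1 : ℝ) (t j - 1 / 2)) ▸ Set.mem_univ θ
          exact this
        refine ⟨s - t j, ?_, by rw [add_sub_cancel]⟩
        by_contra! hge
        have hge' : ρ₂ ≤ |s - t j| := (min_le_left _ _).trans hge
        refine hpK (Or.inl (Or.inr ?_))
        rcases le_total 0 (s - t j) with h' | h'
        · rw [abs_of_nonneg h'] at hge'
          have : ρ₂ ≤ 1 / 2 := min_le_right _ _
          exact ⟨s, ⟨by linarith, by linarith [hs.2]⟩, rfl⟩
        · rw [abs_of_nonpos h'] at hge'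
          have : ρ₂ ≤ 1 / 2 := min_le_right _ _
          refine ⟨s + 1, ⟨by linarith [hs.1], by linarith⟩, ?_⟩
          dsimp only
          rw [AddCircle.coe_add, AddCircle.coe_period, add_zero]
      · refine absurd (Or.inl (Or.inl ?_)) hpK
        exact Set.mem_biUnion (show j ∈ {j | j ≠ i} from hj) ⟨θ, rfl⟩
    · exact absurd (Or.inr hp) hpK
  obtain ⟨s, hs, e⟩ := key
  refine ⟨s, ?_, e⟩
  have : p 2 = -s := by rw [e, hgi s hs]; rfl
  rwa [this, abs_neg] at h2

/-! ### Pulling out the closing arcs -/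

/-- Piecewise linear functions that are constant in the direction `w`. -/
def FlatAlong (w : Space) (f : Space → ℝ) : Prop :=
  SlopeGE w 0 f ∧ SlopeGE w 0 fun p => -f p

namespace FlatAlong

variable {w : Space} {f g : Space → ℝ}

theorem neg (hf : FlatAlong w f) : FlatAlong w fun p => -f p :=
  ⟨hf.2, by simpa using hf.1⟩

theorem coord {k : Fin 3} (a b : ℝ) (h : w k = 0) : FlatAlong w fun p => a * p k + b := by
  refine ⟨.coord k a b (by simp [h]), ?_⟩
  have := SlopeGE.coord (w := w) (c := 0) k (-a) (-b) (by simp [h])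
  convert this using 2
  ring

theorem const (b : ℝ) : FlatAlong w fun _ => b :=
  ⟨.const b le_rfl, .const (-b) le_rfl⟩

theorem sup (hf : FlatAlong w f) (hg : FlatAlong w g) : FlatAlong w fun p => max (f p) (g p) :=
  ⟨hf.1.sup hg.1, by simpa only [max_neg_neg, min_neg_neg, ← max_neg_neg] using hf.2.inf hg.2⟩

theorem inf (hf : FlatAlong w f) (hg : FlatAlong w g) : FlatAlong w fun p => min (f p) (g p) :=
  ⟨hf.1.inf hg.1, by simpa only [max_neg_neg] using hf.2.sup hg.2⟩

theorem add (hf : FlatAlong w f) (hg : FlatAlong w g) : FlatAlong w fun p => f p + g p := by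
  refine ⟨by simpa using hf.1.add hg.1, ?_⟩
  have := hf.2.add hg.2
  simpa [add_comm] using this

theorem smul (hf : FlatAlong w f) {a : ℝ} (ha : 0 ≤ a) : FlatAlong w fun p => a * f p :=
  ⟨by simpa using hf.1.smul ha, by simpa using hf.2.smul ha⟩

theorem abs (hf : FlatAlong w f) : FlatAlong w fun p => |f p| :=
  hf.sup hf.neg

end FlatAlong

/-- The length by which a point is pulled out in the first coordinate direction. -/
noncomputable def fingerFun (l : ℕ) (c μ ε : ℝ) (p : Space) : ℝ :=
  -- On the axis of the `i`-th tube at `p 0 = c`, a point at distance `z` from the middle height is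
  -- pulled by `12 * (1 - z / ε)`, but not beyond the abscissa `4 - basePoint i` of the vertical
  -- part of the closing arc. The other two terms cut off sideways and to the left. As the pull is
  -- less than `6`, the slope `6 / ε` suffices to stop it at distance `ε`, and with `12` the sides
  -- of the finger keep more than half of their distance `ε` from the middle.
  ∑ i : Fin l, max 0 (min (4 - basePoint i - c) (12 - 12 / ε * |p 2 - 1 / 2|) -
    6 / ε * |p 1 - μ * basePoint i| + min 0 (6 / ε * (p 0 - c)))

/-- The final distance of the two sides of a finger from its middle, in excess of the initial
distance. -/
noncomputable def spreadBound (δ c μ ε : ℝ) (p : Space) : ℝ :=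
  -- At abscissa `p 0` the sides of a finger are at distance `ε * (1 - (p 0 - c) / 12)` from the
  -- middle, and those of the closing arc at `x` are at `1 / 2 + (p 0 - x) / 2`. On a finger `p 1 /
  -- μ` is this `x`. Left of `x` the slope `1 / δ` replaces `1 / 2`, and `p 0 + 1 - 2 * δ` bounds
  -- the quantity for every `p 1`; together they make the bound vanish on the rest of the link.
  max 0 (1 / 2 - ε * (1 - (p 0 - c) / 12) +
    min (min (p 0 + 1 - 2 * δ) (p 0 - p 1 / μ) / δ) (min (p 0 + 1 - 2 * δ) (p 0 - p 1 / μ) / 2))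

/-- The length by which a point is pushed in the third coordinate direction. -/
noncomputable def spreadFun (δ c μ ε : ℝ) (p : Space) : ℝ :=
  -- The factor `8 / ε` is so large that both sides of a finger are pushed by the full bound, one
  -- upwards and one downwards.
  max (-spreadBound δ c μ ε p) (min (spreadBound δ c μ ε p) (8 / ε * (p 2 - 1 / 2)))

/-- The length by which a point is pushed in the second coordinate direction, so as to put the
closing arcs into one plane. -/
noncomputable def nestFun (μ : ℝ) (p : Space) : ℝ :=
  -- The minimum equals `x` at every point of the closing arc for `x`, its three terms belonging to
  -- the three edges. So the finger in the plane `p 1 = μ * x` is moved to the plane `p 1 = 0`.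
  -(μ * min (4 - p 0) (min (p 0 - 2 * (p 2 - 1)) (p 0 + 2 * p 2)))

theorem slopeGE_fingerFun (l : ℕ) (c μ ε : ℝ) (hε : 0 < ε) :
    SlopeGE (Pi.single 0 1) 0 (fingerFun l c μ ε) := by
  refine SlopeGE.sum _ fun i _ => .sup (.const 0 le_rfl) ?_
  have h1 : FlatAlong (Pi.single 0 1) fun p : Space => p 2 - 1 / 2 := by
    simpa [sub_eq_add_neg] using FlatAlong.coord (w := Pi.single 0 1) (k := 2) 1 (-(1 / 2)) (by simp)
  have h2 : FlatAlong (Pi.single 0 1) fun p : Space => p 1 - μ * basePoint i := by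
    simpa [sub_eq_add_neg] using
      FlatAlong.coord (w := Pi.single 0 1) (k := 1) 1 (-(μ * basePoint i)) (by simp)
  have h3 : FlatAlong (Pi.single 0 1) fun p : Space =>
      min (4 - basePoint i - c) (12 - 12 / ε * |p 2 - 1 / 2|) - 6 / ε * |p 1 - μ * basePoint i| := by
    simp only [sub_eq_add_neg _ (_ * _)]
    exact ((FlatAlong.const _).inf ((FlatAlong.const _).add
      (h1.abs.smul (by positivity)).neg)).add (h2.abs.smul (by positivity)).neg
  have h4 : SlopeGE (Pi.single 0 1) 0 fun p : Space => min 0 (6 / ε * (p 0 - c)) := by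
    have := SlopeGE.coord (w := Pi.single 0 1) (c := 0) 0 (6 / ε) (-(6 / ε * c))
      (by simp; positivity)
    refine .inf (.const 0 le_rfl) ?_
    convert this using 2
    ring
  simpa using h3.1.add h4

theorem flatAlong_spreadBound (δ c μ ε : ℝ) (hδ : 0 < δ) :
    FlatAlong (Pi.single 2 1) (spreadBound δ c μ ε) := by
  have h1 : FlatAlong (Pi.single 2 1) fun p : Space => 1 / 2 - ε * (1 - (p 0 - c) / 12) := by
    convert FlatAlong.coord (w := Pi.single 2 1) (k := 0) (ε / 12)
      (1 / 2 - ε * (1 + c / 12)) (by simp) using 2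
    ring
  have h2 : FlatAlong (Pi.single 2 1) fun p : Space => min (p 0 + 1 - 2 * δ) (p 0 - p 1 / μ) := by
    have e1 := FlatAlong.coord (w := Pi.single 2 1) (k := 0) 1 (1 - 2 * δ) (by simp)
    have e2 := (FlatAlong.coord (w := Pi.single 2 1) (k := 0) 1 0 (by simp)).add
      (FlatAlong.coord (w := Pi.single 2 1) (k := 1) (-μ⁻¹) 0 (by simp))
    convert e1.inf e2 using 3 <;> ring
  have h3 : ∀ {a : ℝ}, 0 < a → FlatAlong (Pi.single 2 1) fun p : Space =>
      min (p 0 + 1 - 2 * δ) (p 0 - p 1 / μ) / a := fun {a} ha => by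
    simpa only [div_eq_inv_mul] using h2.smul (a := a⁻¹) (by positivity)
  exact (FlatAlong.const 0).sup (h1.add ((h3 hδ).inf (h3 two_pos)))

theorem slopeGE_spreadFun (δ c μ ε : ℝ) (hδ : 0 < δ) (hε : 0 < ε) :
    SlopeGE (Pi.single 2 1) 0 (spreadFun δ c μ ε) := by
  have h := flatAlong_spreadBound δ c μ ε hδ
  have h4 : SlopeGE (Pi.single 2 1) 0 fun p : Space => 8 / ε * (p 2 - 1 / 2) := by
    have := SlopeGE.coord (w := Pi.single 2 1) (c := 0) 2 (8 / ε) (-(8 / ε * (1 / 2)))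
      (by simp; positivity)
    convert this using 2
    ring
  exact h.2.sup (h.1.inf h4)

theorem slopeGE_nestFun (μ : ℝ) (hμ : 0 < μ) : SlopeGE (Pi.single 1 1) 0 (nestFun μ) := by
  have e1 := FlatAlong.coord (w := Pi.single 1 1) (k := 0) (-1) 4 (by simp)
  have e2 := (FlatAlong.coord (w := Pi.single 1 1) (k := 0) 1 2 (by simp)).add
    (FlatAlong.coord (w := Pi.single 1 1) (k := 2) (-2) 0 (by simp))
  have e3 := (FlatAlong.coord (w := Pi.single 1 1) (k := 0) 1 0 (by simp)).add
    (FlatAlong.coord (w := Pi.single 1 1) (k := 2) 2 0 (by simp))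
  convert ((e1.inf (e2.inf e3)).smul hμ.le).2 using 2
  unfold nestFun
  congr 3
  · ring
  · congr 1 <;> ring

/-- The three pushes, one after the other. -/
theorem exists_finger_isotopy (l : ℕ) {δ c μ ε : ℝ} (hδ : 0 < δ) (hμ : 0 < μ) (hε : 0 < ε) :
    ∃ e, IsotopicToId Set.univ e ∧ ∀ x y z x' z' y' : ℝ,
      x' = x + fingerFun l c μ ε ![x, y, z] → z' = z + spreadFun δ c μ ε ![x', y, z] →
      y' = y + nestFun μ ![x', y, z'] → e ![x, y, z] = ![x', y', z'] := by
  obtain ⟨e, he, he'⟩ := (slopeGE_fingerFun l c μ ε hε).exists_push (by norm_num)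
  obtain ⟨f, hf, hf'⟩ := (slopeGE_spreadFun δ c μ ε hδ hε).exists_push (by norm_num)
  obtain ⟨g, hg, hg'⟩ := (slopeGE_nestFun μ hμ).exists_push (by norm_num)
  refine ⟨(e.trans f).trans g, (he.trans hf).trans hg, ?_⟩
  intro x y z x' z' y' hx hz hy
  have e1 : e ![x, y, z] = ![x', y, z] := by
    rw [he', hx]
    ext k
    fin_cases k <;> simp
  have e2 : f ![x', y, z] = ![x', y, z'] := by
    rw [hf', hz]
    ext k
    fin_cases k <;> simp
  have e3 : g ![x', y, z'] = ![x', y', z'] := by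
    rw [hg', hy]
    ext k
    fin_cases k <;> simp
  rw [Homeomorph.trans_apply, Homeomorph.trans_apply, e1, e2, e3]

/-! ### The three edges of a closing arc -/

theorem top_mem_closingArc {x u : ℝ} (hx : x < 1) (h0 : 0 ≤ u) (h1 : u ≤ 4 - 2 * x) :
    ![x + u, 0, 1 + u / 2] ∈ closingArc x '' Set.Icc 0 1 := by
  have hp : 0 < 4 - 2 * x := by linarith
  have ha : u / (3 * (4 - 2 * x)) ≤ 1 / 3 := by rw [div_le_iff₀ (by linarith)]; linarith
  refine ⟨u / (3 * (4 - 2 * x)), ⟨by positivity, by linarith⟩, ?_⟩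
  rw [closingArc, if_pos ha]
  have e : 3 * (u / (3 * (4 - 2 * x))) * (4 - 2 * x) = u := by field_simp
  ext k
  fin_cases k
  · simp [e]
  · simp
  · simp
    linarith

theorem side_mem_closingArc {x z : ℝ} (hx : x < 1) (h0 : x - 2 ≤ z) (h1 : z ≤ 3 - x) :
    ![4 - x, 0, z] ∈ closingArc x '' Set.Icc 0 1 := by
  have hp : 0 < 5 - 2 * x := by linarith
  rcases h1.eq_or_lt with rfl | h1
  · have := top_mem_closingArc (x := x) (u := 4 - 2 * x) hx (by linarith) le_rfl
    convert this using 2 <;> ring_nf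
  have ha : 0 < (3 - x - z) / (5 - 2 * x) := div_pos (by linarith) hp
  have hb : (3 - x - z) / (5 - 2 * x) ≤ 1 := by rw [div_le_one hp]; linarith
  refine ⟨(1 + (3 - x - z) / (5 - 2 * x)) / 3, ⟨by linarith, by linarith⟩, ?_⟩
  rw [closingArc, if_neg (by linarith), if_pos (by linarith)]
  have e : (3 * ((1 + (3 - x - z) / (5 - 2 * x)) / 3) - 1) * (5 - 2 * x) = 3 - x - z := by
    rw [show ∀ q : ℝ, 3 * ((1 + q) / 3) - 1 = q by intro q; ring, div_mul_cancel₀ _ hp.ne']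
  rw [e]
  ext k
  fin_cases k <;> simp

theorem bottom_mem_closingArc {x u : ℝ} (hx : x < 1) (h0 : 0 ≤ u) (h1 : u ≤ 4 - 2 * x) :
    ![x + u, 0, -(u / 2)] ∈ closingArc x '' Set.Icc 0 1 := by
  have hp : 0 < 4 - 2 * x := by linarith
  rcases h1.eq_or_lt with rfl | h1
  · have := side_mem_closingArc (x := x) (z := x - 2) hx le_rfl (by linarith)
    convert this using 2 <;> ring_nf
  have ha : u / (3 * (4 - 2 * x)) < 1 / 3 := by rw [div_lt_iff₀ (by linarith)]; linarith
  have ha0 : 0 ≤ u / (3 * (4 - 2 * x)) := by positivity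
  refine ⟨1 - u / (3 * (4 - 2 * x)), ⟨by linarith, by linarith⟩, ?_⟩
  rw [closingArc, if_neg (by linarith), if_neg (by linarith)]
  have e : 3 * (u / (3 * (4 - 2 * x))) * (4 - 2 * x) = u := by field_simp
  ext k
  fin_cases k
  · simp [e]
  · simp
  · simp
    linarith

/-! ### Estimates for the fingers -/

theorem basePoint_lower {l : ℕ} (i : Fin l) {δ : ℝ} (hδ : δ = 1 / ((l : ℝ) + 1)) :
    -1 + 2 * δ ≤ basePoint i := by
  have : (0 : ℝ) < (l : ℝ) + 1 := by positivity
  have h1 : 2 * δ ≤ 2 * ((i : ℝ) + 1) / ((l : ℝ) + 1) := by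
    rw [hδ, mul_one_div, div_le_div_iff_of_pos_right this]
    have : (0 : ℝ) ≤ (i : ℝ) := by positivity
    linarith
  unfold basePoint
  linarith

/-- A summand is positive only inside its tube, because its leading term is less than `6`. The sum
runs over a subset so that, on the axis of one finger, the contributions of all others can be
discarded. -/
theorem fingerFun_eq_zero {c μ ε : ℝ} {p : Space} (hε : 0 < ε) {δ : ℝ} (hδ0 : 0 < δ)
    (hδ : δ = 1 / ((l : ℝ) + 1)) (hc : c = -1 + δ) (S : Finset (Fin l))
    (h : ∀ i ∈ S, ¬ (c - ε ≤ p 0 ∧ |p 1 - μ * basePoint i| ≤ ε ∧ |p 2 - 1 / 2| ≤ ε)) :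
    ∑ i ∈ S, max 0 (min (4 - basePoint i - c) (12 - 12 / ε * |p 2 - 1 / 2|) -
      6 / ε * |p 1 - μ * basePoint i| + min 0 (6 / ε * (p 0 - c))) = 0 := by
  refine Finset.sum_eq_zero fun i hi => max_eq_left ?_
  by_contra! hpos
  have hb := basePoint_lower i hδ
  have m1 := min_le_left (4 - basePoint i - c) (12 - 12 / ε * |p 2 - 1 / 2|)
  have m2 := min_le_right (4 - basePoint i - c) (12 - 12 / ε * |p 2 - 1 / 2|)
  have m3 := min_le_left 0 (6 / ε * (p 0 - c))
  have m4 := min_le_right 0 (6 / ε * (p 0 - c))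
  have a1 : 0 ≤ 6 / ε * |p 1 - μ * basePoint i| := by positivity
  have a2 : 0 ≤ 12 / ε * |p 2 - 1 / 2| := by positivity
  have k : ∀ {a b : ℝ}, 0 < a → a / ε * b < a → b ≤ ε := fun ha hab => by
    rw [div_mul_eq_mul_div, div_lt_iff₀ hε] at hab
    exact (lt_of_mul_lt_mul_left hab ha.le).le
  refine h i hi ⟨?_, k (by norm_num : (0 : ℝ) < 6) (by linarith),
    k (by norm_num : (0 : ℝ) < 12) (by linarith)⟩
  have := k (b := c - p 0) (by norm_num : (0 : ℝ) < 6) (by linarith)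
  linarith

theorem spreadBound_eq {δ c μ ε x h z : ℝ} (hμ : μ ≠ 0) (hx : -1 + 2 * δ ≤ x) :
    spreadBound δ c μ ε ![c + h, μ * x, z] =
      max 0 (1 / 2 - ε * (1 - h / 12) + min ((c + h - x) / δ) ((c + h - x) / 2)) := by
  have e1 : (![c + h, μ * x, z] : Space) 0 = c + h := rfl
  have e2 : (![c + h, μ * x, z] : Space) 1 = μ * x := rfl
  rw [spreadBound, e1, e2, mul_div_cancel_left₀ _ hμ, min_eq_right (a := c + h + 1 - 2 * δ)
    (by linarith), add_sub_cancel_left]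

/-- The part of a finger that goes into the cylinder. -/
theorem finger_mem_cylinder {δ c μ ε x h ζ z' : ℝ} (hδ0 : 0 < δ) (hδ1 : δ ≤ 1) (hc : c = -1 + δ)
    (hμ : 0 < μ) (hμ' : μ ≤ 1 / 20) (hε : 0 < ε) (hε' : ε ≤ 1 / 4) (hx : -1 + 2 * δ ≤ x)
    (hx1 : x < 1) (hh : 0 ≤ h) (hhx : c + h < x) (hζ : |ζ| = ε * (1 - h / 12))
    (hz : z' = 1 / 2 + ζ + spreadFun δ c μ ε ![c + h, μ * x, 1 / 2 + ζ]) :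
    ![c + h, μ * x + nestFun μ ![c + h, μ * x, z'], z'] ∈ openCylinder := by
  have e2 : (![c + h, μ * x, 1 / 2 + ζ] : Space) 2 = 1 / 2 + ζ := rfl
  rw [spreadFun, spreadBound_eq hμ.ne' hx, e2] at hz
  have hmin : min ((c + h - x) / δ) ((c + h - x) / 2) = (c + h - x) / δ := by
    apply min_eq_left
    rw [div_le_div_iff₀ hδ0 two_pos]
    nlinarith
  have hneg : (c + h - x) / δ < 0 := div_neg_of_neg_of_pos (by linarith) hδ0
  rw [hmin, ← hζ, add_sub_cancel_left] at hz
  set v := (c + h - x) / δ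
  set m := max 0 (1 / 2 - |ζ| + v) with hm
  have hm0 : 0 ≤ m := le_max_left _ _
  have hζ4 : |ζ| ≤ 1 / 4 := by
    rw [hζ]; nlinarith
  -- Left of the base point `v` is negative, so the spread side has not yet reached the distance `1
  -- / 2` of the top and the bottom of the cylinder from the middle.
  have hm1 : |ζ| + m < 1 / 2 := by
    rcases max_choice 0 (1 / 2 - |ζ| + v) with h' | h' <;> rw [hm, h'] <;> linarith
  have hz1 : 1 / 2 - (|ζ| + m) ≤ z' := by
    have := le_max_left (-m) (min m (8 / ε * ζ))
    linarith [neg_abs_le ζ]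
  have hz2 : z' ≤ 1 / 2 + (|ζ| + m) := by
    have : max (-m) (min m (8 / ε * ζ)) ≤ m := max_le (by linarith) (min_le_left _ _)
    linarith [le_abs_self ζ]
  have hz3 : 0 < z' := by linarith
  have hz4 : z' < 1 := by linarith
  -- The minimum is bounded by `5` here, and `μ ≤ 1 / 20`, so the last push is too short to leave
  -- the cylinder.
  have hn : |nestFun μ ![c + h, μ * x, z']| ≤ 1 / 4 := by
    simp only [nestFun, Matrix.cons_val]
    rw [abs_neg, abs_mul, abs_of_pos hμ]
    have : |min (4 - (c + h)) (min (c + h - 2 * (z' - 1)) (c + h + 2 * z'))| ≤ 5 := by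
      rw [abs_le]
      refine ⟨le_min (by linarith) (le_min (by linarith) (by linarith)), (min_le_left _ _).trans ?_⟩
      linarith
    nlinarith [abs_nonneg (min (4 - (c + h)) (min (c + h - 2 * (z' - 1)) (c + h + 2 * z')))]
  rw [abs_le] at hn
  refine ⟨⟨?_, ?_⟩, ⟨?_, ?_⟩, ⟨?_, ?_⟩⟩ <;> simp only [Matrix.cons_val]
  · linarith
  · linarith
  · nlinarith
  · nlinarith
  · linarith
  · linarith

/-- The sides of a finger outside the cylinder. -/
theorem finger_side {δ c μ ε x h ζ z' : ℝ} (hδ0 : 0 < δ) (hδ1 : δ ≤ 1) (hc : c = -1 + δ)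
    (hμ : 0 < μ) (hε : 0 < ε) (hε' : ε ≤ 1 / 4) (hx : -1 + 2 * δ ≤ x)
    (hhx : x ≤ c + h) (hh : c + h ≤ 4 - x) (hζ : |ζ| = ε * (1 - h / 12))
    (hz : z' = 1 / 2 + ζ + spreadFun δ c μ ε ![c + h, μ * x, 1 / 2 + ζ]) :
    (0 < ζ → ![c + h, μ * x + nestFun μ ![c + h, μ * x, z'], z'] =
      ![x + (c + h - x), 0, 1 + (c + h - x) / 2]) ∧
    (ζ ≤ 0 → ![c + h, μ * x + nestFun μ ![c + h, μ * x, z'], z'] =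
      ![x + (c + h - x), 0, -((c + h - x) / 2)]) := by
  have e2 : (![c + h, μ * x, 1 / 2 + ζ] : Space) 2 = 1 / 2 + ζ := rfl
  rw [spreadFun, spreadBound_eq hμ.ne' hx, e2] at hz
  have hmin : min ((c + h - x) / δ) ((c + h - x) / 2) = (c + h - x) / 2 := by
    apply min_eq_right
    rw [div_le_div_iff₀ two_pos hδ0]
    nlinarith
  rw [hmin, ← hζ, add_sub_cancel_left] at hz
  set u := c + h - x with hu
  have hu0 : 0 ≤ u := by linarith
  have hζ4 : |ζ| ≤ 1 / 4 := by
    rw [hζ]; nlinarith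
  have hm : max 0 (1 / 2 - |ζ| + u / 2) = 1 / 2 - |ζ| + u / 2 := max_eq_right (by linarith)
  rw [hm] at hz
  set m := 1 / 2 - |ζ| + u / 2
  -- Here `h < 6`, so the right side is greater than `4`, whereas `m` is less than `7 / 2`.
  have hmb : m ≤ 8 / ε * |ζ| := by
    rw [hζ]
    have : 8 / ε * (ε * (1 - h / 12)) = 8 * (1 - h / 12) := by field_simp
    rw [this]
    have := abs_nonneg ζ
    simp only [m]
    linarith
  have hnest : ∀ z : ℝ, z - 1 ≤ u / 2 → -(u / 2) ≤ z → (z - 1 = u / 2 ∨ z = -(u / 2)) →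
      μ * x + nestFun μ ![c + h, μ * x, z] = 0 := by
    intro z h1 h2 h3
    simp only [nestFun, Matrix.cons_val]
    have : min (4 - (c + h)) (min (c + h - 2 * (z - 1)) (c + h + 2 * z)) = x := by
      rcases h3 with h3 | h3
      · rw [min_eq_left (a := c + h - 2 * (z - 1)) (by linarith), min_eq_right (by linarith)]
        linarith
      · rw [min_eq_right (a := c + h - 2 * (z - 1)) (by linarith), min_eq_right (by linarith)]
        linarith
    rw [this]
    ring
  constructor
  · intro hpos
    rw [abs_of_pos hpos] at hmb
    rw [min_eq_left hmb, max_eq_right (by simp only [m]; linarith)] at hz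
    have hz' : z' = 1 + u / 2 := by
      rw [hz]
      simp only [m, abs_of_pos hpos]
      ring
    rw [hnest z' (by linarith) (by linarith) (by left; linarith), hz', hu]
    ring_nf
  · intro hneg
    rw [abs_of_nonpos hneg] at hmb
    have h8 : 8 / ε * ζ ≤ -m := by linarith
    have hm0 : 0 ≤ m := by simp only [m]; linarith
    rw [min_eq_right (by linarith), max_eq_left h8] at hz
    have hz' : z' = -(u / 2) := by
      rw [hz]
      simp only [m, abs_of_nonpos hneg]
      ring
    rw [hnest z' (by linarith) (by linarith) (by right; linarith), hz', hu]
    ring_nf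

/-- The tip of a finger. -/
theorem finger_tip {δ c μ ε x h ζ z' : ℝ} (hδ0 : 0 < δ) (hδ1 : δ ≤ 1) (hc : c = -1 + δ)
    (hμ : 0 < μ) (hε : 0 < ε) (hε' : ε ≤ 1 / 4) (hx : -1 + 2 * δ ≤ x)
    (hx1 : x < 1) (hh : c + h = 4 - x) (hζ : |ζ| ≤ ε * (1 - h / 12))
    (hz : z' = 1 / 2 + ζ + spreadFun δ c μ ε ![c + h, μ * x, 1 / 2 + ζ]) :
    ![c + h, μ * x + nestFun μ ![c + h, μ * x, z'], z'] ∈ closingArc x '' Set.Icc 0 1 := by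
  have e2 : (![c + h, μ * x, 1 / 2 + ζ] : Space) 2 = 1 / 2 + ζ := rfl
  rw [spreadFun, spreadBound_eq hμ.ne' hx, e2] at hz
  have hmin : min ((c + h - x) / δ) ((c + h - x) / 2) = (c + h - x) / 2 := by
    apply min_eq_right
    rw [div_le_div_iff₀ two_pos hδ0]
    nlinarith
  have hp : ε * (1 - h / 12) ≤ 1 / 4 := by nlinarith
  rw [hmin, max_eq_right (show 0 ≤ 1 / 2 - ε * (1 - h / 12) + (c + h - x) / 2 by linarith),
    add_sub_cancel_left] at hz
  set m := 1 / 2 - ε * (1 - h / 12) + (c + h - x) / 2 with hm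
  have hm0 : 0 ≤ m := by linarith
  -- The extreme initial distance plus the extreme push is exactly `5 / 2 - x`, half the length of
  -- the vertical edge.
  have hz1 : x - 2 ≤ z' := by
    have := le_max_left (-m) (min m (8 / ε * ζ))
    linarith [neg_abs_le ζ]
  have hz2 : z' ≤ 3 - x := by
    have : max (-m) (min m (8 / ε * ζ)) ≤ m := max_le (by linarith) (min_le_left _ _)
    linarith [le_abs_self ζ]
  have hn : μ * x + nestFun μ ![c + h, μ * x, z'] = 0 := by
    simp only [nestFun, Matrix.cons_val]
    rw [hh, min_eq_left (le_min (by linarith) (by linarith))]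
    ring
  rw [hn, hh]
  exact side_mem_closingArc hx1 hz1 hz2

/-- The part of a link that is not pulled out ends up in the cylinder. -/
theorem rest_mem_cylinder {δ c μ ε x y z z' : ℝ} (hδ0 : 0 < δ) (hδ1 : δ ≤ 1) (hc : c = -1 + δ)
    (hμ : 0 < μ) (hμ' : μ ≤ 1 / 20) (hε : 0 < ε) (hx : |x - c| < δ / 2) (hy : |y| ≤ 1 / 2)
    (hz : |z - 1 / 2| < 1 / 2) (hz' : z' = z + spreadFun δ c μ ε ![x, y, z]) :
    ![x, y + nestFun μ ![x, y, z'], z'] ∈ openCylinder := by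
  rw [abs_lt] at hx hz
  rw [abs_le] at hy
  -- Since `x < c + δ / 2`, the quantity `x + 1 - 2 * δ` is below `-δ / 2`, and division by `δ`
  -- gives less than `-1 / 2`.
  have hm : spreadBound δ c μ ε ![x, y, z] = 0 := by
    simp only [spreadBound, Matrix.cons_val]
    apply max_eq_left
    have h1 : min (min (x + 1 - 2 * δ) (x - y / μ) / δ) (min (x + 1 - 2 * δ) (x - y / μ) / 2) ≤
        -(1 / 2) := by
      refine (min_le_left _ _).trans ?_
      rw [div_le_iff₀ hδ0]
      refine (min_le_left _ _).trans ?_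
      linarith
    have h2 : 0 ≤ ε * (1 - (x - c) / 12) := mul_nonneg hε.le (by linarith)
    linarith
  have hs : spreadFun δ c μ ε ![x, y, z] = 0 := by
    rw [spreadFun, hm, neg_zero]
    exact max_eq_left (min_le_left _ _)
  rw [hs, add_zero] at hz'
  subst hz'
  have hn : |nestFun μ ![x, y, z']| ≤ 1 / 4 := by
    simp only [nestFun, Matrix.cons_val]
    rw [abs_neg, abs_mul, abs_of_pos hμ]
    have : |min (4 - x) (min (x - 2 * (z' - 1)) (x + 2 * z'))| ≤ 5 := by
      rw [abs_le]
      refine ⟨le_min (by linarith) (le_min (by linarith) (by linarith)), (min_le_left _ _).trans ?_⟩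
      linarith
    nlinarith [abs_nonneg (min (4 - x) (min (x - 2 * (z' - 1)) (x + 2 * z')))]
  rw [abs_le] at hn
  refine ⟨⟨?_, ?_⟩, ⟨?_, ?_⟩, ⟨?_, ?_⟩⟩ <;> simp only [Matrix.cons_val] <;> linarith

theorem vec_eta (p : Space) : ![p 0, p 1, p 2] = p := by
  ext k
  fin_cases k <;> rfl

/-- `e` carries the link `L` to a closed string link, the part of the `i`-th component on
`[a i, b i]` to the closing arc, and the set `B` into the cylinder. -/
def IsStandardForm (L : Link l) (B : Set Space) (e : Space ≃ₜ Space) (a b : Fin l → ℝ) : Prop :=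
  (∀ p ∈ B, e p ∈ openCylinder) ∧ ∀ i, a i < b i ∧ b i < a i + 1 ∧
    (∀ t ∈ Set.Icc (a i) (b i),
      e (L.toFun i (t : UnitAddCircle)) ∈ closingArc (basePoint i) '' Set.Icc 0 1) ∧
    e (L.toFun i (a i : UnitAddCircle)) = ![basePoint i, 0, 1] ∧
    e (L.toFun i (b i : UnitAddCircle)) = ![basePoint i, 0, 0] ∧
    ∀ t ∈ Set.Ioo (b i) (a i + 1), e (L.toFun i (t : UnitAddCircle)) ∈ openCylinder

/-- The link has already been shrunk into a small slab around `p 0 = c`, to the left of all base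
points. Near `t i` the `i`-th component runs straight down, and the tube to the right of this piece
contains nothing else. The three pushes then turn the middle of this piece into the closing arc. -/
theorem Link.exists_pull_out (L : Link l) {B : Set Space} {δ c μ ρ : ℝ}
    (hδ : δ = 1 / ((l : ℝ) + 1)) (hc : c = -1 + δ) (hμ : 0 < μ) (hμ' : μ ≤ 1 / 20) (hρ : 0 < ρ)
    (hρ' : ρ < 1 / 2) (t : Fin l → ℝ)
    (hK : ∀ p ∈ (⋃ j, Set.range (L.toFun j)) ∪ B,
      |p 0 - c| < δ / 2 ∧ |p 1| ≤ 1 / 2 ∧ |p 2 - 1 / 2| < 1 / 2)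
    (hB : ∀ p ∈ B, p 0 < c)
    (hg : ∀ i s, |s| ≤ ρ → L.toFun i ((t i + s : ℝ) : UnitAddCircle) =
      ![c, μ * basePoint i, 1 / 2 - μ * s])
    (htube : ∀ i, ∀ p ∈ (⋃ j, Set.range (L.toFun j)) ∪ B, c - μ * ρ ≤ p 0 →
      |p 1 - μ * basePoint i| ≤ μ * ρ → |p 2 - 1 / 2| ≤ μ * ρ →
        ∃ s, |s| ≤ ρ ∧ p = L.toFun i ((t i + s : ℝ) : UnitAddCircle)) :
    ∃ e, IsotopicToId Set.univ e ∧ ∃ a b, IsStandardForm L B e a b := by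
  have hl1 : (1 : ℝ) ≤ (l : ℝ) + 1 := by linarith [(Nat.cast_nonneg l : (0 : ℝ) ≤ l)]
  have hδ0 : 0 < δ := by rw [hδ]; positivity
  have hδ1 : δ ≤ 1 := by rw [hδ, div_le_one (by linarith)]; exact hl1
  set ε := μ * ρ with hε
  have hε0 : 0 < ε := by positivity
  have hε4 : ε ≤ 1 / 4 := by rw [hε]; nlinarith
  obtain ⟨e, he, he'⟩ := exists_finger_isotopy l (c := c) hδ0 hμ hε0
  -- The solution of `12 * (1 - s / ρ) = basePoint i - c`: at distance `σ i` from `t i` the finger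
  -- crosses the vertical line through its base point, where the closing arc begins and ends.
  set σ : Fin l → ℝ := fun i => ρ * (1 - (basePoint i - c) / 12) with hσ
  have hσ0 : ∀ i, 0 < σ i := fun i =>
    mul_pos hρ (by linarith [(basePoint_mem i).2])
  have hσρ : ∀ i, σ i < ρ := fun i => by
    have := basePoint_lower i hδ
    simp only [hσ]
    nlinarith
  have hfing : ∀ (i : Fin l) (s : ℝ), |s| ≤ ρ → fingerFun l c μ ε ![c, μ * basePoint i, 1 / 2 - μ * s] =
      min (4 - basePoint i - c) (12 - 12 * |s| / ρ) := by
    intro i s hs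
    have hpt := hg i s hs
    rw [fingerFun, ← Finset.add_sum_erase _ _ (Finset.mem_univ i),
      fingerFun_eq_zero hε0 hδ0 hδ hc, add_zero]
    · have e1 : 12 / ε * |1 / 2 - μ * s - 1 / 2| = 12 * |s| / ρ := by
        rw [show 1 / 2 - μ * s - 1 / 2 = -(μ * s) by ring, abs_neg, abs_mul, abs_of_pos hμ, hε]
        field_simp
      have h1 : 12 * |s| / ρ ≤ 12 := by rw [div_le_iff₀ hρ]; linarith
      simp only [Matrix.cons_val, sub_self, abs_zero, mul_zero, min_self, add_zero, sub_zero, e1]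
      refine max_eq_right (le_min ?_ (by linarith))
      linarith [(basePoint_mem i).2]
    · rintro j hj ⟨k1, k2, k3⟩
      obtain ⟨s', -, hs'⟩ := htube j _ (Or.inl (Set.mem_iUnion.2 ⟨i, _, hpt⟩)) k1 k2 k3
      have : i = j := congrArg Prod.fst (L.injective (a₁ := (i, _)) (a₂ := (j, _))
        (hpt.trans hs'))
      exact Finset.ne_of_mem_erase hj this.symm
  have hform : ∀ (i : Fin l) (s : ℝ), |s| ≤ ρ → ∀ h : ℝ, h = min (4 - basePoint i - c) (12 - 12 * |s| / ρ) →
      ∃ z' : ℝ, z' = 1 / 2 + -(μ * s) +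
        spreadFun δ c μ ε ![c + h, μ * basePoint i, 1 / 2 + -(μ * s)] ∧
      e (L.toFun i ((t i + s : ℝ) : UnitAddCircle)) = ![c + h, μ * basePoint i +
        nestFun μ ![c + h, μ * basePoint i, z'], z'] := by
    rintro i s hs h rfl
    refine ⟨_, rfl, ?_⟩
    rw [hg i s hs]
    exact he' _ _ _ _ _ _ (by rw [hfing i s hs]) rfl rfl
  have habs : ∀ s, |-(μ * s)| = ε * (|s| / ρ) := fun s => by
    rw [abs_neg, abs_mul, abs_of_pos hμ, hε]
    field_simp
  have hcyl : ∀ (i : Fin l) (s : ℝ), σ i < |s| → |s| ≤ ρ →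
      e (L.toFun i ((t i + s : ℝ) : UnitAddCircle)) ∈ openCylinder := by
    intro i s hs1 hs2
    have hx := basePoint_lower i hδ
    have hx1 := (basePoint_mem i).2
    have hs3 : 12 - 12 * |s| / ρ < basePoint i - c := by
      have : 12 - (basePoint i - c) < 12 * |s| / ρ := by
        rw [lt_div_iff₀ hρ]
        simp only [hσ] at hs1
        nlinarith
      linarith
    have hs4 : 12 * |s| / ρ ≤ 12 := by rw [div_le_iff₀ hρ]; linarith
    obtain ⟨z', hz', e1⟩ := hform i s hs2 (12 - 12 * |s| / ρ)
      (by rw [min_eq_right]; linarith)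
    rw [e1]
    refine finger_mem_cylinder hδ0 hδ1 hc hμ hμ' hε0 hε4 hx hx1 (by linarith) (by linarith) ?_ hz'
    rw [habs]
    ring
  have hside : ∀ (i : Fin l) (s : ℝ), |s| ≤ σ i → basePoint i - c ≤ 12 - 12 * |s| / ρ := by
    intro i s hs
    have : 12 * |s| / ρ ≤ 12 - (basePoint i - c) := by
      rw [div_le_iff₀ hρ]
      simp only [hσ] at hs
      nlinarith
    linarith
  -- Only membership in the arc is needed; that the arc is run through monotonically follows later
  -- from injectivity, in `exists_closingArc_reparam`.
  have harc : ∀ (i : Fin l) (s : ℝ), |s| ≤ σ i → e (L.toFun i ((t i + s : ℝ) : UnitAddCircle)) ∈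
      closingArc (basePoint i) '' Set.Icc 0 1 := by
    intro i s hs
    have hx := basePoint_lower i hδ
    have hx1 := (basePoint_mem i).2
    have hs2 := hs.trans (hσρ i).le
    have hs3 := hside i s hs
    rcases le_total (12 - 12 * |s| / ρ) (4 - basePoint i - c) with hle | hle
    · obtain ⟨z', hz', e1⟩ := hform i s hs2 _ (min_eq_right hle).symm
      obtain ⟨k1, k2⟩ := finger_side hδ0 hδ1 hc hμ hε0 hε4 hx (by linarith) (by linarith)
        (by rw [habs]; ring) hz'
      rw [e1]
      rcases lt_or_ge 0 (-(μ * s)) with h0 | h0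
      · rw [k1 h0]
        exact top_mem_closingArc hx1 (by linarith) (by linarith)
      · rw [k2 h0]
        exact bottom_mem_closingArc hx1 (by linarith) (by linarith)
    · obtain ⟨z', hz', e1⟩ := hform i s hs2 _ (min_eq_left hle).symm
      rw [e1]
      refine finger_tip hδ0 hδ1 hc hμ hε0 hε4 hx hx1 (by ring) ?_ hz'
      rw [habs]
      refine mul_le_mul_of_nonneg_left ?_ hε0.le
      have : 12 * (|s| / ρ) ≤ 12 - (4 - basePoint i - c) := by
        rw [← mul_div_assoc]; linarith
      linarith
  have hend : ∀ (i : Fin l) (s : ℝ), |s| = σ i → ∃ z' : ℝ, z' = 1 / 2 + -(μ * s) + spreadFun δ c μ ε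
      ![c + (basePoint i - c), μ * basePoint i, 1 / 2 + -(μ * s)] ∧
      e (L.toFun i ((t i + s : ℝ) : UnitAddCircle)) = ![c + (basePoint i - c), μ * basePoint i +
        nestFun μ ![c + (basePoint i - c), μ * basePoint i, z'], z'] := by
    intro i s hs
    refine hform i s (hs.le.trans (hσρ i).le) _ ?_
    have : 12 - 12 * |s| / ρ = basePoint i - c := by
      rw [hs]
      simp only [hσ]
      field_simp
      ring
    rw [this, min_eq_right]
    linarith [(basePoint_mem i).2]
  have hends : ∀ (i : Fin l) (s : ℝ), |s| = σ i → |-(μ * s)| = ε * (1 - (basePoint i - c) / 12) := by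
    intro i s hs
    rw [habs, hs]
    simp only [hσ]
    field_simp
  -- In a tube there are only points of the straight piece, treated above. Outside all tubes nothing
  -- is pulled, and the remaining pushes keep the point in the cylinder.
  have hrest : ∀ p ∈ (⋃ j, Set.range (L.toFun j)) ∪ B,
      (∃ i s, |s| ≤ σ i ∧ p = L.toFun i ((t i + s : ℝ) : UnitAddCircle)) ∨ e p ∈ openCylinder := by
    intro p hp
    by_cases htub : ∃ i : Fin l, c - ε ≤ p 0 ∧ |p 1 - μ * basePoint i| ≤ ε ∧ |p 2 - 1 / 2| ≤ ε
    · obtain ⟨i, h1, h2, h3⟩ := htub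
      obtain ⟨s, hs, rfl⟩ := htube i p hp h1 h2 h3
      rcases le_or_gt |s| (σ i) with h | h
      · exact Or.inl ⟨i, s, h, rfl⟩
      · exact Or.inr (hcyl i s h hs)
    · right
      push Not at htub
      have hf : fingerFun l c μ ε p = 0 :=
        fingerFun_eq_zero hε0 hδ0 hδ hc _ fun i _ h => absurd h.2.2 (not_le.2 (htub i h.1 h.2.1))
      obtain ⟨h1, h2, h3⟩ := hK p hp
      rw [← vec_eta p, he' (p 0) (p 1) (p 2) (p 0) _ _ (by rw [vec_eta, hf, add_zero]) rfl rfl]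
      exact rest_mem_cylinder hδ0 hδ1 hc hμ hμ' hε0 h1 h2 h3 rfl
  -- The straight pieces run downwards, so the earlier end, at `t i - σ i`, goes to the top of the
  -- cylinder. Points of `B` cannot lie on the arcs, as they satisfy `p 0 < c`.
  refine ⟨e, he, fun i => t i - σ i, fun i => t i + σ i, fun p hp => ?_, fun i => ⟨?_, ?_, ?_, ?_,
    ?_, ?_⟩⟩
  · rcases hrest p (Or.inr hp) with ⟨i, s, hs, e1⟩ | h
    · have h1 := hB p hp
      rw [e1, hg i s (hs.trans (hσρ i).le)] at h1
      simp at h1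
    · exact h
  · linarith [hσ0 i]
  · linarith [hσρ i]
  · rintro u ⟨hu1, hu2⟩
    have := harc i (u - t i) (abs_le.2 ⟨by linarith, by linarith⟩)
    rwa [add_sub_cancel] at this
  · have hs : |-(σ i)| = σ i := by rw [abs_neg, abs_of_pos (hσ0 i)]
    obtain ⟨z', hz', e1⟩ := hend i _ hs
    have := (finger_side hδ0 hδ1 hc hμ hε0 hε4 (basePoint_lower i hδ) (by linarith)
      (by linarith [(basePoint_mem i).2]) (hends i _ hs) hz').1 (by nlinarith [hσ0 i])
    beta_reduce
    rw [sub_eq_add_neg, e1, this]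
    ext k
    fin_cases k <;> simp
  · have hs : |σ i| = σ i := abs_of_pos (hσ0 i)
    obtain ⟨z', hz', e1⟩ := hend i _ hs
    have := (finger_side hδ0 hδ1 hc hμ hε0 hε4 (basePoint_lower i hδ) (by linarith)
      (by linarith [(basePoint_mem i).2]) (hends i _ hs) hz').2 (by nlinarith [hσ0 i])
    rw [e1, this]
    ext k
    fin_cases k <;> simp
  · rintro u ⟨hu1, hu2⟩
    refine (hrest _ (Or.inl (Set.mem_iUnion.2 ⟨i, _, rfl⟩))).resolve_left ?_
    rintro ⟨j, s, hs, e1⟩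
    have h1 := L.injective (a₁ := (i, _)) (a₂ := (j, _)) e1
    obtain rfl : i = j := congrArg Prod.fst h1
    have h2 : (u : UnitAddCircle) = ((t i + s : ℝ) : UnitAddCircle) := congrArg Prod.snd h1
    rw [abs_le] at hs
    rw [AddCircle.coe_eq_coe_iff_of_mem_Ico (a := t i - σ i) ⟨by linarith, by linarith⟩
      ⟨by linarith [hs.1], by linarith [hs.2, hσρ i]⟩] at h2
    linarith [hs.2]

/-! ### Bringing a link to standard form -/

/-- A positive homothety followed by a translation is isotopic to the identity. -/
theorem exists_homothety {μ : ℝ} (hμ : 0 < μ) (v : Space) :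
    ∃ e, IsotopicToId Set.univ e ∧ ∀ p : Space, e p = μ • p + v := by
  have h (k : Fin 3) : ∃ e, IsotopicToId Set.univ e ∧
      ∀ x : Space, e x = x + ((μ - 1) * x k + v k) • (Pi.single k 1 : Space) :=
    (SlopeGE.coord (w := Pi.single k 1) (c := μ - 1) k (μ - 1) (v k) (by simp)).exists_push
      (by linarith)
  choose e he he' using h
  refine ⟨(e 0).trans ((e 1).trans (e 2)), (he 0).trans ((he 1).trans (he 2)), fun p => ?_⟩
  simp only [Homeomorph.trans_apply, he']
  ext k
  fin_cases k <;> simp <;> ring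

theorem IsStandardForm.of_map {L : Link l} {B : Set Space} {e f : Space ≃ₜ Space}
    {he : IsPLOn e Set.univ} {a b : Fin l → ℝ} (h : IsStandardForm (L.map e he) (e '' B) f a b) :
    IsStandardForm L B (e.trans f) a b :=
  ⟨fun p hp => h.1 _ ⟨p, hp, rfl⟩, h.2⟩

/-- A bound for the coordinates on a compact set. -/
theorem exists_coord_bound {K : Set Space} (hK : IsCompact K) (X : ℝ) :
    ∃ R, 10 ≤ R ∧ ∀ p ∈ K, |p 0 - X| < R ∧ |p 1| < R ∧ |p 2| < R := by
  obtain ⟨C, hC⟩ := hK.isBounded.exists_norm_le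
  refine ⟨max 10 (C + |X| + 1), le_max_left _ _, fun p hp => ?_⟩
  have h (k : Fin 3) : |p k| ≤ C := (norm_le_pi_norm p k).trans (hC p hp)
  have h1 : C + |X| + 1 ≤ max 10 (C + |X| + 1) := le_max_right _ _
  refine ⟨((abs_sub _ _).trans_lt ?_).trans_le h1, ?_, ?_⟩
  · linarith [h 0]
  · linarith [h 1, abs_nonneg X]
  · linarith [h 2, abs_nonneg X]

theorem Link.isCompact_range (L : Link l) : IsCompact (⋃ j, Set.range (L.toFun j)) :=
  isCompact_iUnion fun j => _root_.isCompact_range (L.continuous j)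

/-- A link all of whose components meet the plane `p 0 = X` in a standard way, and a compact set
on one side of that plane, can be brought to standard form. -/
theorem Link.exists_isStandardForm_of_tubes (L : Link l) {B : Set Space} (hB : IsCompact B) {X : ℝ}
    (hBX : ∀ p ∈ B, p 0 < X) (t : Fin l → ℝ)
    (hg : ∀ i, ∀ᶠ s in 𝓝 (0 : ℝ),
      L.toFun i ((t i + s : ℝ) : UnitAddCircle) = ![X, basePoint i, -s])
    (hray : ∀ (i j : Fin l) (θ : UnitAddCircle) (r : ℝ),
      L.toFun j θ = ![X + r, basePoint i, 0] → r = 0) :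
    ∃ e, IsotopicToId Set.univ e ∧ ∃ a b, IsStandardForm L B e a b := by
  obtain ⟨ρ, hρ, hρ', hgerm, htube⟩ := L.exists_tubes hB hBX t hg hray
  obtain ⟨R, hR, hK⟩ := exists_coord_bound (L.isCompact_range.union hB) X
  have hl1 : (1 : ℝ) ≤ (l : ℝ) + 1 := by linarith [(Nat.cast_nonneg l : (0 : ℝ) ≤ l)]
  obtain ⟨δ, hδ⟩ : ∃ δ : ℝ, δ = 1 / ((l : ℝ) + 1) := ⟨_, rfl⟩
  have hδ0 : 0 < δ := by rw [hδ]; positivity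
  have hδ1 : δ ≤ 1 := by rw [hδ, div_le_one (by linarith)]; exact hl1
  obtain ⟨c, hc⟩ : ∃ c : ℝ, c = -1 + δ := ⟨_, rfl⟩
  -- This scale shrinks everything into the slab of half-width `δ / 2` around `p 0 = c`; the bound
  -- `10 ≤ R` makes `μ ≤ 1 / 20`.
  obtain ⟨μ, hμR⟩ : ∃ μ : ℝ, μ = δ / (2 * R) := ⟨_, rfl⟩
  have hμ : 0 < μ := by rw [hμR]; positivity
  have hμR' : μ * R = δ / 2 := by rw [hμR]; field_simp
  have hμ' : μ ≤ 1 / 20 := by nlinarith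
  obtain ⟨e, he, he'⟩ := exists_homothety hμ ![c - μ * X, 0, 1 / 2]
  have he0 (p : Space) : e p 0 = c + μ * (p 0 - X) := by rw [he']; simp; ring
  have he1 (p : Space) : e p 1 = μ * p 1 := by rw [he']; simp
  have he2 (p : Space) : e p 2 = μ * p 2 + 1 / 2 := by rw [he']; simp
  have hpre {p : Space} (hp : p ∈ (⋃ j, Set.range ((L.map e he.isPLOn).toFun j)) ∪ e '' B) :
      ∃ q ∈ (⋃ j, Set.range (L.toFun j)) ∪ B, e q = p := by
    rcases hp with hp | ⟨q, hq, rfl⟩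
    · obtain ⟨j, θ, rfl⟩ := Set.mem_iUnion.1 hp
      exact ⟨_, Or.inl (Set.mem_iUnion.2 ⟨j, θ, rfl⟩), rfl⟩
    · exact ⟨q, Or.inr hq, rfl⟩
  have hlt {y : ℝ} (hy : |y| < R) : |μ * y| < δ / 2 := by
    rw [abs_mul, abs_of_pos hμ, ← hμR']
    exact mul_lt_mul_of_pos_left hy hμ
  have hle {y r : ℝ} (hy : |μ * y| ≤ μ * r) : |y| ≤ r := by
    rw [abs_mul, abs_of_pos hμ] at hy
    exact le_of_mul_le_mul_left hy hμ
  have main := (L.map e he.isPLOn).exists_pull_out (B := e '' B) hδ hc hμ hμ' hρ hρ'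
    t ?_ ?_ ?_ ?_
  · obtain ⟨f, hf, a, b, hst⟩ := main
    exact ⟨e.trans f, he.trans hf, a, b, hst.of_map⟩
  · intro p hp
    obtain ⟨q, hq, rfl⟩ := hpre hp
    obtain ⟨h0, h1, h2⟩ := hK q hq
    rw [he0, he1, he2, add_sub_cancel_left, add_sub_cancel_right]
    exact ⟨hlt h0, by linarith [hlt h1], by linarith [hlt h2]⟩
  · rintro _ ⟨q, hq, rfl⟩
    rw [he0]
    nlinarith [hBX q hq]
  · intro i s hs
    change e _ = _
    rw [hgerm i s hs, he']
    ext k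
    fin_cases k <;> simp; ring
  · intro i p hp h0 h1 h2
    obtain ⟨q, hq, rfl⟩ := hpre hp
    rw [he0] at h0
    rw [he1, ← mul_sub] at h1
    rw [he2, add_sub_cancel_right] at h2
    obtain ⟨s, hs, rfl⟩ := htube i q hq (by nlinarith) (hle h1) (hle h2)
    exact ⟨s, hs, rfl⟩

/-- Every link is isotopic to a closed string link, and the isotopy can be chosen to carry a given
compact set to the cylinder, provided its complement is connected and no component of the link is
contained in it. -/
theorem Link.exists_isStandardForm (L : Link l) {B : Set Space} (hB : IsCompact B)
    (hc : IsPreconnected Bᶜ) (hL : ∀ i, ¬ Set.range (L.toFun i) ⊆ B) :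
    ∃ e, IsotopicToId Set.univ e ∧ ∃ a b, IsStandardForm L B e a b := by
  obtain ⟨X, -, hX⟩ := exists_coord_bound hB 0
  have hBX : ∀ p ∈ B, p 0 < X := fun p hp => by
    have := (hX p hp).1
    rw [sub_zero] at this
    exact (le_abs_self _).trans_lt this
  set P : Fin l → Space := fun i => ![X, basePoint i, 0] with hPdef
  obtain ⟨e₁, he₁, hgerm⟩ := L.exists_move_germs hB.isClosed hc hL (P := P)
    (fun i j h => basePoint_injective (congrFun h 1)) (fun i h => (hBX _ h).ne rfl)
    (w := ![0, 0, -1]) (fun h => by simpa using congrFun h 2)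
  choose t ht using hgerm
  have he₁' := he₁.mono (Set.subset_univ _)
  have he₁B : e₁ '' B = B := by
    have h : ∀ p ∈ B, e₁ p = p := fun p hp => he₁.fixed fun h => h hp
    rw [Set.image_congr h, Set.image_id']
  -- The generic direction is made parallel to the first axis by a shear. The shear preserves the
  -- first coordinate and fixes the plane `p 0 = X`, so `B` stays to the left and the vertical germs
  -- in this plane stay in place.
  obtain ⟨τ, hτ⟩ := (L.map e₁ he₁'.isPLOn).exists_generic_direction P
  obtain ⟨e₂, he₂, he₂'⟩ := exists_shear X τ
  have main := ((L.map e₁ he₁'.isPLOn).map e₂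
    he₂.isPLOn).exists_isStandardForm_of_tubes (B := e₂ '' B) (hB.image e₂.continuous) (X := X)
    ?_ t ?_ ?_
  · obtain ⟨f, hf, a, b, hst⟩ := main
    rw [← he₁B] at hst
    exact ⟨e₁.trans (e₂.trans f), he₁'.trans (he₂.trans hf), a, b, hst.of_map.of_map⟩
  · rintro _ ⟨p, hp, rfl⟩
    rw [he₂']
    exact hBX p hp
  · intro i
    filter_upwards [ht i] with s hs
    change e₂ (e₁ _) = _
    rw [hs, he₂']
    ext k
    fin_cases k <;> simp [hPdef]
  · intro i j θ r h
    refine hτ i j θ r (e₂.injective (h.trans ?_))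
    rw [he₂']
    ext k
    fin_cases k <;> simp [hPdef] <;> ring

/-! ### Reparametrizations -/

/-- An increasing bijection of `[0, 1]` extends to an increasing map of the line that commutes with
the translation by `1`. -/
theorem exists_periodic_extension {γ : ℝ → ℝ} (hc : ContinuousOn γ (Set.Icc 0 1))
    (hm : StrictMonoOn γ (Set.Icc 0 1)) (h0 : γ 0 = 0) (h1 : γ 1 = 1) :
    ∃ g : ℝ → ℝ, Continuous g ∧ StrictMono g ∧ (∀ t, g (t + 1) = g t + 1) ∧
      ∀ t, g t = ⌊t⌋ + γ (Int.fract t) := by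
  have hf (t : ℝ) : Int.fract t ∈ Set.Icc (0 : ℝ) 1 :=
    ⟨Int.fract_nonneg t, (Int.fract_lt_one t).le⟩
  refine ⟨fun t => ⌊t⌋ + γ (Int.fract t), ?_, fun s t hst => ?_, fun t => ?_, fun t => rfl⟩
  · have h := ContinuousOn.comp_fract'' (hc.sub continuousOn_id) (by simp [h0, h1])
    refine (continuous_id.add h).congr fun t => ?_
    have := Int.floor_add_fract t
    change t + (γ (Int.fract t) - Int.fract t) = ⌊t⌋ + γ (Int.fract t)
    linarith
  · rcases (Int.floor_le_floor hst.le).eq_or_lt with h | h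
    · have : Int.fract s < Int.fract t := by
        rw [Int.fract, Int.fract, h]
        linarith
      simpa only [h, add_lt_add_iff_left] using hm (hf s) (hf t) this
    · have e1 : γ (Int.fract s) < 1 := by
        rw [← h1]
        exact hm (hf s) (by simp) (Int.fract_lt_one s)
      have e2 : 0 ≤ γ (Int.fract t) := by
        rw [← h0]
        exact hm.monotoneOn (by simp) (hf t) (hf t).1
      have e3 : (⌊s⌋ : ℝ) + 1 ≤ ⌊t⌋ := by exact_mod_cast h
      dsimp only
      linarith
  · simp only [Int.floor_add_one, Int.fract_add_one, Int.cast_add, Int.cast_one]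
    ring

/-- To check that links are isotopic, it suffices to reparametrize each component on one period. -/
theorem Link.Isotopic.of_period {L L' : Link l} {e : Space ≃ₜ Space} (he : IsotopicToId Set.univ e)
    (b : Fin l → ℝ) (h : ∀ i, ∃ γ : ℝ → ℝ, ContinuousOn γ (Set.Icc 0 1) ∧
      StrictMonoOn γ (Set.Icc 0 1) ∧ γ 0 = 0 ∧ γ 1 = 1 ∧ ∀ u ∈ Set.Icc (0 : ℝ) 1,
        e (L.toFun i ((b i + u : ℝ) : UnitAddCircle)) = L'.toFun i (γ u : UnitAddCircle)) :
    L.Isotopic L' := by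
  obtain ⟨H, rfl⟩ := he
  refine ⟨H, fun i => ?_⟩
  obtain ⟨γ, hc, hm, h0, h1, hγ⟩ := h i
  obtain ⟨g, gc, gm, gp, hg⟩ := exists_periodic_extension hc hm h0 h1
  refine ⟨fun t => g (t - b i), by fun_prop, fun s t hst => gm (by linarith), fun t => ?_,
    fun t => ?_⟩
  · dsimp only
    rw [← gp]
    congr 1
    ring
  · have e1 := hγ (Int.fract (t - b i)) ⟨Int.fract_nonneg _, (Int.fract_lt_one _).le⟩
    have e2 : ((b i + Int.fract (t - b i) : ℝ) : UnitAddCircle) = (t : UnitAddCircle) := by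
      rw [AddCircle.coe_add, coe_fract_circle, ← AddCircle.coe_add, add_sub_cancel]
    have e3 : (g (t - b i) : UnitAddCircle) = (γ (Int.fract (t - b i)) : UnitAddCircle) := by
      have h4 : ((⌊t - b i⌋ : ℝ) : UnitAddCircle) = 0 := by
        have h5 := coe_fract_circle (t - b i)
        rw [Int.fract, AddCircle.coe_sub] at h5
        simpa only [sub_eq_self] using h5
      rw [hg, AddCircle.coe_add, h4, zero_add]
    rw [← e2, e1, e3]

theorem closingArc_zero (x : ℝ) : closingArc x 0 = ![x, 0, 1] := by
  simp [closingArc]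

theorem closingArc_one (x : ℝ) : closingArc x 1 = ![x, 0, 0] := by
  rw [closingArc, if_neg (by norm_num), if_neg (by norm_num)]
  simp

theorem closingArc_notMem_openCylinder {x s : ℝ} (hx : -1 < x ∧ x < 1) (hs : s ∈ Set.Icc (0 : ℝ) 1) :
    closingArc x s ∉ openCylinder := by
  intro h
  rcases hs.1.eq_or_lt with rfl | h0
  · rw [closingArc_zero] at h
    exact lt_irrefl _ h.2.2.2
  rcases hs.2.eq_or_lt with rfl | h1
  · rw [closingArc_one] at h
    exact lt_irrefl _ h.2.2.1
  exact closingArc_notMem hx ⟨h0, h1⟩ ⟨h.1.2.le, h.2.2.1.le, h.2.2.2.le⟩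

/-- `closingArc_injective` covers interior parameters only. The two endpoints are distinct and
satisfy the inequalities that `closingArc_notMem` excludes for interior points. -/
theorem closingArc_injOn {x : ℝ} (hx : -1 < x ∧ x < 1) :
    Set.InjOn (closingArc x) (Set.Icc 0 1) := by
  have h01 : closingArc x 0 ≠ closingArc x 1 := by
    rw [closingArc_zero, closingArc_one]
    intro h
    simpa using congrFun h 2
  have hend {s r : ℝ} (hs : s = 0 ∨ s = 1) (hr : 0 < r ∧ r < 1) :
      closingArc x s ≠ closingArc x r := by
    intro h
    refine closingArc_notMem hx hr ?_
    rw [← h]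
    rcases hs with rfl | rfl
    · rw [closingArc_zero]
      simp [hx.2.le]
    · rw [closingArc_one]
      simp [hx.2.le]
  have hcase {s : ℝ} (hs : s ∈ Set.Icc (0 : ℝ) 1) : (s = 0 ∨ s = 1) ∨ 0 < s ∧ s < 1 := by
    rcases hs.1.eq_or_lt with h | h
    · exact Or.inl (Or.inl h.symm)
    rcases hs.2.eq_or_lt with h' | h'
    · exact Or.inl (Or.inr h')
    exact Or.inr ⟨h, h'⟩
  intro s hs r hr h
  rcases hcase hs with hs' | hs' <;> rcases hcase hr with hr' | hr'
  · rcases hs' with rfl | rfl <;> rcases hr' with rfl | rfl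
    · rfl
    · exact absurd h h01
    · exact absurd h.symm h01
    · rfl
  · exact absurd h (hend hs' hr')
  · exact absurd h.symm (hend hr' hs')
  · exact (closingArc_injective hx hx hs' hr' h).2

/-- An embedded path that runs through the closing arc is a reparametrization of it. -/
theorem exists_closingArc_reparam {x : ℝ} (hx : -1 < x ∧ x < 1) {a b : ℝ} (hab : a ≤ b)
    {q : ℝ → Space} (hq : ContinuousOn q (Set.Icc a b)) (hi : Set.InjOn q (Set.Icc a b))
    (hm : ∀ t ∈ Set.Icc a b, q t ∈ closingArc x '' Set.Icc 0 1) (ha : q a = ![x, 0, 1])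
    (hb : q b = ![x, 0, 0]) :
    ∃ α : ℝ → ℝ, ContinuousOn α (Set.Icc a b) ∧ StrictMonoOn α (Set.Icc a b) ∧ α a = 0 ∧
      α b = 1 ∧ ∀ t ∈ Set.Icc a b, α t ∈ Set.Icc (0 : ℝ) 1 ∧ q t = closingArc x (α t) := by
  -- The arc is an embedded compact interval, so the parameter on it is a continuous function of the
  -- point.
  have hA : IsClosedEmbedding ((Set.Icc (0 : ℝ) 1).domRestrict (closingArc x)) :=
    (isPLOn_closingArc x).1.domRestrict.isClosedEmbedding (closingArc_injOn hx).injective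
  have hex : ∀ t : Set.Icc a b, ∃ s : Set.Icc (0 : ℝ) 1, closingArc x s = q t := fun t => by
    obtain ⟨s, hs, h⟩ := hm t t.2
    exact ⟨⟨s, hs⟩, h⟩
  choose α hα using hex
  have hαc : Continuous α := by
    rw [hA.isInducing.continuous_iff]
    refine hq.domRestrict.congr fun t => (hα t).symm
  have hE {t : ℝ} (ht : t ∈ Set.Icc a b) : Set.IccExtend hab α t = α ⟨t, ht⟩ :=
    Set.IccExtend_of_mem _ _ ht
  have hval {t : ℝ} (ht : t ∈ Set.Icc a b) :
      q t = closingArc x (Set.IccExtend hab α t : Set.Icc (0 : ℝ) 1) := by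
    rw [hE ht, hα]
  have h0 : ((Set.IccExtend hab α a : Set.Icc (0 : ℝ) 1) : ℝ) = 0 :=
    closingArc_injOn hx (Subtype.prop _) (by simp)
      (by rw [← hval (Set.left_mem_Icc.2 hab), ha, closingArc_zero])
  have h1 : ((Set.IccExtend hab α b : Set.Icc (0 : ℝ) 1) : ℝ) = 1 :=
    closingArc_injOn hx (Subtype.prop _) (by simp)
      (by rw [← hval (Set.right_mem_Icc.2 hab), hb, closingArc_one])
  have hcont : ContinuousOn (fun t => ((Set.IccExtend hab α t : Set.Icc (0 : ℝ) 1) : ℝ))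
      (Set.Icc a b) :=
    (continuous_subtype_val.comp (hαc.Icc_extend' (h := hab))).continuousOn
  refine ⟨_, hcont, ?_, h0, h1, fun t ht => ⟨Subtype.prop _, hval ht⟩⟩
  -- A continuous injective function on an interval is strictly monotone, and the values at the ends
  -- decide that it increases.
  refine hcont.strictMonoOn_of_injOn_Icc hab (by rw [h0, h1]; exact zero_le_one) ?_
  intro s hs t ht h
  refine hi hs ht ?_
  rw [hval hs, hval ht]
  exact congrArg _ h

theorem StringLink.closure_toFun (σ : StringLink l) (i : Fin l) {t : ℝ}
    (ht : t ∈ Set.Icc (0 : ℝ) 1) :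
    σ.closure.toFun i (t : UnitAddCircle) = σ.closurePath i t :=
  σ.liftIco_closurePath i ht

/-! ### String links from links in standard form -/

/-- A bounded interval meets finitely many periods, so finitely many integer translates of the given
pieces suffice. -/
theorem Link.isPLOn_path (L : Link l) (i : Fin l) (u v : ℝ) :
    IsPLOn (fun t : ℝ => L.toFun i (t : UnitAddCircle)) (Set.Icc u v) := by
  obtain ⟨-, 𝒜, h𝒜, hA⟩ := L.isPL i
  refine ⟨(L.continuous_path i).continuousOn, Set.image2 (fun (A : ℝ →ᵃ[ℝ] Space) (n : ℤ) =>
    A.comp (AffineMap.id ℝ ℝ - AffineMap.const ℝ ℝ (n : ℝ))) 𝒜 (Set.Icc ⌊u⌋ ⌊v⌋),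
    h𝒜.image2 _ (Set.finite_Icc _ _), fun t ht => ?_⟩
  obtain ⟨A, hA𝒜, h⟩ := hA (Int.fract t) ⟨Int.fract_nonneg t, (Int.fract_lt_one t).le⟩
  refine ⟨_, ⟨A, hA𝒜, ⌊t⌋, ⟨Int.floor_le_floor ht.1, Int.floor_le_floor ht.2⟩, rfl⟩, ?_⟩
  beta_reduce at h ⊢
  rw [coe_fract_circle] at h
  rw [h]
  change A (Int.fract t) = A (t - ⌊t⌋)
  rw [Int.self_sub_floor]

namespace IsStandardForm

variable {L : Link l} {B : Set Space} {e : Space ≃ₜ Space} {a b : Fin l → ℝ}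

/-- The string link whose closure is a link in standard form. -/
def stringLink (h : IsStandardForm L B e a b) (he : IsPLOn e Set.univ) : StringLink l where
  -- The string is the part of the component complementary to the closing arc, on `[b i, a i + 1]`.
  toFun i τ := e (L.toFun i (((a i + 1 - b i) * τ + b i : ℝ) : UnitAddCircle))
  injective := by
    rintro ⟨i, s⟩ ⟨j, t⟩ hij
    have h1 := L.injective (a₁ := (i, _)) (a₂ := (j, _)) (e.injective hij)
    obtain rfl : i = j := congrArg Prod.fst h1
    obtain ⟨hab, hba, -⟩ := h.2 i
    have h2 : (((a i + 1 - b i) * s + b i : ℝ) : UnitAddCircle) =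
        (((a i + 1 - b i) * t + b i : ℝ) : UnitAddCircle) := congrArg Prod.snd h1
    have hmem (r : unitInterval) : (a i + 1 - b i) * r + b i ∈ Set.Ico (b i) (b i + 1) :=
      ⟨by nlinarith [r.2.1], by nlinarith [r.2.1, r.2.2]⟩
    rw [AddCircle.coe_eq_coe_iff_of_mem_Ico (hmem s) (hmem t)] at h2
    have h3 : (s : ℝ) = t := mul_left_cancel₀ (by linarith : a i + 1 - b i ≠ 0) (by linarith)
    rw [Subtype.ext h3]
  isPL i := by
    obtain ⟨hab, hba, -⟩ := h.2 i
    refine (he.comp ((L.isPLOn_path i (b i) (a i + 1)).comp_affine (s' := Set.Icc 0 1)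
      (a i + 1 - b i) (b i) fun t ht => ⟨?_, ?_⟩) (Set.mapsTo_univ _ _)).congr fun t ht => ?_
    · nlinarith [ht.1]
    · nlinarith [ht.2]
    · rw [Set.IccExtend_of_mem _ _ ht]
      rfl
  map_zero i := by
    obtain ⟨-, -, -, -, h0, -⟩ := h.2 i
    simpa using h0
  map_one i := by
    obtain ⟨-, -, -, h1, -⟩ := h.2 i
    have : (((a i + 1 - b i) * (1 : unitInterval) + b i : ℝ) : UnitAddCircle) = a i := by
      rw [Set.Icc.coe_one, mul_one, sub_add_cancel, AddCircle.coe_add, AddCircle.coe_period,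
        add_zero]
    rw [this, h1]
  mem_openCylinder i t h0 h1 := by
    obtain ⟨hab, hba, -, -, -, h2⟩ := h.2 i
    have h0' : (0 : ℝ) < t := h0
    have h1' : (t : ℝ) < 1 := h1
    exact h2 _ ⟨by nlinarith, by nlinarith⟩

/-- The closure runs through the string in the first half of its period, as `e` maps the
complementary part of `L`, and then through the standard arc. The arc part of `L` has the same image
up to a monotone change of parameter, so the two links differ by reparametrization only. -/
theorem isotopic_closure (h : IsStandardForm L B e a b) (he : IsotopicToId Set.univ e) :
    L.Isotopic (h.stringLink he.isPLOn).closure := by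
  refine Link.Isotopic.of_period he b fun i => ?_
  obtain ⟨hab, hba, harc, ha, hb, -⟩ := h.2 i
  have hinj : Set.InjOn (fun t : ℝ => e (L.toFun i (t : UnitAddCircle))) (Set.Icc (a i) (b i)) := by
    intro s hs t ht hst
    have := L.injective_component i (e.injective hst)
    rwa [AddCircle.coe_eq_coe_iff_of_mem_Ico (a := a i) ⟨hs.1, by linarith [hs.2]⟩
      ⟨ht.1, by linarith [ht.2]⟩] at this
  obtain ⟨α, hαc, hαm, hα0, hα1, hα⟩ := exists_closingArc_reparam (basePoint_mem i) hab.le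
    (e.continuous.comp (L.continuous_path i)).continuousOn hinj harc ha hb
  obtain ⟨d, hd⟩ : ∃ d, d = a i + 1 - b i := ⟨_, rfl⟩
  have hd0 : 0 < d := by linarith
  have hmem {u : ℝ} (hu : u ∈ Set.Icc d 1) : b i + u - 1 ∈ Set.Icc (a i) (b i) :=
    ⟨by linarith [hu.1], by linarith [hu.2]⟩
  have hglue : d / (2 * d) = (1 + α (b i + d - 1)) / 2 := by
    rw [show b i + d - 1 = a i by linarith, hα0]
    field_simp
    norm_num
  have hright {u : ℝ} (hu : u ∈ Set.Icc d 1) :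
      (fun u => if u ≤ d then u / (2 * d) else (1 + α (b i + u - 1)) / 2) u =
        (1 + α (b i + u - 1)) / 2 := by
    rcases hu.1.eq_or_lt with rfl | h'
    · simp only [le_refl, if_true, hglue]
    · simp [not_le.2 h']
  have hleft {u : ℝ} (hu : u ∈ Set.Icc 0 d) :
      (fun u => if u ≤ d then u / (2 * d) else (1 + α (b i + u - 1)) / 2) u = u / (2 * d) := by
    simp [hu.2]
  have hU : Set.Icc 0 d ∪ Set.Icc d 1 = Set.Icc (0 : ℝ) 1 :=
    Set.Icc_union_Icc_eq_Icc hd0.le (by linarith)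
  -- Starting at `b i`, the string takes time `d`, rescaled linearly to `1 / 2`; the rest follows
  -- the parameter `α` on the arc.
  refine ⟨fun u => if u ≤ d then u / (2 * d) else (1 + α (b i + u - 1)) / 2, ?_, ?_, ?_, ?_, ?_⟩
  · rw [← hU]
    refine ContinuousOn.union_of_isClosed ?_ ?_ isClosed_Icc isClosed_Icc
    · exact ContinuousOn.congr (by fun_prop) fun u hu => hleft hu
    · refine ContinuousOn.congr ?_ fun u hu => hright hu
      exact (continuousOn_const.add (hαc.comp (by fun_prop) fun u hu => hmem hu)).div_const 2
  · rw [← hU]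
    refine StrictMonoOn.union (c := d) ?_ ?_ (isGreatest_Icc hd0.le) (isLeast_Icc (by linarith))
    · refine StrictMonoOn.congr ?_ fun u hu => (hleft hu).symm
      exact fun s _ t _ hst => div_lt_div_of_pos_right hst (by linarith)
    · refine StrictMonoOn.congr ?_ fun u hu => (hright hu).symm
      intro s hs t ht hst
      have := hαm (hmem hs) (hmem ht) (by linarith)
      dsimp only
      linarith
  · simp [hd0.le]
  · rw [hright ⟨by linarith, le_rfl⟩, add_sub_cancel_right, hα1]
    norm_num
  · intro u hu
    rcases le_total u d with hud | hud
    · have hu' : u / (2 * d) ≤ 1 / 2 := by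
        rw [div_le_iff₀ (by linarith)]
        linarith
      have h2 : 2 * (u / (2 * d)) = u / d := by field_simp
      have h3 : u / d ∈ Set.Icc (0 : ℝ) 1 := ⟨div_nonneg hu.1 hd0.le, (div_le_one hd0).2 hud⟩
      rw [hleft ⟨hu.1, hud⟩, StringLink.closure_toFun _ _
        ⟨div_nonneg hu.1 (by linarith), by linarith⟩, StringLink.closurePath, if_pos hu', h2,
        Set.IccExtend_of_mem _ _ h3]
      simp only [stringLink, ← hd, mul_div_cancel₀ _ hd0.ne', add_comm]
    · obtain ⟨hα2, hα3⟩ := hα _ (hmem ⟨hud, hu.2⟩)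
      have h1 : ((b i + u : ℝ) : UnitAddCircle) = ((b i + u - 1 : ℝ) : UnitAddCircle) := by
        rw [AddCircle.coe_sub, AddCircle.coe_period, sub_zero]
      rw [hright ⟨hud, hu.2⟩, StringLink.closure_toFun _ _
        ⟨by linarith [hα2.1], by linarith [hα2.2]⟩, h1]
      refine hα3.trans ?_
      rcases hud.eq_or_lt with rfl | hlt
      · have h4 : b i + d - 1 = a i := by linarith
        rw [h4, hα0, closingArc_zero, StringLink.closurePath, if_pos (by norm_num)]
        norm_num
        exact (StringLink.map_one _ i).symm
      · have h4 : 0 < α (b i + u - 1) := by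
          rw [← hα0]
          exact hαm (Set.left_mem_Icc.2 hab.le) (hmem ⟨hud, hu.2⟩) (by linarith)
        rw [StringLink.closurePath, if_neg (by linarith)]
        congr 1
        ring

end IsStandardForm

/-! ### The framed link of a tree clasper lies in the ball and misses the strands -/

theorem firstChild_injective : Function.Injective firstChild := by
  intro p q h
  have h0 := congrFun h 0
  have h1 := congrFun h 1
  have h2 := congrFun h 2
  simp only [firstChild, Matrix.cons_val] at h0 h1 h2
  ext k
  fin_cases k
  · change p 0 = q 0
    linarith
  · change p 1 = q 1
    linarith
  · change p 2 = q 2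
    linarith

theorem secondChild_injective : Function.Injective secondChild := by
  intro p q h
  have h0 := congrFun h 0
  have h1 := congrFun h 1
  have h2 := congrFun h 2
  simp only [secondChild, Matrix.cons_val] at h0 h1 h2
  ext k
  fin_cases k
  · change p 0 = q 0
    linarith
  · change p 1 = q 1
    linarith
  · change p 2 = q 2
    linarith

theorem rectangle_bounds {i j : Fin 3} {x y z x' y' z' : ℝ} {p : Space}
    (hp : p ∈ (rectangle i j ![x, y, z] ![x', y', z']).solid) :
    (x - 1 / 64 ≤ p 0 ∧ p 0 ≤ x' + 1 / 64) ∧ (y - 1 / 64 ≤ p 1 ∧ p 1 ≤ y' + 1 / 64) ∧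
      (z - 1 / 64 ≤ p 2 ∧ p 2 ≤ z' + 1 / 64) :=
  ⟨hp.1 0, hp.1 1, hp.1 2⟩

theorem mem_firstChild_cube (t : Tree) {p : Space} (h0 : 1 ≤ p 0 ∧ p 0 ≤ 3 / 2)
    (h1 : |p 1| ≤ 1 / 4) (h2 : |p 2 - 1| ≤ 1 / 4) : p ∈ firstChild '' t.upperBall := by
  rw [abs_le] at h1 h2
  refine ⟨![4 * (p 2 - 1), -4 * p 1, 4 * (p 0 - 1)], cube_subset_upperBall t ?_, ?_⟩
  · rw [mem_Icc_vec]
    simp only [Matrix.cons_val]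
    refine ⟨⟨?_, ?_⟩, ⟨?_, ?_⟩, ⟨?_, ?_⟩⟩ <;> linarith
  · ext k
    fin_cases k <;> simp [firstChild]

theorem mem_secondChild_cube (t : Tree) {p : Space} (h0 : |p 0| ≤ 1 / 4)
    (h1 : 1 ≤ p 1 ∧ p 1 ≤ 3 / 2) (h2 : |p 2 - 1| ≤ 1 / 4) : p ∈ secondChild '' t.upperBall := by
  rw [abs_le] at h0 h2
  refine ⟨![4 * p 0, -4 * (p 2 - 1), 4 * (p 1 - 1)], cube_subset_upperBall t ?_, ?_⟩
  · rw [mem_Icc_vec]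
    simp only [Matrix.cons_val]
    refine ⟨⟨?_, ?_⟩, ⟨?_, ?_⟩, ⟨?_, ?_⟩⟩ <;> linarith
  · ext k
    fin_cases k <;> simp [secondChild]; ring

/-- Only two rectangles leave the cube of their vertex. They protrude by `1 / 8` plus the thickness,
and the cubes attached to the faces there contain these ends. -/
theorem upperLink_subset : ∀ (t : Tree), ∀ K ∈ t.upperLink, K.solid ⊆ t.upperBall
  | .leaf, K, hK => by
    obtain rfl := List.mem_singleton.1 hK
    intro p hp
    obtain ⟨h0, h1, h2⟩ := rectangle_bounds hp
    rw [Tree.upperBall, mem_Icc_vec]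
    refine ⟨⟨?_, ?_⟩, ⟨?_, ?_⟩, ⟨?_, ?_⟩⟩ <;> linarith
  | .node a b, K, hK => by
    simp only [Tree.upperLink, List.mem_cons, List.mem_append, List.mem_map] at hK
    rcases hK with rfl | rfl | rfl | ⟨K, hK, rfl⟩ | ⟨K, hK, rfl⟩
    · intro p hp
      obtain ⟨h0, h1, h2⟩ := rectangle_bounds hp
      refine Or.inl (mem_Icc_vec.2 ?_)
      refine ⟨⟨?_, ?_⟩, ⟨?_, ?_⟩, ⟨?_, ?_⟩⟩ <;> linarith
    · intro p hp
      obtain ⟨h0, h1, h2⟩ := rectangle_bounds hp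
      rcases le_total (p 0) 1 with h | h
      · refine Or.inl (mem_Icc_vec.2 ?_)
        refine ⟨⟨?_, ?_⟩, ⟨?_, ?_⟩, ⟨?_, ?_⟩⟩ <;> linarith
      · exact Or.inr (Or.inl (mem_firstChild_cube a ⟨h, by linarith⟩
          (abs_le.2 ⟨by linarith, by linarith⟩) (abs_le.2 ⟨by linarith, by linarith⟩)))
    · intro p hp
      obtain ⟨h0, h1, h2⟩ := rectangle_bounds hp
      rcases le_total (p 1) 1 with h | h
      · refine Or.inl (mem_Icc_vec.2 ?_)
        refine ⟨⟨?_, ?_⟩, ⟨?_, ?_⟩, ⟨?_, ?_⟩⟩ <;> linarith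
      · exact Or.inr (Or.inr (mem_secondChild_cube b (abs_le.2 ⟨by linarith, by linarith⟩)
          ⟨h, by linarith⟩ (abs_le.2 ⟨by linarith, by linarith⟩)))
    · exact (Set.image_mono (upperLink_subset a K hK)).trans
        (Set.subset_union_left.trans Set.subset_union_right)
    · exact (Set.image_mono (upperLink_subset b K hK)).trans
        (Set.subset_union_right.trans Set.subset_union_right)

theorem framedLink_subset (t : Tree) : ∀ K ∈ t.framedLink, K.solid ⊆ t.ball := by
  intro K hK
  rcases List.mem_cons.1 hK with rfl | hK
  · intro p hp
    obtain ⟨h0, h1, h2⟩ := rectangle_bounds hp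
    rcases le_total (p 2) 0 with h | h
    · refine Or.inl (mem_Icc_vec.2 ?_)
      refine ⟨⟨?_, ?_⟩, ⟨?_, ?_⟩, ⟨?_, ?_⟩⟩ <;> linarith
    · refine Or.inr (cube_subset_upperBall t (mem_Icc_vec.2 ?_))
      refine ⟨⟨?_, ?_⟩, ⟨?_, ?_⟩, ⟨?_, ?_⟩⟩ <;> linarith
  · exact (upperLink_subset t K hK).trans Set.subset_union_right

theorem upperStrands_subset : ∀ t : Tree, t.upperStrands ⊆ t.upperBall
  | .leaf => fun p hp => by
    obtain ⟨h0, h2, h1⟩ := segment_leaf hp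
    rw [Tree.upperBall, mem_Icc_vec]
    refine ⟨⟨?_, ?_⟩, ⟨?_, ?_⟩, ⟨?_, ?_⟩⟩ <;> linarith
  | .node a b => (Set.union_subset_union (Set.image_mono (upperStrands_subset a))
      (Set.image_mono (upperStrands_subset b))).trans Set.subset_union_right

theorem upperStrands_height (t : Tree) {p : Space} (hp : p ∈ t.upperStrands) : 5 / 8 ≤ p 2 := by
  rcases t with _ | ⟨a, b⟩
  · rw [(segment_leaf hp).2.1]
    norm_num
  · rcases hp with hp | hp
    · exact (firstChild_upperBall_bounds a (Set.image_mono (upperStrands_subset a) hp)).2.2.1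
    · exact (secondChild_upperBall_bounds b (Set.image_mono (upperStrands_subset b) hp)).2.2.1

theorem firstChild_upperStrands_bound (t : Tree) {p : Space} (hp : p ∈ firstChild '' t.upperStrands) :
    37 / 32 ≤ p 0 := by
  obtain ⟨q, hq, rfl⟩ := hp
  have := upperStrands_height t hq
  simp only [firstChild, Matrix.cons_val]
  linarith

theorem secondChild_upperStrands_bound (t : Tree) {p : Space}
    (hp : p ∈ secondChild '' t.upperStrands) : 37 / 32 ≤ p 1 := by
  obtain ⟨q, hq, rfl⟩ := hp
  have := upperStrands_height t hq
  simp only [secondChild, Matrix.cons_val]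
  linarith

/-- At a leaf the strand passes through the hole of the rectangle. At a node the strands of a
subtree start at distance `37 / 32` from the center of the square base, whereas the rectangles of
the node end at `9 / 8 + 1 / 64`. -/
theorem disjoint_upperLink_upperStrands :
    ∀ (t : Tree), ∀ K ∈ t.upperLink, Disjoint K.solid t.upperStrands
  | .leaf, K, hK => by
    obtain rfl := List.mem_singleton.1 hK
    rw [Set.disjoint_left]
    intro p hp hs
    obtain ⟨h0, h2, -⟩ := segment_leaf hs
    refine hp.2 ⟨?_, ?_⟩
    · rw [h0]
      simp [thickness]
      norm_num
    · rw [h2]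
      simp [thickness]
      norm_num
  | .node a b, K, hK => by
    simp only [Tree.upperLink, List.mem_cons, List.mem_append, List.mem_map] at hK
    rw [Set.disjoint_left]
    rcases hK with rfl | rfl | rfl | ⟨K, hK, rfl⟩ | ⟨K, hK, rfl⟩ <;> rintro p hp (hs | hs)
    · linarith [(rectangle_bounds hp).1.2, firstChild_upperStrands_bound a hs]
    · linarith [(rectangle_bounds hp).2.1.2, secondChild_upperStrands_bound b hs]
    · linarith [(rectangle_bounds hp).1.2, firstChild_upperStrands_bound a hs]
    · linarith [(rectangle_bounds hp).2.1.2, secondChild_upperStrands_bound b hs]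
    · linarith [(rectangle_bounds hp).1.2, firstChild_upperStrands_bound a hs]
    · linarith [(rectangle_bounds hp).2.1.2, secondChild_upperStrands_bound b hs]
    · exact Set.disjoint_left.1 ((Set.disjoint_image_iff firstChild_injective).2
        (disjoint_upperLink_upperStrands a K hK)) hp hs
    · have := firstChild_upperBall_bounds a (Set.image_mono (upperLink_subset a K hK) hp)
      linarith [this.2.1.2, secondChild_upperStrands_bound b hs]
    · have := secondChild_upperBall_bounds b (Set.image_mono (upperLink_subset b K hK) hp)
      linarith [this.1.2, firstChild_upperStrands_bound a hs]
    · exact Set.disjoint_left.1 ((Set.disjoint_image_iff secondChild_injective).2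
        (disjoint_upperLink_upperStrands b K hK)) hp hs

theorem segment_root {p : Space} (hp : p ∈ segment ℝ (![-1, 0, -1] : Space) ![1, 0, -1]) :
    p 1 = 0 ∧ p 2 = -1 := by
  obtain ⟨a, b, -, -, hab, rfl⟩ := hp
  simp
  linarith

theorem disjoint_framedLink_strands (t : Tree) :
    ∀ K ∈ t.framedLink, Disjoint K.solid t.strands := by
  intro K hK
  rw [Set.disjoint_left]
  rcases List.mem_cons.1 hK with rfl | hK <;> rintro p hp (hs | hs)
  · obtain ⟨h1, h2⟩ := segment_root hs
    refine hp.2 ⟨?_, ?_⟩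
    · rw [h1]
      simp [thickness]
      norm_num
    · rw [h2]
      simp [thickness]
      norm_num
  · linarith [(rectangle_bounds hp).2.2.2, upperStrands_height t hs]
  · linarith [(segment_root hs).2, (upperBall_bounds t (upperLink_subset t K hK hp)).2.2.1]
  · exact Set.disjoint_left.1 (disjoint_upperLink_upperStrands t K hK) hp hs

theorem strands_subset_exterior (t : Tree) : t.strands ⊆ exterior t.framedLink :=
  fun _ hp K hK h => Set.disjoint_left.1 (disjoint_framedLink_strands t K hK) (interior_subset h) hp

theorem compl_ball_subset_exterior (t : Tree) : t.ballᶜ ⊆ exterior t.framedLink :=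
  fun _ hp K hK h => hp (framedLink_subset t K hK (interior_subset h))

/-- A surgery map keeps the strands in the ball. -/
theorem IsSurgeryMap.mem_ball {t : Tree} {h : Space → Space}
    (hh : IsSurgeryMap t.framedLink t.ball h) {p : Space} (hp : p ∈ t.strands)
    (hpB : p ∈ t.ball) : h p ∈ t.ball := by
  by_contra hn
  -- If `h p` were outside the ball, it would be fixed by `h`, so `h p` and `p` would have the same
  -- image; both are in the exterior, where `h` is injective.
  have := hh.2.1 (compl_ball_subset_exterior t hn) (strands_subset_exterior t hp)
    (hh.2.2.1 _ hn)
  exact hn (this.symm ▸ hpB)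

/-! ### Isotopy of links is an equivalence relation -/

theorem Link.Isotopic.trans {L L' L'' : Link l} (h : L.Isotopic L') (h' : L'.Isotopic L'') :
    L.Isotopic L'' := by
  obtain ⟨H, hH⟩ := h
  obtain ⟨K, hK⟩ := h'
  refine ⟨H.trans K, fun i => ?_⟩
  obtain ⟨f, fc, fm, fp, hf⟩ := hH i
  obtain ⟨g, gc, gm, gp, hg⟩ := hK i
  refine ⟨g ∘ f, gc.comp fc, gm.comp fm, fun t => ?_, fun t => ?_⟩
  · simp [fp, gp]
  · change K.homeo 1 (H.homeo 1 _) = _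
    rw [hf, hg]
    rfl

theorem Link.Isotopic.symm {L L' : Link l} (h : L.Isotopic L') : L'.Isotopic L := by
  obtain ⟨H, hH⟩ := h
  refine ⟨H.symm, fun i => ?_⟩
  obtain ⟨g, gc, gm, gp, hg⟩ := hH i
  -- As a lift of degree one, `g` is unbounded in both directions, hence a bijection of the line.
  let G : CircleDeg1Lift := ⟨⟨g, gm.monotone⟩, gp⟩
  have hs : Function.Surjective g := gc.surjective G.tendsto_atTop G.tendsto_atBot
  let F : ℝ ≃o ℝ := gm.orderIsoOfSurjective g hs
  have hF (t : ℝ) : g (F.symm t) = t := F.apply_symm_apply t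
  refine ⟨F.symm, F.symm.continuous, F.symm.strictMono, fun t => gm.injective ?_, fun t => ?_⟩
  · rw [hF, gp, hF]
  · change (H.homeo 1).symm _ = _
    rw [Homeomorph.symm_apply_eq, hg, hF]

/-! ### Closures of equivalent string links -/

theorem StringLink.exists_closure_eq (i : Fin l) (τ : unitInterval) :
    ∃ θ, ∀ σ : StringLink l, σ.closure.toFun i θ = σ.toFun i τ := by
  have h1 : (τ : ℝ) / 2 ≤ 1 / 2 := by linarith [τ.2.2]
  refine ⟨((τ / 2 : ℝ) : UnitAddCircle), fun σ => ?_⟩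
  rw [σ.closure_toFun i ⟨by linarith [τ.2.1], by linarith⟩, closurePath, if_pos h1,
    mul_div_cancel₀ _ two_ne_zero, Set.IccExtend_val]

/-- The alternative and the parameter do not depend on the string link, so they can be used for a
string link and the result of surgery on it at once. -/
theorem StringLink.closure_cases (i : Fin l) (θ : UnitAddCircle) :
    (∃ τ, ∀ σ : StringLink l, σ.closure.toFun i θ = σ.toFun i τ) ∨
      ∃ s ∈ Set.Icc (0 : ℝ) 1,
        ∀ σ : StringLink l, σ.closure.toFun i θ = closingArc (basePoint i) s := by
  obtain ⟨t, rfl⟩ := QuotientAddGroup.mk_surjective θ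
  have ht : Int.fract t ∈ Set.Icc (0 : ℝ) 1 := ⟨Int.fract_nonneg t, (Int.fract_lt_one t).le⟩
  have hc (σ : StringLink l) : σ.closure.toFun i (t : UnitAddCircle) =
      σ.closurePath i (Int.fract t) := by
    rw [← coe_fract_circle t, σ.closure_toFun i ht]
  rcases le_or_gt (Int.fract t) (1 / 2) with h | h
  · refine Or.inl ⟨⟨2 * Int.fract t, by linarith [ht.1], by linarith⟩, fun σ => (hc σ).trans ?_⟩
    rw [closurePath, if_pos h]
    exact Set.IccExtend_of_mem _ _ ⟨by linarith [ht.1], by linarith⟩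
  · refine Or.inr ⟨2 * Int.fract t - 1, ⟨by linarith, by linarith [ht.2]⟩,
      fun σ => (hc σ).trans ?_⟩
    rw [closurePath, if_neg (not_le.2 h)]

/-- The isotopy is supported in the open cylinder and so fixes the closing arcs. The strings are
reparametrized by `g`, compressed to the first half of the period, and the arcs not at all. -/
theorem StringLink.Isotopic.closure {σ σ' : StringLink l} (h : σ.Isotopic σ') :
    σ.closure.Isotopic σ'.closure := by
  obtain ⟨H, hH⟩ := h
  refine Link.Isotopic.of_period (e := H.homeo 1) ⟨H.mono (Set.subset_univ _), rfl⟩ 0 fun i => ?_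
  obtain ⟨g, hg⟩ := hH i
  set G : ℝ → unitInterval := Set.IccExtend zero_le_one g with hG
  have hGc : Continuous G := g.continuous.Icc_extend'
  have hmem {u : ℝ} (hu : u ∈ Set.Icc (0 : ℝ) (1 / 2)) : 2 * u ∈ Set.Icc (0 : ℝ) 1 :=
    ⟨by linarith [hu.1], by linarith [hu.2]⟩
  have hGe {u : ℝ} (hu : u ∈ Set.Icc (0 : ℝ) (1 / 2)) : G (2 * u) = g ⟨2 * u, hmem hu⟩ :=
    Set.IccExtend_of_mem _ _ (hmem hu)
  have hG1 : G 1 = 1 := by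
    rw [hG, Set.IccExtend_right]
    exact g.map_top
  have hG0 : G 0 = 0 := by
    rw [hG, Set.IccExtend_left]
    exact g.map_bot
  have hleft {u : ℝ} (hu : u ∈ Set.Icc (0 : ℝ) (1 / 2)) :
      (fun u => if u ≤ 1 / 2 then (G (2 * u) : ℝ) / 2 else u) u = (G (2 * u) : ℝ) / 2 := by
    simp only [hu.2, if_true]
  have hright {u : ℝ} (hu : u ∈ Set.Icc (1 / 2 : ℝ) 1) :
      (fun u => if u ≤ 1 / 2 then (G (2 * u) : ℝ) / 2 else u) u = u := by
    rcases hu.1.eq_or_lt with rfl | h'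
    · simp [hG1]
    · simp only [not_le.2 h', if_false]
  have hU : Set.Icc (0 : ℝ) (1 / 2) ∪ Set.Icc (1 / 2) 1 = Set.Icc (0 : ℝ) 1 :=
    Set.Icc_union_Icc_eq_Icc (by norm_num) (by norm_num)
  refine ⟨fun u => if u ≤ 1 / 2 then (G (2 * u) : ℝ) / 2 else u, ?_, ?_, ?_, ?_, ?_⟩
  · rw [← hU]
    refine ContinuousOn.union_of_isClosed ?_ ?_ isClosed_Icc isClosed_Icc
    · exact ContinuousOn.congr (by fun_prop) fun u hu => hleft hu
    · exact continuousOn_id.congr fun u hu => hright hu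
  · rw [← hU]
    refine StrictMonoOn.union (c := 1 / 2) ?_ ?_ (isGreatest_Icc (by norm_num))
      (isLeast_Icc (by norm_num))
    · refine StrictMonoOn.congr ?_ fun u hu => (hleft hu).symm
      intro s hs t ht hst
      dsimp only
      rw [hGe hs, hGe ht]
      have h2 : (⟨2 * s, hmem hs⟩ : unitInterval) < ⟨2 * t, hmem ht⟩ :=
        Subtype.mk_lt_mk.2 (by linarith)
      have h3 : (g ⟨2 * s, hmem hs⟩ : ℝ) < g ⟨2 * t, hmem ht⟩ := g.strictMono h2
      linarith
    · exact (strictMono_id.strictMonoOn _).congr fun u hu => (hright hu).symm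
  · simp [hG0]
  · exact hright ⟨by norm_num, le_rfl⟩
  · intro u hu
    rw [Pi.zero_apply, zero_add, σ.closure_toFun i hu]
    rcases le_or_gt u (1 / 2) with h | h
    · have h1 : (G (2 * u) : ℝ) / 2 ≤ 1 / 2 := by linarith [(G (2 * u)).2.2]
      rw [hleft ⟨hu.1, h⟩, σ'.closure_toFun i ⟨by linarith [(G (2 * u)).2.1], by linarith⟩,
        StringLink.closurePath, StringLink.closurePath, if_pos h, if_pos h1,
        mul_div_cancel₀ _ two_ne_zero, Set.IccExtend_val, hGe ⟨hu.1, h⟩, ← hg,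
        Set.IccExtend_of_mem _ _ (hmem ⟨hu.1, h⟩)]
    · rw [hright ⟨h.le, hu.2⟩, σ'.closure_toFun i hu, StringLink.closurePath,
        StringLink.closurePath, if_neg (not_le.2 h), if_neg (not_le.2 h)]
      exact H.fixed _ _ (closingArc_notMem_openCylinder (basePoint_mem i)
        ⟨by linarith, by linarith [hu.2]⟩)

/-- A tree clasper for a string link is a tree clasper for its closure. -/
def TreeClasper.closure {σ : StringLink l} (C : TreeClasper openCylinder σ.toFun) :
    TreeClasper Set.univ σ.closure.toFun where
  tree := C.tree
  place := C.place
  orientationPreserving := C.orientationPreserving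
  ball_subset := Set.subset_univ _
  inter_ball := by
    rw [← C.inter_ball]
    ext p
    refine and_congr_left fun hp => ?_
    simp only [Set.mem_iUnion, Set.mem_range]
    constructor
    · rintro ⟨i, θ, rfl⟩
      rcases StringLink.closure_cases i θ with ⟨τ, h⟩ | ⟨s, hs, h⟩
      · exact ⟨i, τ, (h σ).symm⟩
      · rw [h] at hp
        exact absurd (C.ball_subset hp) (closingArc_notMem_openCylinder (basePoint_mem i) hs)
    · rintro ⟨i, τ, rfl⟩
      obtain ⟨θ, h⟩ := StringLink.exists_closure_eq i τ
      exact ⟨i, θ, h σ⟩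

theorem TreeClasper.IsSelf.closure {σ : StringLink l} {C : TreeClasper openCylinder σ.toFun}
    (h : C.IsSelf) : C.closure.IsSelf := by
  obtain ⟨i, hi⟩ := h
  refine ⟨i, fun j hj => Set.disjoint_left.2 ?_⟩
  rintro _ ⟨θ, rfl⟩ hp
  rcases StringLink.closure_cases j θ with ⟨τ, h⟩ | ⟨s, hs, h⟩ <;> rw [h] at hp
  · exact Set.disjoint_left.1 (hi j hj) ⟨τ, rfl⟩ hp
  · exact closingArc_notMem_openCylinder (basePoint_mem j) hs (C.ball_subset hp)

/-- The same surgery map serves, because it is the identity outside the ball and hence on the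
closing arcs. -/
theorem TreeClasper.IsResult.closure {σ σ' : StringLink l} {C : TreeClasper openCylinder σ.toFun}
    (h : C.IsResult σ'.toFun) : C.closure.IsResult σ'.closure.toFun := by
  obtain ⟨f, hf, hfr⟩ := h
  refine ⟨f, hf, fun i θ => ?_⟩
  change _ = C.place (f (C.place.symm _))
  rcases StringLink.closure_cases i θ with ⟨τ, h⟩ | ⟨s, hs, h⟩
  · rw [h, h, hfr]
  · rw [h, h, hf.2.2.1, C.place.apply_symm_apply]
    intro hp
    exact closingArc_notMem_openCylinder (basePoint_mem i) hs
      (C.ball_subset ⟨_, hp, C.place.apply_symm_apply _⟩)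

/-! ### Claspers of links in standard form -/

theorem IsStandardForm.mem_openCylinder_cases {L : Link l} {B : Set Space} {e : Space ≃ₜ Space}
    {a b : Fin l → ℝ} (h : IsStandardForm L B e a b) (i : Fin l) (θ : UnitAddCircle)
    (hθ : e (L.toFun i θ) ∈ openCylinder) :
    ∃ τ : unitInterval, θ = (((a i + 1 - b i) * τ + b i : ℝ) : UnitAddCircle) := by
  obtain ⟨hab, hba, harc, -⟩ := h.2 i
  obtain ⟨t, ht, rfl⟩ : ∃ t ∈ Set.Ico (a i) (a i + 1), (t : UnitAddCircle) = θ :=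
    (AddCircle.coe_image_Ico_eq (1 : ℝ) (a i)).ge (Set.mem_univ θ)
  rcases le_or_gt t (b i) with htb | htb
  · obtain ⟨s, hs, h1⟩ := harc t ⟨ht.1, htb⟩
    rw [← h1] at hθ
    exact absurd hθ (closingArc_notMem_openCylinder (basePoint_mem i) hs)
  · have hd : 0 < a i + 1 - b i := by linarith
    refine ⟨⟨(t - b i) / (a i + 1 - b i), div_nonneg (by linarith) hd.le, ?_⟩, ?_⟩
    · rw [div_le_one hd]
      linarith [ht.2]
    · rw [mul_div_cancel₀ _ hd.ne', sub_add_cancel]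

/-- The surgery along a tree clasper for a link is, up to isotopy, the closure of the surgery along
a tree clasper for a string link. -/
theorem TreeClasper.exists_stringLink {L L' : Link l} (C : TreeClasper Set.univ L.toFun)
    (hC : C.IsResult L'.toFun) : ∃ σ σ' : StringLink l, L.Isotopic σ.closure ∧
      L'.Isotopic σ'.closure ∧ ∃ C' : TreeClasper openCylinder σ.toFun,
        C'.degree = C.degree ∧ (C.IsSelf → C'.IsSelf) ∧ C'.IsResult σ'.toFun := by
  obtain ⟨f, hf, hfr⟩ := hC
  set B : Set Space := C.place '' C.tree.ball with hBdef
  have hsymm {p : Space} : p ∈ B ↔ C.place.symm p ∈ C.tree.ball := by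
    rw [hBdef, C.place.image_eq_preimage_symm]
    rfl
  have hB : IsCompact B := (isCompact_ball _).image C.place.continuous
  have hBc : IsPreconnected Bᶜ := by
    rw [hBdef, ← Set.image_compl_eq C.place.bijective]
    exact (isPreconnected_compl_ball _).image _ C.place.continuous.continuousOn
  have hstrand {i : Fin l} {θ : UnitAddCircle} (h : L.toFun i θ ∈ B) :
      C.place.symm (L.toFun i θ) ∈ C.tree.strands := by
    have h1 : L.toFun i θ ∈ C.place '' C.tree.strands :=
      C.inter_ball ▸ ⟨Set.mem_iUnion.2 ⟨i, θ, rfl⟩, h⟩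
    obtain ⟨q, hq, h2⟩ := h1
    rwa [← h2, C.place.symm_apply_apply]
  have hL : ∀ i, ¬ Set.range (L.toFun i) ⊆ B := fun i h =>
    not_range_subset_strands C.tree (f := fun θ => C.place.symm (L.toFun i θ))
      (C.place.symm.continuous.comp (L.continuous i))
      (C.place.symm.injective.comp (L.injective_component i)) (by
        rintro _ ⟨θ, rfl⟩
        exact hstrand (h ⟨θ, rfl⟩))
  obtain ⟨e, he, a, b, hst⟩ := L.exists_isStandardForm hB hBc hL
  have hoff {i : Fin l} {θ : UnitAddCircle} (h : e (L.toFun i θ) ∉ openCylinder) :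
      L'.toFun i θ = L.toFun i θ := by
    rw [hfr, hf.2.2.1 _ fun h' => h (hst.1 _ (hsymm.2 h')), C.place.apply_symm_apply]
  have harc {i : Fin l} {s : ℝ} {θ : UnitAddCircle} (hs : s ∈ Set.Icc (0 : ℝ) 1)
      (h : closingArc (basePoint i) s = e (L.toFun i θ)) : L'.toFun i θ = L.toFun i θ :=
    hoff (h ▸ closingArc_notMem_openCylinder (basePoint_mem i) hs)
  -- The homeomorphism found for `L` works for `L'`: on the closing arcs, which stay outside the
  -- image of `B`, the two links agree, and the points of `L` in `B` stay in `B` under surgery.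
  have hst' : IsStandardForm L' B e a b := by
    refine ⟨hst.1, fun i => ?_⟩
    obtain ⟨hab, hba, h1, h2, h3, h4⟩ := hst.2 i
    have h5 : ∀ t ∈ Set.Icc (a i) (b i), L'.toFun i (t : UnitAddCircle) = L.toFun i t := by
      intro t ht
      obtain ⟨s, hs, h⟩ := h1 t ht
      exact harc hs h
    refine ⟨hab, hba, fun t ht => ?_, ?_, ?_, fun t ht => ?_⟩
    · rw [h5 t ht]
      exact h1 t ht
    · rw [h5 _ (Set.left_mem_Icc.2 hab.le), h2]
    · rw [h5 _ (Set.right_mem_Icc.2 hab.le), h3]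
    · by_cases hp : L.toFun i (t : UnitAddCircle) ∈ B
      · refine hst.1 _ ?_
        rw [hfr]
        exact ⟨_, hf.mem_ball (hstrand hp) (hsymm.1 hp), rfl⟩
      · rw [hfr, hf.2.2.1 _ fun h => hp (hsymm.2 h), C.place.apply_symm_apply]
        exact h4 t ht
  have hBe : (C.place.trans e) '' C.tree.ball = e '' B := by
    rw [hBdef, Set.image_image]
    rfl
  -- The new clasper has the same tree, placed by `C.place` followed by `e`, and the same surgery
  -- map `f` gives the result.
  refine ⟨hst.stringLink he.isPLOn, hst'.stringLink he.isPLOn, hst.isotopic_closure he,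
    hst'.isotopic_closure he, ⟨C.tree, C.place.trans e, IsotopicToId.trans C.orientationPreserving he, ?_, ?_⟩,
    rfl, ?_, f, hf, ?_⟩
  · rw [hBe]
    rintro _ ⟨p, hp, rfl⟩
    exact hst.1 p hp
  · have h1 : (C.place.trans e) '' C.tree.strands = e '' (C.place '' C.tree.strands) := by
      rw [Set.image_image]
      rfl
    rw [hBe, h1, ← C.inter_ball, Set.image_inter e.injective]
    ext p
    refine and_congr_left ?_
    rintro ⟨q, hq, rfl⟩
    simp only [Set.mem_iUnion, Set.mem_range, Set.mem_image]
    constructor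
    · rintro ⟨i, τ, h⟩
      exact ⟨q, ⟨i, _, e.injective h⟩, rfl⟩
    · rintro ⟨_, ⟨i, θ, rfl⟩, h⟩
      obtain rfl := e.injective h
      obtain ⟨τ, rfl⟩ := hst.mem_openCylinder_cases i θ (hst.1 _ hq)
      exact ⟨i, τ, rfl⟩
  · rintro ⟨i, hi⟩
    refine ⟨i, fun j hj => Set.disjoint_left.2 ?_⟩
    rintro _ ⟨τ, rfl⟩ hp
    have hp' : e (L.toFun j (((a j + 1 - b j) * τ + b j : ℝ) : UnitAddCircle)) ∈ e '' B :=
      hBe ▸ hp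
    exact Set.disjoint_left.1 (hi j hj) ⟨_, rfl⟩ (e.injective.mem_set_image.1 hp')
  · intro i τ
    change e (L'.toFun i _) = e (C.place (f (C.place.symm (e.symm (e (L.toFun i _))))))
    rw [e.symm_apply_apply, ← hfr]

theorem Link.exists_isotopic_closure (L : Link l) : ∃ σ : StringLink l, L.Isotopic σ.closure := by
  obtain ⟨e, he, a, b, h⟩ := L.exists_isStandardForm (B := ∅) isCompact_empty
    (by simpa using isPreconnected_univ) fun i h => h ⟨0, rfl⟩
  exact ⟨h.stringLink he.isPLOn, h.isotopic_closure he⟩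

/-! ### The equivalence relations on links and on string links -/

/-- Surgery along a tree clasper of degree at least `n` that satisfies `IsSelf` if `P` holds. -/
def Surgery (n : ℕ) (P : Prop) (U : Set Space) {ι X : Type} (T T' : ι → X → Space) : Prop :=
  ∃ C : TreeClasper U T, n ≤ C.degree ∧ (P → C.IsSelf) ∧ C.IsResult T'

/-- `C_n`-equivalence or Self-`C_n`-equivalence of links, depending on `P`. -/
def Link.SurgeryEquiv (n : ℕ) (P : Prop) : Link l → Link l → Prop :=
  Relation.EqvGen fun L L' => L.Isotopic L' ∨ Surgery n P Set.univ L.toFun L'.toFun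

/-- `C_n`-equivalence or Self-`C_n`-equivalence of string links, depending on `P`. -/
def StringLink.SurgeryEquiv (n : ℕ) (P : Prop) : StringLink l → StringLink l → Prop :=
  Relation.EqvGen fun σ σ' => σ.Isotopic σ' ∨ Surgery n P openCylinder σ.toFun σ'.toFun

theorem StringLink.SurgeryEquiv.closure {n : ℕ} {P : Prop} {σ σ' : StringLink l}
    (h : σ.SurgeryEquiv n P σ') : σ.closure.SurgeryEquiv n P σ'.closure := by
  induction h with
  | rel σ σ' h =>
    refine Relation.EqvGen.rel _ _ (h.imp StringLink.Isotopic.closure ?_)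
    rintro ⟨C, hn, hs, hr⟩
    exact ⟨C.closure, hn, fun h => (hs h).closure, hr.closure⟩
  | refl σ => exact Relation.EqvGen.refl _
  | symm σ σ' _ ih => exact ih.symm
  | trans σ σ' σ'' _ _ ih ih' => exact ih.trans _ _ _ ih'

/-- Finite sequences are replaced by a reflexive transitive closure, which allows induction on
steps. -/
theorem joinedByStringLinks_iff {E : StringLink l → StringLink l → Prop} {L L' : Link l} :
    JoinedByStringLinks E L L' ↔ ∃ σ σ' : StringLink l, L.Isotopic σ.closure ∧
      L'.Isotopic σ'.closure ∧
        Relation.ReflTransGen (fun σ σ' => E σ σ' ∨ σ.closure.Isotopic σ'.closure) σ σ' := by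
  constructor
  · rintro ⟨m, σ, h, h', hσ⟩
    refine ⟨_, _, h, h', ?_⟩
    have main (k : Fin (m + 1)) : Relation.ReflTransGen
        (fun σ σ' => E σ σ' ∨ σ.closure.Isotopic σ'.closure) (σ 0) (σ k) := by
      induction k using Fin.induction with
      | zero => exact .refl
      | succ i ih => exact ih.tail (hσ i)
    exact main _
  · rintro ⟨σ, σ', h, h', hσ⟩
    have main : ∃ (m : ℕ) (f : ℕ → StringLink l), f 0 = σ ∧ f m = σ' ∧
        ∀ k < m, E (f k) (f (k + 1)) ∨ (f k).closure.Isotopic (f (k + 1)).closure := by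
      clear h
      induction hσ using Relation.ReflTransGen.head_induction_on with
      | refl => exact ⟨0, fun _ => σ', rfl, rfl, fun k hk => absurd hk (Nat.not_lt_zero k)⟩
      | @head τ _ h1 _ ih =>
        obtain ⟨m, f, rfl, hm, hf⟩ := ih
        refine ⟨m + 1, fun k => Nat.casesOn k τ f, rfl, hm, fun k hk => ?_⟩
        cases k with
        | zero => exact h1
        | succ k => exact hf k (Nat.lt_of_succ_lt_succ hk)
    obtain ⟨m, f, rfl, rfl, hf⟩ := main
    exact ⟨m, fun k => f k, h, h', fun i => hf i i.2⟩

/-- Induction on how the equivalence is generated; the only generator with content is a surgery,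
settled by `TreeClasper.exists_stringLink`. -/
theorem Link.SurgeryEquiv.joinedByStringLinks {n : ℕ} {P : Prop} {L L' : Link l}
    (h : L.SurgeryEquiv n P L') : JoinedByStringLinks (StringLink.SurgeryEquiv n P) L L' := by
  rw [joinedByStringLinks_iff]
  induction h with
  | rel L L' h =>
    rcases h with h | ⟨C, hn, hs, hr⟩
    · obtain ⟨σ, hσ⟩ := L.exists_isotopic_closure
      exact ⟨σ, σ, hσ, h.symm.trans hσ, .refl⟩
    · obtain ⟨σ, σ', h, h', C', hd, hs', hr'⟩ := C.exists_stringLink hr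
      exact ⟨σ, σ', h, h', .single (Or.inl (Relation.EqvGen.rel _ _
        (Or.inr ⟨C', hd ▸ hn, fun p => hs' (hs p), hr'⟩)))⟩
  | refl L =>
    obtain ⟨σ, hσ⟩ := L.exists_isotopic_closure
    exact ⟨σ, σ, hσ, hσ, .refl⟩
  | symm L L' _ ih =>
    obtain ⟨σ, σ', h, h', hσ⟩ := ih
    refine ⟨σ', σ, h', h, ?_⟩
    rw [← Relation.reflTransGen_swap]
    exact Relation.ReflTransGen.mono (fun _ _ h => h.imp (fun h => h.symm) fun h => h.symm) _ _ hσ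
  | trans L L' L'' _ _ ih ih' =>
    obtain ⟨σ₁, σ₂, h₁, h₂, h⟩ := ih
    obtain ⟨σ₃, σ₄, h₃, h₄, h'⟩ := ih'
    -- The two chains meet in string links `σ₂` and `σ₃` whose closures are both isotopic to `L'`,
    -- which supplies one more admissible step.
    exact ⟨σ₁, σ₄, h₁, h₄, (h.tail (Or.inr (h₂.symm.trans h₃))).trans h'⟩

theorem Link.surgeryEquiv_of_joinedByStringLinks {n : ℕ} {P : Prop} {L L' : Link l}
    (h : JoinedByStringLinks (StringLink.SurgeryEquiv n P) L L') : L.SurgeryEquiv n P L' := by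
  obtain ⟨σ, σ', h, h', hσ⟩ := joinedByStringLinks_iff.1 h
  have iso {K K' : Link l} (h : K.Isotopic K') : K.SurgeryEquiv n P K' :=
    Relation.EqvGen.rel _ _ (Or.inl h)
  have main : σ.closure.SurgeryEquiv n P σ'.closure := by
    clear h h'
    induction hσ with
    | refl => exact Relation.EqvGen.refl _
    | tail _ h ih => exact ih.trans _ _ _ (h.elim StringLink.SurgeryEquiv.closure iso)
  exact ((iso h).trans _ _ _ main).trans _ _ _ (iso h'.symm)

theorem Link.surgeryEquiv_iff {n : ℕ} {P : Prop} {L L' : Link l} :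
    L.SurgeryEquiv n P L' ↔ JoinedByStringLinks (StringLink.SurgeryEquiv n P) L L' :=
  ⟨Link.SurgeryEquiv.joinedByStringLinks, Link.surgeryEquiv_of_joinedByStringLinks⟩

end Clasper

theorem proposition5p2 (n l : ℕ) (hn : 1 ≤ n) (hl : 1 ≤ l) (L L' : Clasper.Link l) :
    (Clasper.Link.CEquiv n L L' ↔
      Clasper.JoinedByStringLinks (Clasper.StringLink.CEquiv n) L L') ∧
    (Clasper.Link.SelfCEquiv n L L' ↔
      Clasper.JoinedByStringLinks (Clasper.StringLink.SelfCEquiv n) L L') := by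
  -- With `P = False` the condition on the leaves is vacuous; with `P = True` it is imposed on every
  -- clasper.
  have h1 := Clasper.Link.surgeryEquiv_iff (n := n) (P := False) (L := L) (L' := L')
  have h2 := Clasper.Link.surgeryEquiv_iff (n := n) (P := True) (L := L) (L' := L')
  simp only [Clasper.Link.SurgeryEquiv, Clasper.StringLink.SurgeryEquiv, Clasper.Surgery,
    false_imp_iff, true_imp_iff, true_and] at h1 h2
  exact ⟨h1, h2⟩
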